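/- **Theorem (PTAS for maximum bipartite subgraph on unit squares and unit disks).** A unit disk is a closed disk of radius $1$ and a unit square is a closed axis-parallel square of side length $1$ in the plane $\mathbb{R}^2$. For a finite family $S=(S_1,\dots,S_n)$ of such objects, given by the real coordinates of their centres, call $T\subseteq\{1,\dots,n\}$ feasible if the intersection graph of the objects $S_i$, $i\in T$ (distinct indices $i,j$ are adjacent iff $S_i\cap S_j\neq\emptyset$) is bipartite. The maximum bipartite subgraph problem (MBS) asks for a feasible $T$ with $|T|$ maximum. In weighted MBS each object additionally has a real weight $w_i$, and $\sum_{i\in T}w_i$ is to be maximized over the feasible $T$. The model of computation is the real RAM: natural-number and real-number memory cells with indirect addressing, unit-cost comparisons, addition and truncated subtraction of natural numbers, and $+,-,\times,/$ on real numbers, without a rounding operation. (a) There are a real RAM program and constants $K,A,B$ such that, for every real $\varepsilon>0$, every $n$ and every family of $n$ unit squares, the program on input $\varepsilon$ and the family halts after at most $K\cdot n^{A}\cdot n^{B/\varepsilon}$ steps (at most $K$ steps if $n=0$) and returns a feasible set $T^*$ with $|T|\le(1+\varepsilon)\,|T^*|$ for every feasible $T$. That is, MBS on unit squares has a PTAS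 running in $n^{O(1)}\cdot n^{O(1/\varepsilon)}$ time. (b) The same holds for weighted MBS on unit disks, and for weighted MBS on unit squares, with arbitrary real weights $w_1,\dots,w_n$ as part of the input and $\sum_{i\in T}w_i\le(1+\varepsilon)\sum_{i\in T^*}w_i$ for every feasible $T$; the constants do not depend on the weights. -/

import Mathlib

/-! ### The geometric problem -/

/-- The Euclidean plane. -/
abbrev Plane : Type := EuclideanSpace ℝ (Fin 2)

/-- The unit disk with centre `c`: the closed disk of radius `1`. -/
def unitDisk (c : Plane) : Set Plane := Metric.closedBall c 1

/-- The unit square with centre `c`: the closed axis-parallel square of side length `1`. -/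
def unitSquare (c : Plane) : Set Plane := {p | ∀ i, |p i - c i| ≤ 1 / 2}

/-- The intersection graph of an indexed family of subsets of the plane. -/
def intersectionGraph {V : Type*} (obj : V → Set Plane) : SimpleGraph V where
  Adj i j := i ≠ j ∧ (obj i ∩ obj j).Nonempty
  symm := ⟨fun _ _ h => ⟨h.1.symm, by rw [Set.inter_comm]; exact h.2⟩⟩
  loopless := ⟨fun _ h => h.1 rfl⟩

/-- `T` is a feasible solution of the maximum bipartite subgraph problem for the family `obj`:
the intersection graph of the objects in `T` is bipartite. -/
def IsFeasible {n : ℕ} (obj : Fin n → Set Plane) (T : Finset (Fin n)) : Prop :=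
  ((intersectionGraph obj).induce (T : Set (Fin n))).IsBipartite

/-! ### The machine model

A real random access machine, programmed in a structured language. Its memory consists of
arrays of natural numbers and arrays of real numbers, addressed indirectly through natural
numbers. A program names finitely many arrays; a single register is a fixed cell of an array.
The unit-cost operations are reading or writing a cell, loading a constant, addition and
truncated subtraction of natural numbers, the four arithmetic operations on real numbers,
and comparisons of two natural or of two real numbers. There is no rounding operation
(no passage from real numbers to natural numbers other than through comparisons), and there
is no multiplication of natural numbers. -/

namespace RealRAM

/-- The contents of the memory: `nat a i` and `real a i` are the cells with index `i` of the
natural-number array `a` and of the real-number array `a`. -/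
structure Store where
  nat : ℕ → ℕ → ℕ
  real : ℕ → ℕ → ℝ

/-- Expressions with a natural number as value; `get a i` reads cell `i` of array `a`. -/
inductive NatExpr where
  | lit (k : ℕ)
  | get (a : ℕ) (i : NatExpr)
  | add (e f : NatExpr)
  | sub (e f : NatExpr)

/-- Expressions with a real number as value; `get a i` reads cell `i` of array `a`. -/
inductive RealExpr where
  | lit (q : ℚ)
  | get (a : ℕ) (i : NatExpr)
  | add (e f : RealExpr)
  | sub (e f : RealExpr)
  | mul (e f : RealExpr)
  | div (e f : RealExpr)

/-- Tests. -/
inductive Test where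
  | natLe (e f : NatExpr)
  | realLe (e f : RealExpr)
  | neg (b : Test)
  | and (b c : Test)

/-- Programs; `setNat a i e` and `setReal a i e` write the value of `e` into cell `i` of
array `a`. -/
inductive Prog where
  | skip
  | setNat (a : ℕ) (i e : NatExpr)
  | setReal (a : ℕ) (i : NatExpr) (e : RealExpr)
  | seq (p q : Prog)
  | ite (b : Test) (p q : Prog)
  | loop (b : Test) (p : Prog)

/-- The value of an expression. -/
def NatExpr.eval (s : Store) : NatExpr → ℕ
  | lit k => k
  | get a i => s.nat a (i.eval s)
  | add e f => e.eval s + f.eval s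
  | sub e f => e.eval s - f.eval s

/-- The number of operations that the evaluation of an expression takes. -/
def NatExpr.cost : NatExpr → ℕ
  | lit _ => 1
  | get _ i => i.cost + 1
  | add e f => e.cost + f.cost + 1
  | sub e f => e.cost + f.cost + 1

/-- The value of an expression. -/
noncomputable def RealExpr.eval (s : Store) : RealExpr → ℝ
  | lit q => (q : ℝ)
  | get a i => s.real a (i.eval s)
  | add e f => e.eval s + f.eval s
  | sub e f => e.eval s - f.eval s
  | mul e f => e.eval s * f.eval s
  | div e f => e.eval s / f.eval s

/-- The number of operations that the evaluation of an expression takes. -/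
def RealExpr.cost : RealExpr → ℕ
  | lit _ => 1
  | get _ i => i.cost + 1
  | add e f => e.cost + f.cost + 1
  | sub e f => e.cost + f.cost + 1
  | mul e f => e.cost + f.cost + 1
  | div e f => e.cost + f.cost + 1

/-- The truth of a test. -/
def Test.Holds (s : Store) : Test → Prop
  | natLe e f => e.eval s ≤ f.eval s
  | realLe e f => e.eval s ≤ f.eval s
  | neg b => ¬ b.Holds s
  | and b c => b.Holds s ∧ c.Holds s

/-- The number of operations that a test takes. -/
def Test.cost : Test → ℕ
  | natLe e f => e.cost + f.cost + 1
  | realLe e f => e.cost + f.cost + 1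
  | neg b => b.cost + 1
  | and b c => b.cost + c.cost + 1

/-- The store after writing `v` into cell `i` of the natural-number array `a`. -/
def Store.writeNat (s : Store) (a i v : ℕ) : Store where
  nat := Function.update s.nat a (Function.update (s.nat a) i v)
  real := s.real

/-- The store after writing `v` into cell `i` of the real-number array `a`. -/
noncomputable def Store.writeReal (s : Store) (a i : ℕ) (v : ℝ) : Store where
  nat := s.nat
  real := Function.update s.real a (Function.update (s.real a) i v)

/-- `Exec p s t s'`: started in the store `s`, the program `p` halts after `t` steps in the
store `s'`. -/
inductive Exec : Prog → Store → ℕ → Store → Prop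
  | skip (s : Store) : Exec .skip s 1 s
  | setNat (a : ℕ) (i e : NatExpr) (s : Store) :
      Exec (.setNat a i e) s (i.cost + e.cost + 1) (s.writeNat a (i.eval s) (e.eval s))
  | setReal (a : ℕ) (i : NatExpr) (e : RealExpr) (s : Store) :
      Exec (.setReal a i e) s (i.cost + e.cost + 1) (s.writeReal a (i.eval s) (e.eval s))
  | seq {p q : Prog} {s s' s'' : Store} {t t' : ℕ} (h : Exec p s t s') (h' : Exec q s' t' s'') :
      Exec (.seq p q) s (t + t') s''
  | iteTrue {b : Test} {p q : Prog} {s s' : Store} {t : ℕ} (hb : b.Holds s) (h : Exec p s t s') :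
      Exec (.ite b p q) s (b.cost + 1 + t) s'
  | iteFalse {b : Test} {p q : Prog} {s s' : Store} {t : ℕ} (hb : ¬ b.Holds s)
      (h : Exec q s t s') : Exec (.ite b p q) s (b.cost + 1 + t) s'
  | loopTrue {b : Test} {p : Prog} {s s' s'' : Store} {t t' : ℕ} (hb : b.Holds s)
      (h : Exec p s t s') (h' : Exec (.loop b p) s' t' s'') :
      Exec (.loop b p) s (b.cost + 1 + t + t') s''
  | loopFalse {b : Test} {p : Prog} {s : Store} (hb : ¬ b.Holds s) :
      Exec (.loop b p) s (b.cost + 1) s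

/-- Programs are deterministic: the running time and the final store are unique. -/
theorem Exec.unique {p : Prog} {s s₁ s₂ : Store} {t₁ t₂ : ℕ} (h₁ : Exec p s t₁ s₁)
    (h₂ : Exec p s t₂ s₂) : t₁ = t₂ ∧ s₁ = s₂ := by
  induction h₁ generalizing t₂ s₂ with
  | skip => cases h₂; exact ⟨rfl, rfl⟩
  | setNat => cases h₂; exact ⟨rfl, rfl⟩
  | setReal => cases h₂; exact ⟨rfl, rfl⟩
  | seq _ _ ih ih' =>
    cases h₂ with
    | seq k k' =>
      obtain ⟨rfl, rfl⟩ := ih k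
      obtain ⟨rfl, rfl⟩ := ih' k'
      exact ⟨rfl, rfl⟩
  | iteTrue hb _ ih =>
    cases h₂ with
    | iteTrue _ k => obtain ⟨rfl, rfl⟩ := ih k; exact ⟨rfl, rfl⟩
    | iteFalse hb' _ => exact absurd hb hb'
  | iteFalse hb _ ih =>
    cases h₂ with
    | iteTrue hb' _ => exact absurd hb' hb
    | iteFalse _ k => obtain ⟨rfl, rfl⟩ := ih k; exact ⟨rfl, rfl⟩
  | loopTrue hb _ _ ih ih' =>
    cases h₂ with
    | loopTrue _ k k' =>
      obtain ⟨rfl, rfl⟩ := ih k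
      obtain ⟨rfl, rfl⟩ := ih' k'
      exact ⟨rfl, rfl⟩
    | loopFalse hb' => exact absurd hb hb'
  | loopFalse hb =>
    cases h₂ with
    | loopTrue hb' _ _ => exact absurd hb' hb
    | loopFalse _ => exact ⟨rfl, rfl⟩

end RealRAM

/-! ### Inputs, outputs, approximation schemes -/

/-- The array that holds the values of `f`, followed by zeros. -/
noncomputable def tabulate {n : ℕ} (f : Fin n → ℝ) (i : ℕ) : ℝ :=
  if h : i < n then f ⟨i, h⟩ else 0

/-- The input of a weighted instance: the number `n` of objects in the first cell of the
natural-number array `0`, the accuracy `ε` in the first cell of the real-number array `0`, the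
coordinates of the centres in the real-number arrays `1` and `2`, and the weights in the
real-number array `3`. All other cells hold `0`. -/
noncomputable def weightedInput {n : ℕ} (ε : ℝ) (c : Fin n → Plane) (w : Fin n → ℝ) :
    RealRAM.Store where
  nat a i := if a = 0 ∧ i = 0 then n else 0
  real a i :=
    match a with
    | 0 => if i = 0 then ε else 0
    | 1 => tabulate (fun j => c j 0) i
    | 2 => tabulate (fun j => c j 1) i
    | 3 => tabulate w i
    | _ => 0

/-- The input of an unweighted instance: the same without weights (array `3` holds zeros). -/
noncomputable def unweightedInput {n : ℕ} (ε : ℝ) (c : Fin n → Plane) : RealRAM.Store :=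
  weightedInput ε c (fun _ => 0)

/-- The set of objects returned: those whose cell in the natural-number array `1` is not `0`. -/
def outputSet (n : ℕ) (s : RealRAM.Store) : Finset (Fin n) :=
  Finset.univ.filter fun i => s.nat 1 i ≠ 0

/-- The number `t` of steps is at most `K · n ^ A · n ^ (B / ε)`, with `n` read as `1` for an
empty instance. -/
def WithinTime (K A B : ℝ) (n : ℕ) (ε : ℝ) (t : ℕ) : Prop :=
  (t : ℝ) ≤ K * ((max n 1 : ℕ) : ℝ) ^ A * ((max n 1 : ℕ) : ℝ) ^ (B / ε)

/-- `P` is a polynomial-time approximation scheme, running in time `n ^ O(1) · n ^ O(1 / ε)`,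
for the maximum bipartite subgraph problem on families of objects of the given shape. -/
def IsPTAS (shape : Plane → Set Plane) (P : RealRAM.Prog) : Prop :=
  ∃ K A B : ℝ, ∀ (ε : ℝ), 0 < ε → ∀ (n : ℕ) (c : Fin n → Plane),
    ∃ (t : ℕ) (s : RealRAM.Store),
      RealRAM.Exec P (unweightedInput ε c) t s ∧ WithinTime K A B n ε t ∧
      IsFeasible (fun i => shape (c i)) (outputSet n s) ∧
      ∀ T : Finset (Fin n), IsFeasible (fun i => shape (c i)) T →
        (T.card : ℝ) ≤ (1 + ε) * ((outputSet n s).card : ℝ)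

/-- `P` is a polynomial-time approximation scheme, running in time `n ^ O(1) · n ^ O(1 / ε)`,
for the weighted maximum bipartite subgraph problem on families of objects of the given
shape. -/
def IsWeightedPTAS (shape : Plane → Set Plane) (P : RealRAM.Prog) : Prop :=
  ∃ K A B : ℝ, ∀ (ε : ℝ), 0 < ε → ∀ (n : ℕ) (c : Fin n → Plane) (w : Fin n → ℝ),
    ∃ (t : ℕ) (s : RealRAM.Store),
      RealRAM.Exec P (weightedInput ε c w) t s ∧ WithinTime K A B n ε t ∧
      IsFeasible (fun i => shape (c i)) (outputSet n s) ∧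
      ∀ T : Finset (Fin n), IsFeasible (fun i => shape (c i)) T →
        ∑ i ∈ T, w i ≤ (1 + ε) * ∑ i ∈ outputSet n s, w i

/-! The scheme combines shifting in the second coordinate with a sweep along the first. Without a
rounding operation the plane cannot be cut by a grid, so the level of a value takes the place of its
integer part: the length of the longest chain of jumps of length more than 2 that ends in it. Values
of equal level differ by at most 2 (`abs_sub_le_of_level_eq`), and values at distance at most 2 have
levels that differ by at most 1 (`level_le_succ`). Comparisons suffice to compute levels.

Fix k with (k - 1)ε ≥ 1. For each residue r the objects with y-level congruent to r modulo k are
dropped. An object is lost for exactly one r, so the restrictions of an optimal solution have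
average weight (k - 1)/k of the whole, and the best of them loses at most the factor 1 + ε
(`colorWeight_le_of_shifts`). If this requires more than n + 1 shifts, then k = n + 1 is enough,
because some residue is the level of no object.

For fixed r the remaining objects form strips of at most k - 1 consecutive y-levels, and objects of
different strips are disjoint. The strips are laid one after the other and swept by x-level. The
group number n · strip + x-level encodes this order, and intersecting objects have group numbers
that differ by at most 1 (`groupOf_le_succ`). A partial colouring with two colours therefore matters
for the future only through its trace on the last two groups, and for each trace one heaviest
colouring is kept (`IsFront.step`).

The number of traces is small by packing (`traceBound_groupOf`). Within a level the values split
into two halves of diameter at most 1, and two objects that agree in both levels and both halves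
intersect, so they cannot have the same colour. A trace thus has at most one object for each choice
of group, two halves, colour and y-level modulo k, that is, in each of 16k cells. This leaves at
most (n + 1)^(16k) traces, and k ≤ 2 + 1/ε gives the exponent O(1) + O(1/ε).

All running times are proved in the form constant times a power of one number M that bounds both n +
1 and the number of traces. The argument uses the shape only through `IsShapeTest`, which covers
disks and squares alike. -/

/-! ### Program logic for the real RAM -/

namespace RealRAM

section Store

variable (s : Store) (a b i v : ℕ) (x : ℝ)

@[simp] theorem Store.writeNat_nat_self :
    (s.writeNat a i v).nat a = Function.update (s.nat a) i v := by
  simp [Store.writeNat]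

@[simp] theorem Store.writeNat_nat_of_ne {a b : ℕ} (h : b ≠ a) :
    (s.writeNat a i v).nat b = s.nat b := by
  simp [Store.writeNat, h]

@[simp] theorem Store.writeNat_real : (s.writeNat a i v).real = s.real := rfl

@[simp] theorem Store.writeReal_real_self :
    (s.writeReal a i x).real a = Function.update (s.real a) i x := by
  simp [Store.writeReal]

@[simp] theorem Store.writeReal_real_of_ne {a b : ℕ} (h : b ≠ a) :
    (s.writeReal a i x).real b = s.real b := by
  simp [Store.writeReal, h]

@[simp] theorem Store.writeReal_nat : (s.writeReal a i x).nat = s.nat := rfl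

end Store

/-- The register kept in the first cell of the natural-number array `x`. -/
abbrev reg (x : ℕ) : NatExpr := .get x (.lit 0)

/-- Equality of natural numbers. -/
abbrev Test.natEq (e f : NatExpr) : Test := .and (.natLe e f) (.natLe f e)

/-- The natural-number arrays that a program writes to. -/
def Prog.natWrites : Prog → List ℕ
  | .skip => []
  | .setNat a _ _ => [a]
  | .setReal _ _ _ => []
  | .seq p q => p.natWrites ++ q.natWrites
  | .ite _ p q => p.natWrites ++ q.natWrites
  | .loop _ p => p.natWrites

/-- The real-number arrays that a program writes to. -/
def Prog.realWrites : Prog → List ℕ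
  | .skip => []
  | .setNat _ _ _ => []
  | .setReal a _ _ => [a]
  | .seq p q => p.realWrites ++ q.realWrites
  | .ite _ p q => p.realWrites ++ q.realWrites
  | .loop _ p => p.realWrites

/-- The stores `s` and `s'` agree on all arrays that `p` does not write to. -/
structure Frame (p : Prog) (s s' : Store) : Prop where
  nat : ∀ a, a ∉ p.natWrites → s'.nat a = s.nat a
  real : ∀ a, a ∉ p.realWrites → s'.real a = s.real a

theorem Frame.refl (p : Prog) (s : Store) : Frame p s s := ⟨fun _ _ => rfl, fun _ _ => rfl⟩

theorem Frame.trans {p : Prog} {s s' s'' : Store} (h : Frame p s s') (h' : Frame p s' s'') :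
    Frame p s s'' :=
  ⟨fun a ha => (h'.nat a ha).trans (h.nat a ha), fun a ha => (h'.real a ha).trans (h.real a ha)⟩

theorem Frame.mono {p q : Prog} {s s' : Store} (h : Frame p s s')
    (hn : p.natWrites ⊆ q.natWrites) (hr : p.realWrites ⊆ q.realWrites) : Frame q s s' :=
  ⟨fun a ha => h.nat a fun h' => ha (hn h'), fun a ha => h.real a fun h' => ha (hr h')⟩

/-- The list of written arrays can be read off the program text. Invariants therefore need to
mention only the arrays that change; everything else is transported by `Frame`. -/
theorem Exec.frame {p : Prog} {s s' : Store} {t : ℕ} (h : Exec p s t s') : Frame p s s' := by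
  induction h with
  | skip s => exact Frame.refl _ _
  | setNat a i e s =>
    exact ⟨fun b hb => Store.writeNat_nat_of_ne _ _ _ (by simpa [Prog.natWrites] using hb),
      fun _ _ => rfl⟩
  | setReal a i e s =>
    exact ⟨fun _ _ => rfl,
      fun b hb => Store.writeReal_real_of_ne _ _ _ (by simpa [Prog.realWrites] using hb)⟩
  | seq _ _ ih ih' =>
    exact (ih.mono (by simp [Prog.natWrites]) (by simp [Prog.realWrites])).trans
      (ih'.mono (by simp [Prog.natWrites]) (by simp [Prog.realWrites]))
  | iteTrue _ _ ih => exact ih.mono (by simp [Prog.natWrites]) (by simp [Prog.realWrites])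
  | iteFalse _ _ ih => exact ih.mono (by simp [Prog.natWrites]) (by simp [Prog.realWrites])
  | loopTrue _ _ _ ih ih' =>
    exact (ih.mono (by simp [Prog.natWrites]) (by simp [Prog.realWrites])).trans ih'
  | loopFalse _ => exact Frame.refl _ _

/-- Started in `s`, the program `p` halts after at most `T` steps in a store satisfying `Q`. -/
def Runs (p : Prog) (T : ℕ) (s : Store) (Q : Store → Prop) : Prop :=
  ∃ t s', Exec p s t s' ∧ t ≤ T ∧ Q s'

namespace Runs

variable {p q : Prog} {T T' T₁ T₂ : ℕ} {s : Store} {Q R : Store → Prop}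

theorem mono (h : Runs p T s Q) (hT : T ≤ T') (hQ : ∀ s', Q s' → R s') : Runs p T' s R := by
  obtain ⟨t, s', he, ht, hq⟩ := h
  exact ⟨t, s', he, ht.trans hT, hQ _ hq⟩

theorem frame (h : Runs p T s Q) : Runs p T s fun s' => Q s' ∧ Frame p s s' := by
  obtain ⟨t, s', he, ht, hq⟩ := h
  exact ⟨t, s', he, ht, hq, he.frame⟩

theorem seq (h : Runs p T₁ s R) (h' : ∀ s', R s' → Frame p s s' → Runs q T₂ s' Q)
    (hT : T₁ + T₂ ≤ T) : Runs (.seq p q) T s Q := by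
  obtain ⟨t, s', he, ht, hr⟩ := h
  obtain ⟨t', s'', he', ht', hq⟩ := h' s' hr he.frame
  exact ⟨_, s'', .seq he he', by omega, hq⟩

theorem ite {b : Test} (h : b.Holds s → Runs p T₁ s Q) (h' : ¬ b.Holds s → Runs q T₁ s Q)
    (hT : b.cost + 1 + T₁ ≤ T) : Runs (.ite b p q) T s Q := by
  by_cases hb : b.Holds s
  · obtain ⟨t, s', he, ht, hr⟩ := h hb
    exact ⟨_, s', .iteTrue hb he, by omega, hr⟩
  · obtain ⟨t, s', he, ht, hr⟩ := h' hb
    exact ⟨_, s', .iteFalse hb he, by omega, hr⟩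

end Runs

/-- Whether a program has no loops. -/
def Prog.loopFree : Prog → Bool
  | .seq p q => p.loopFree && q.loopFree
  | .ite _ p q => p.loopFree && q.loopFree
  | .loop _ _ => false
  | _ => true

/-- A bound for the running time of a loop-free program. -/
def Prog.maxCost : Prog → ℕ
  | .skip => 1
  | .setNat _ i e => i.cost + e.cost + 1
  | .setReal _ i e => i.cost + e.cost + 1
  | .seq p q => p.maxCost + q.maxCost
  | .ite b p q => b.cost + 1 + max p.maxCost q.maxCost
  | .loop _ _ => 0

open Classical in
/-- The final store of a loop-free program. -/
noncomputable def Prog.run : Prog → Store → Store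
  | .skip, s => s
  | .setNat a i e, s => s.writeNat a (i.eval s) (e.eval s)
  | .setReal a i e, s => s.writeReal a (i.eval s) (e.eval s)
  | .seq p q, s => q.run (p.run s)
  | .ite b p q, s => if b.Holds s then p.run s else q.run s
  | .loop _ _, s => s

/-- Loop-free pieces are executed symbolically: the final store is given by `Prog.run`, so their
correctness becomes a simplification. -/
theorem Runs.of_loopFree {p : Prog} {T : ℕ} {s : Store} {Q : Store → Prop}
    (h : p.loopFree = true) (hT : p.maxCost ≤ T) (hQ : Q (p.run s)) : Runs p T s Q := by
  suffices H : ∀ (p : Prog) (s : Store), p.loopFree = true →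
      ∃ t, Exec p s t (p.run s) ∧ t ≤ p.maxCost by
    obtain ⟨t, he, ht⟩ := H p s h
    exact ⟨t, _, he, ht.trans hT, hQ⟩
  clear h hT hQ s p
  intro p
  induction p with
  | skip => exact fun s _ => ⟨_, .skip s, le_rfl⟩
  | setNat a i e => exact fun s _ => ⟨_, .setNat a i e s, le_rfl⟩
  | setReal a i e => exact fun s _ => ⟨_, .setReal a i e s, le_rfl⟩
  | seq p q ihp ihq =>
    intro s h
    simp only [Prog.loopFree, Bool.and_eq_true] at h
    obtain ⟨t, he, ht⟩ := ihp s h.1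
    obtain ⟨t', he', ht'⟩ := ihq (p.run s) h.2
    exact ⟨_, .seq he he', Nat.add_le_add ht ht'⟩
  | ite b p q ihp ihq =>
    intro s h
    simp only [Prog.loopFree, Bool.and_eq_true] at h
    by_cases hb : b.Holds s
    · obtain ⟨t, he, ht⟩ := ihp s h.1
      refine ⟨_, ?_, Nat.add_le_add le_rfl (ht.trans (le_max_left _ _))⟩
      simpa [Prog.run, hb] using Exec.iteTrue hb he
    · obtain ⟨t, he, ht⟩ := ihq s h.2
      refine ⟨_, ?_, Nat.add_le_add le_rfl (ht.trans (le_max_right _ _))⟩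
      simpa [Prog.run, hb] using Exec.iteFalse hb he
  | loop b p _ => intro s h; simp [Prog.loopFree] at h

/-- `for v := a to e - 1 do body`. -/
def forFrom (v : ℕ) (a e : NatExpr) (body : Prog) : Prog :=
  .seq (.setNat v (.lit 0) a)
    (.loop (.neg (.natLe e (reg v)))
      (.seq body (.setNat v (.lit 0) (.add (reg v) (.lit 1)))))

/-- The invariant rule. The upper end is evaluated again in each round, so `he` is required in every
store that agrees with `s` off the written arrays. The increment of the counter also changes the
store, hence `stable`. The 12 covers the test and the increment of one round. -/
theorem Runs.forFrom {v : ℕ} {a e : NatExpr} {body : Prog} {s : Store} {T T' : ℕ} (lo hi : ℕ)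
    (I : ℕ → Store → Prop) (hle : lo ≤ hi) (ha : a.eval s = lo) (h0 : I lo s)
    (he : ∀ s', Frame (RealRAM.forFrom v a e body) s s' → e.eval s' = hi)
    (hv : v ∉ body.natWrites) (stable : ∀ i s' x, I i s' → I i (s'.writeNat v 0 x))
    (step : ∀ i s', lo ≤ i → i < hi → s'.nat v 0 = i →
      Frame (RealRAM.forFrom v a e body) s s' → I i s' → Runs body T s' (I (i + 1)))
    (hT : (hi - lo) * (T + e.cost + 12) + a.cost + e.cost + 10 ≤ T') :
    Runs (RealRAM.forFrom v a e body) T' s (I hi) := by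
  set p := RealRAM.forFrom v a e body with hp
  have hvp : v ∈ p.natWrites := by simp [hp, RealRAM.forFrom, Prog.natWrites]
  have hbody : ∀ {s₁ s₂}, Frame body s₁ s₂ → Frame p s₁ s₂ := fun h =>
    h.mono (by intro x hx; simp [hp, RealRAM.forFrom, Prog.natWrites, hx])
      (by intro x hx; simp [hp, RealRAM.forFrom, Prog.realWrites, hx])
  have hwrite : ∀ s₁ x, Frame p s₁ (s₁.writeNat v 0 x) := fun s₁ x =>
    ⟨fun b hb => Store.writeNat_nat_of_ne _ _ _ (by rintro rfl; exact hb hvp), fun _ _ => rfl⟩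
  -- Induction on the number `d` of rounds that are left.
  have main : ∀ d s', lo + d ≤ hi → s'.nat v 0 = hi - d → Frame p s s' → I (hi - d) s' →
      Runs (.loop (.neg (.natLe e (reg v)))
        (.seq body (.setNat v (.lit 0) (.add (reg v) (.lit 1)))))
        (d * (T + e.cost + 12) + e.cost + 5) s' (I hi) := by
    intro d
    induction d with
    | zero =>
      intro s' _ hv' hF hI
      refine ⟨_, s', .loopFalse ?_, ?_, by simpa using hI⟩
      · simp [Test.Holds, NatExpr.eval, hv', he s' hF]
      · simp [Test.cost, NatExpr.cost]
    | succ d ih =>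
      intro s' hd hv' hF hI
      obtain ⟨t, s₁, hex, ht, hI'⟩ :=
        step (hi - (d + 1)) s' (by omega) (by omega) hv' hF hI
      have hb := hex.frame
      have hv₁ : s₁.nat v 0 = hi - (d + 1) := by rw [hb.nat v hv, hv']
      rw [show hi - (d + 1) + 1 = hi - d by omega] at hI'
      obtain ⟨t', s₂, hex', ht', hQ⟩ := ih (s₁.writeNat v 0 (hi - d)) (by omega) (by simp)
        ((hF.trans (hbody hb)).trans (hwrite _ _)) (stable _ _ _ hI')
      have hset := Exec.setNat v (.lit 0) (.add (reg v) (.lit 1)) s₁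
      have hval : (NatExpr.add (reg v) (.lit 1)).eval s₁ = hi - d := by
        simp only [NatExpr.eval, hv₁]; omega
      rw [hval] at hset
      refine ⟨_, s₂, .loopTrue ?_ (.seq hex hset) hex', ?_, hQ⟩
      · simp only [Test.Holds, NatExpr.eval, hv', he s' hF]; omega
      · simp only [Test.cost, NatExpr.cost]
        have : (d + 1) * (T + e.cost + 12) = d * (T + e.cost + 12) + (T + e.cost + 12) := by ring
        omega
  refine Runs.seq (T₁ := a.cost + 2) (R := fun s' => s' = s.writeNat v 0 lo)
    ⟨_, _, .setNat v (.lit 0) a s, ?_, ?_⟩ ?_ (T₂ := (hi - lo) * (T + e.cost + 12) + e.cost + 5)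
    (by omega)
  · simp [NatExpr.cost]; omega
  · simp [NatExpr.eval, ha]
  · rintro s' rfl -
    refine main (hi - lo) _ (by omega) ?_ (hwrite _ _) ?_
    · simp; omega
    · rw [show hi - (hi - lo) = lo by omega]; exact stable _ _ _ h0

/-- `flag := 0; for v := a to e - 1 do if b then flag := 1`. -/
def anyFlag (flag v : ℕ) (a e : NatExpr) (b : Test) : Prog :=
  .seq (.setNat flag (.lit 0) (.lit 0))
    (forFrom v a e (.ite b (.setNat flag (.lit 0) (.lit 1)) .skip))

theorem Runs.anyFlag {flag v : ℕ} {a e : NatExpr} {b : Test} {s : Store} {T' : ℕ} (lo hi : ℕ)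
    (P : ℕ → Prop) (hle : lo ≤ hi) (hvf : v ≠ flag)
    (ha : ∀ s', Frame (RealRAM.anyFlag flag v a e b) s s' → a.eval s' = lo)
    (he : ∀ s', Frame (RealRAM.anyFlag flag v a e b) s s' → e.eval s' = hi)
    (hb : ∀ i s', lo ≤ i → i < hi → s'.nat v 0 = i →
      Frame (RealRAM.anyFlag flag v a e b) s s' → (b.Holds s' ↔ P i))
    (hT : (hi - lo) * (b.cost + e.cost + 16) + a.cost + e.cost + 13 ≤ T') :
    Runs (RealRAM.anyFlag flag v a e b) T' s
      fun s' => s'.nat flag 0 = 0 ↔ ∀ i, lo ≤ i → i < hi → ¬ P i := by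
  set p := RealRAM.anyFlag flag v a e b with hp
  set lp := RealRAM.forFrom v a e (.ite b (.setNat flag (.lit 0) (.lit 1)) .skip) with hlp
  have hF0 : Frame p s (s.writeNat flag 0 0) :=
    ⟨fun c hc => Store.writeNat_nat_of_ne _ _ _
      (by rintro rfl; exact hc (by simp [hp, RealRAM.anyFlag, Prog.natWrites])), fun _ _ => rfl⟩
  have hF : ∀ s', Frame lp (s.writeNat flag 0 0) s' → Frame p s s' := fun s' h =>
    hF0.trans (h.mono (by intro x hx; simp [hp, RealRAM.anyFlag, Prog.natWrites, ← hlp, hx])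
      (by intro x hx; simp [hp, RealRAM.anyFlag, Prog.realWrites, ← hlp, hx]))
  refine Runs.seq (T₁ := 3) (R := fun s' => s' = s.writeNat flag 0 0)
    ⟨_, _, .setNat flag (.lit 0) (.lit 0) s, by simp [NatExpr.cost], by simp [NatExpr.eval]⟩ ?_
    (T₂ := (hi - lo) * (b.cost + e.cost + 16) + a.cost + e.cost + 10) (by omega)
  rintro s₀ rfl -
  refine Runs.forFrom (T := b.cost + 4) lo hi
    (fun i s' => s'.nat flag 0 = 0 ↔ ∀ j, lo ≤ j → j < i → ¬ P j) hle (ha _ hF0) ?_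
    (fun s' h => he s' (hF s' h)) (by simpa [Prog.natWrites] using hvf) ?_ ?_ ?_
  · simp; omega
  · intro i s' x h
    simpa [Store.writeNat_nat_of_ne s' 0 x hvf.symm] using h
  · intro i s' h1 h2 h3 h4 h5
    refine Runs.of_loopFree rfl (by simp [Prog.maxCost, NatExpr.cost]) ?_
    have key := hb i s' h1 h2 h3 (hF s' h4)
    simp only [Prog.run, NatExpr.eval]
    split_ifs with hh
    · simp only [Store.writeNat_nat_self, Function.update_self, one_ne_zero, false_iff]
      exact fun H => H i h1 (by omega) (key.1 hh)
    · rw [h5]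
      constructor
      · intro H j hj hji
        rcases Nat.lt_succ_iff_lt_or_eq.1 hji with h | rfl
        · exact H j hj h
        · exact fun hP => hh (key.2 hP)
      · exact fun H j hj hji => H j hj (by omega)
  · have : (hi - lo) * (b.cost + 4 + e.cost + 12) = (hi - lo) * (b.cost + e.cost + 16) := by ring
    omega

/-! ### Polynomial time bounds -/

namespace Runs

variable {p q : Prog} {s : Store} {Q R : Store → Prop} {M α β γ i j r : ℕ}

/-- Bounds of the form γ · M ^ r compose well: under sequencing the constants add and the larger
exponent wins, and under a loop of at most M ^ i rounds (`forFrom_pow`) the exponents add. -/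
theorem seq_pow (hM : 1 ≤ M) (h : Runs p (α * M ^ i) s R)
    (h' : ∀ s', R s' → Frame p s s' → Runs q (β * M ^ j) s' Q)
    (hi : i ≤ r) (hj : j ≤ r) (hγ : α + β ≤ γ) : Runs (.seq p q) (γ * M ^ r) s Q := by
  refine h.seq h' ?_
  calc α * M ^ i + β * M ^ j ≤ α * M ^ r + β * M ^ r :=
        Nat.add_le_add (Nat.mul_le_mul_left _ (Nat.pow_le_pow_right hM hi))
          (Nat.mul_le_mul_left _ (Nat.pow_le_pow_right hM hj))
    _ = (α + β) * M ^ r := by ring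
    _ ≤ γ * M ^ r := Nat.mul_le_mul_right _ hγ

theorem ite_pow {b : Test} (hM : 1 ≤ M) (h : b.Holds s → Runs p (α * M ^ r) s Q)
    (h' : ¬ b.Holds s → Runs q (α * M ^ r) s Q) (hγ : b.cost + 1 + α ≤ γ) :
    Runs (.ite b p q) (γ * M ^ r) s Q := by
  refine Runs.ite h h' ?_
  have := Nat.mul_le_mul_right (M ^ r) hγ
  have h1 : 1 ≤ M ^ r := Nat.one_le_pow _ _ hM
  nlinarith

theorem of_loopFree_pow (hM : 1 ≤ M) (h : p.loopFree = true) (hα : p.maxCost ≤ α)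
    (hQ : Q (p.run s)) : Runs p (α * M ^ r) s Q :=
  Runs.of_loopFree h (hα.trans (Nat.le_mul_of_pos_right _ (Nat.pow_pos hM))) hQ

theorem forFrom_pow {v : ℕ} {a e : NatExpr} {body : Prog} (hM : 1 ≤ M) (lo hi : ℕ)
    (I : ℕ → Store → Prop) (hle : lo ≤ hi) (hc : hi - lo ≤ M ^ i) (ha : a.eval s = lo)
    (h0 : I lo s) (he : ∀ s', Frame (RealRAM.forFrom v a e body) s s' → e.eval s' = hi)
    (hv : v ∉ body.natWrites) (stable : ∀ i s' x, I i s' → I i (s'.writeNat v 0 x))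
    (step : ∀ i s', lo ≤ i → i < hi → s'.nat v 0 = i →
      Frame (RealRAM.forFrom v a e body) s s' → I i s' → Runs body (α * M ^ j) s' (I (i + 1)))
    (hr : i + j ≤ r) (hγ : α + a.cost + 2 * e.cost + 22 ≤ γ) :
    Runs (RealRAM.forFrom v a e body) (γ * M ^ r) s (I hi) := by
  refine Runs.forFrom lo hi I hle ha h0 he hv stable step ?_
  have h1 : 1 ≤ M ^ j := Nat.one_le_pow _ _ hM
  have h2 : 1 ≤ M ^ (i + j) := Nat.one_le_pow _ _ hM
  calc (hi - lo) * (α * M ^ j + e.cost + 12) + a.cost + e.cost + 10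
      ≤ M ^ i * (α * M ^ j + e.cost * M ^ j + 12 * M ^ j) + (a.cost + e.cost + 10) * 1 := by
        have : α * M ^ j + e.cost + 12 ≤ α * M ^ j + e.cost * M ^ j + 12 * M ^ j := by nlinarith
        have := Nat.mul_le_mul hc this
        omega
    _ ≤ M ^ i * (α * M ^ j + e.cost * M ^ j + 12 * M ^ j) +
        (a.cost + e.cost + 10) * M ^ (i + j) := Nat.add_le_add_left (Nat.mul_le_mul_left _ h2) _
    _ = (α + a.cost + 2 * e.cost + 22) * M ^ (i + j) := by rw [pow_add]; ring
    _ ≤ γ * M ^ r := Nat.mul_le_mul hγ (Nat.pow_le_pow_right hM hr)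

theorem anyFlag_pow {flag v : ℕ} {a e : NatExpr} {b : Test} (hM : 1 ≤ M) (lo hi : ℕ)
    (P : ℕ → Prop) (hle : lo ≤ hi) (hc : hi - lo ≤ M) (hvf : v ≠ flag)
    (ha : ∀ s', Frame (RealRAM.anyFlag flag v a e b) s s' → a.eval s' = lo)
    (he : ∀ s', Frame (RealRAM.anyFlag flag v a e b) s s' → e.eval s' = hi)
    (hb : ∀ i s', lo ≤ i → i < hi → s'.nat v 0 = i →
      Frame (RealRAM.anyFlag flag v a e b) s s' → (b.Holds s' ↔ P i))
    (hγ : b.cost + a.cost + 2 * e.cost + 29 ≤ γ) :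
    Runs (RealRAM.anyFlag flag v a e b) (γ * M ^ 1) s
      fun s' => s'.nat flag 0 = 0 ↔ ∀ i, lo ≤ i → i < hi → ¬ P i := by
  refine Runs.anyFlag lo hi P hle hvf ha he hb ?_
  have h1 := Nat.mul_le_mul_right (b.cost + e.cost + 16) hc
  have h2 := Nat.mul_le_mul_right M hγ
  rw [pow_one]
  nlinarith

end Runs

end RealRAM

/-! ### Levels -/

/-- There is a chain of `m` jumps of length more than `2` in `x 0, …, x (n - 1)` that ends in
`x i`. -/
def HasChain (n : ℕ) (x : ℕ → ℝ) : ℕ → ℕ → Prop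
  | 0, _ => True
  | m + 1, i => ∃ j < n, HasChain n x m j ∧ x j + 2 < x i

theorem HasChain.pred {n : ℕ} {x : ℕ → ℝ} {m i : ℕ} (h : HasChain n x (m + 1) i) :
    HasChain n x m i := by
  induction m generalizing i with
  | zero => trivial
  | succ m ih =>
    obtain ⟨j, hj, hc, hx⟩ := h
    exact ⟨j, hj, ih hc, hx⟩

theorem HasChain.anti {n : ℕ} {x : ℕ → ℝ} {m m' i : ℕ} (h : HasChain n x m i) (hm : m' ≤ m) :
    HasChain n x m' i := by
  induction hm with
  | refl => exact h
  | step _ ih => exact ih h.pred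

/-- Values increase strictly along a chain, so each jump adds an index below the end. Consequently
chains have fewer than `n` jumps, and cutting off at `n` in `level` loses nothing. -/
theorem HasChain.le_card {n : ℕ} {x : ℕ → ℝ} {m i : ℕ} (h : HasChain n x m i) :
    m ≤ ((Finset.range n).filter fun j => x j < x i).card := by
  induction m generalizing i with
  | zero => exact Nat.zero_le _
  | succ m ih =>
    obtain ⟨j, hj, hc, hx⟩ := h
    refine (ih hc).trans_lt (Finset.card_lt_card ?_)
    refine Finset.ssubset_iff_of_subset (fun a ha => ?_) |>.2 ⟨j, ?_, ?_⟩
    · simp only [Finset.mem_filter] at ha ⊢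
      exact ⟨ha.1, by linarith [ha.2]⟩
    · simp only [Finset.mem_filter, Finset.mem_range]
      exact ⟨hj, by linarith⟩
    · simp

theorem HasChain.lt {n : ℕ} {x : ℕ → ℝ} {m i : ℕ} (hi : i < n) (h : HasChain n x m i) :
    m < n := by
  refine h.le_card.trans_lt ?_
  conv_rhs => rw [← Finset.card_range n]
  refine Finset.card_lt_card (Finset.ssubset_iff_of_subset (Finset.filter_subset _ _) |>.2
    ⟨i, by simpa using hi, by simp⟩)

open Classical in
/-- The greatest `m ≤ L` such that there is a chain of `m` jumps ending in `x i`. -/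
noncomputable def levelUpTo (n : ℕ) (x : ℕ → ℝ) : ℕ → ℕ → ℕ
  | 0, _ => 0
  | L + 1, i => if HasChain n x (L + 1) i then L + 1 else levelUpTo n x L i

theorem le_levelUpTo_iff {n : ℕ} {x : ℕ → ℝ} {m L i : ℕ} (hm : m ≤ L) :
    m ≤ levelUpTo n x L i ↔ HasChain n x m i := by
  induction L with
  | zero => obtain rfl := Nat.le_zero.1 hm; simp [HasChain]
  | succ L ih =>
    rw [levelUpTo]
    split_ifs with h
    · exact iff_of_true hm (h.anti hm)
    · rcases Nat.le_succ_iff.1 hm with h' | rfl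
      · exact ih h'
      · refine iff_of_false (fun h' => ?_) h
        have : ∀ L, levelUpTo n x L i ≤ L := by
          intro L
          induction L with
          | zero => exact le_rfl
          | succ L ih => rw [levelUpTo]; split_ifs <;> omega
        have := this L
        omega

/-- The length of the longest chain of jumps of length more than `2` that ends in `x i`. -/
noncomputable def level (n : ℕ) (x : ℕ → ℝ) (i : ℕ) : ℕ := levelUpTo n x n i

theorem le_level_iff {n : ℕ} {x : ℕ → ℝ} {m i : ℕ} (hi : i < n) :
    m ≤ level n x i ↔ HasChain n x m i := by
  by_cases hm : m ≤ n
  · exact le_levelUpTo_iff hm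
  · refine iff_of_false (fun h => ?_) fun h => hm (h.lt hi).le
    have h1 := ((le_levelUpTo_iff (n := n) (x := x) (i := i) le_rfl).1
      ((le_of_not_ge hm).trans h)).lt hi
    exact lt_irrefl _ h1

theorem level_lt {n : ℕ} {x : ℕ → ℝ} {i : ℕ} (hi : i < n) : level n x i < n :=
  ((le_level_iff hi).1 le_rfl).lt hi

theorem level_lt_level {n : ℕ} {x : ℕ → ℝ} {i j : ℕ} (hi : i < n) (hj : j < n)
    (h : x j + 2 < x i) : level n x j < level n x i :=
  (le_level_iff hi).2 ⟨j, hj, (le_level_iff hj).1 le_rfl, h⟩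

/-- The last jump of a chain to `x j` is also a jump to the larger `x i`. -/
theorem level_le_level {n : ℕ} {x : ℕ → ℝ} {i j : ℕ} (hi : i < n) (hj : j < n)
    (h : x j ≤ x i) : level n x j ≤ level n x i := by
  rw [le_level_iff hi]
  have := (le_level_iff hj).1 (le_refl (level n x j))
  generalize level n x j = m at this
  cases m with
  | zero => trivial
  | succ m =>
    obtain ⟨l, hl, hc, hx⟩ := this
    exact ⟨l, hl, hc, by linarith⟩

theorem abs_sub_le_of_level_eq {n : ℕ} {x : ℕ → ℝ} {i j : ℕ} (hi : i < n) (hj : j < n)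
    (h : level n x i = level n x j) : |x i - x j| ≤ 2 := by
  rw [abs_le]
  constructor <;> by_contra hc
  · have := level_lt_level hj hi (by linarith : x i + 2 < x j); omega
  · have := level_lt_level hi hj (by linarith : x j + 2 < x i); omega

/-- If the level of `x i` were larger by 2, the last jump of a longest chain would start at some `x
l < x j` whose level exceeds that of `x j`, against monotonicity. -/
theorem level_le_succ {n : ℕ} {x : ℕ → ℝ} {i j : ℕ} (hi : i < n) (hj : j < n)
    (h : x i ≤ x j + 2) : level n x i ≤ level n x j + 1 := by
  by_contra hc
  obtain ⟨l, hl, hcl, hx⟩ := (le_level_iff (x := x) (m := level n x j + 2) hi).1 (by omega)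
  have h1 := (le_level_iff hl).2 hcl
  have h2 := level_le_level hj hl (by linarith)
  omega

/-- Whether `x i` exceeds another value of the same level by more than `1`. -/
def IsUpper (n : ℕ) (x : ℕ → ℝ) (i : ℕ) : Prop :=
  ∃ j < n, level n x j = level n x i ∧ x j + 1 < x i

/-- If `x j` exceeds `x i` by more than 1, then `j` is upper, hence so is `i`. The value that
witnesses this for `i` lies more than 2 below `x j`, although it has the same level. -/
theorem abs_sub_le_one {n : ℕ} {x : ℕ → ℝ} {i j : ℕ} (hi : i < n) (hj : j < n)
    (h : level n x i = level n x j) (hu : IsUpper n x i ↔ IsUpper n x j) : |x i - x j| ≤ 1 := by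
  have key : ∀ {i j}, i < n → j < n → level n x i = level n x j →
      (IsUpper n x j → IsUpper n x i) → x j ≤ x i + 1 := by
    intro i j hi hj h hu
    by_contra hc
    obtain ⟨l, hl, hl', hx⟩ := hu ⟨i, hi, h, by linarith⟩
    have := (abs_le.1 (abs_sub_le_of_level_eq hj hl (by rw [← h, hl']))).2
    linarith
  have h1 := key hi hj h hu.2
  have h2 := key hj hi h.symm hu.1
  rw [abs_le]; constructor <;> linarith

/-! ### Groups -/

/-- The objects on a level congruent to `r` modulo `k` get a number that is at least
`n * n + n`. The other ones get a number that determines their level in the first coordinate and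
the number of levels congruent to `r` below their level in the second coordinate. -/
def groupOf (n k r lx ly : ℕ) : ℕ :=
  (if ly % k = r then n * n + n else n * Nat.count (fun m => m % k = r) ly) + lx

theorem groupOf_lt_iff {n k r lx ly : ℕ} (hx : lx < n) (hy : ly < n) :
    groupOf n k r lx ly < n * n + n ↔ ly % k ≠ r := by
  rw [groupOf]
  split_ifs with h
  · simp [h]
  · simp only [ne_eq, h, not_false_eq_true, iff_true]
    have h1 : Nat.count (fun m => m % k = r) ly ≤ n := (Nat.count_le _).trans hy.le
    have := Nat.mul_le_mul_left n h1
    omega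

/-- Neither y-level is removed and they differ by at most 1, so no removed level separates them and
the strip is the same. Only the x-levels contribute to the difference. -/
theorem groupOf_le_succ {n k r lx ly lx' ly' : ℕ} (hy : ly % k ≠ r) (hy' : ly' % k ≠ r)
    (h : lx ≤ lx' + 1) (h1 : ly ≤ ly' + 1) (h2 : ly' ≤ ly + 1) :
    groupOf n k r lx ly ≤ groupOf n k r lx' ly' + 1 := by
  have : Nat.count (fun m => m % k = r) ly = Nat.count (fun m => m % k = r) ly' := by
    obtain rfl | rfl | rfl : ly = ly' ∨ ly = ly' + 1 ∨ ly' = ly + 1 := by omega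
    · rfl
    · simp [Nat.count_succ, hy']
    · simp [Nat.count_succ, hy]
  rw [groupOf, groupOf, if_neg hy, if_neg hy', this]
  omega

/-- Since x-levels are less than `n`, remainder and quotient modulo `n` recover the x-level and the
strip. Within one strip the residue modulo `k` determines the y-level, as two different levels with
that residue have a removed level between them. -/
theorem eq_of_groupOf_eq {n k r lx ly lx' ly' : ℕ} (hx : lx < n) (hx' : lx' < n)
    (hr : r < k) (hy : ly % k ≠ r) (hy' : ly' % k ≠ r)
    (h : groupOf n k r lx ly = groupOf n k r lx' ly') (hk : ly % k = ly' % k) :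
    lx = lx' ∧ ly = ly' := by
  rw [groupOf, groupOf, if_neg hy, if_neg hy'] at h
  have h1 := congrArg (· % n) h
  have h2 := congrArg (· / n) h
  simp only [Nat.mul_add_mod, Nat.mod_eq_of_lt hx, Nat.mod_eq_of_lt hx',
    Nat.mul_add_div (Nat.zero_lt_of_lt hx), Nat.div_eq_of_lt hx, Nat.div_eq_of_lt hx',
    add_zero] at h1 h2
  refine ⟨h1, ?_⟩
  have key : ∀ a b : ℕ, a < b → a % k = b % k →
      Nat.count (fun m => m % k = r) a < Nat.count (fun m => m % k = r) b := by
    intro a b hab hk'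
    have hd : k ∣ b - a := (Nat.modEq_iff_dvd' hab.le).1 hk'
    have hkb : a + k ≤ b := by have := Nat.le_of_dvd (by omega) hd; omega
    -- Among `k` consecutive levels one is congruent to `r`.
    obtain ⟨l, hl, hl', hlr⟩ : ∃ l, a ≤ l ∧ l < a + k ∧ l % k = r := by
      have ha := Nat.div_add_mod a k
      have hm := Nat.mod_lt a (Nat.zero_lt_of_lt hr)
      by_cases hc : a % k ≤ r
      · exact ⟨k * (a / k) + r, by omega, by omega, by simp [Nat.mod_eq_of_lt hr]⟩
      · exact ⟨k * (a / k + 1) + r, by rw [mul_add]; omega, by rw [mul_add]; omega,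
          by simp [Nat.mod_eq_of_lt hr]⟩
    calc Nat.count (fun m => m % k = r) a ≤ Nat.count (fun m => m % k = r) l :=
          Nat.count_monotone _ hl
      _ < Nat.count (fun m => m % k = r) (l + 1) := by simp [Nat.count_succ, hlr]
      _ ≤ Nat.count (fun m => m % k = r) b := Nat.count_monotone _ (by omega)
  rcases lt_trichotomy ly ly' with hlt | heq | hlt
  · have := key _ _ hlt hk; omega
  · exact heq
  · have := key _ _ hlt hk.symm; omega

/-! ### Partial colourings -/

/-- `f` is a proper partial colouring, with the colours `1` and `2`, of the graph with the edges
`E`; only objects `j < n` with `P j` are coloured. -/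
structure IsColoring (n : ℕ) (E : ℕ → ℕ → Prop) (P : ℕ → Prop) (f : ℕ → ℕ) : Prop where
  lt : ∀ j, f j ≠ 0 → j < n
  mem : ∀ j, f j ≠ 0 → P j
  le : ∀ j, f j ≤ 2
  proper : ∀ i j, f i ≠ 0 → f i = f j → i ≠ j → ¬ E i j

theorem IsColoring.mono {n : ℕ} {E : ℕ → ℕ → Prop} {P P' : ℕ → Prop} {f : ℕ → ℕ}
    (h : IsColoring n E P f) (hP : ∀ j < n, P j → P' j) : IsColoring n E P' f :=
  ⟨h.lt, fun j hj => hP j (h.lt j hj) (h.mem j hj), h.le, h.proper⟩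

/-- The total weight of the coloured objects. -/
def colorWeight (n : ℕ) (w : ℕ → ℝ) (f : ℕ → ℕ) : ℝ :=
  ∑ j ∈ Finset.range n, if f j = 0 then 0 else w j

/-- The colourings `f` and `f'` agree on the objects that have a group number at least `γ - 1`. -/
def SameTrace (n : ℕ) (G : ℕ → ℕ) (γ : ℕ) (f f' : ℕ → ℕ) : Prop :=
  ∀ j < n, γ ≤ G j + 1 → f j = f' j

theorem SameTrace.symm {n : ℕ} {G : ℕ → ℕ} {γ : ℕ} {f f' : ℕ → ℕ} (h : SameTrace n G γ f f') :
    SameTrace n G γ f' f := fun j hj hG => (h j hj hG).symm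

theorem SameTrace.trans {n : ℕ} {G : ℕ → ℕ} {γ : ℕ} {f f' f'' : ℕ → ℕ}
    (h : SameTrace n G γ f f') (h' : SameTrace n G γ f' f'') : SameTrace n G γ f f'' :=
  fun j hj hG => (h j hj hG).trans (h' j hj hG)

/-- The traces of colourings of the objects with group number at most `γ` are determined by a
number less than `N`. -/
def TraceBound (n : ℕ) (E : ℕ → ℕ → Prop) (G : ℕ → ℕ) (N γ : ℕ) : Prop :=
  ∃ key : (ℕ → ℕ) → Fin N, ∀ f f', IsColoring n E (fun j => G j ≤ γ) f →
    IsColoring n E (fun j => G j ≤ γ) f' → key f = key f' → SameTrace n G γ f f'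

-- The packing argument. Of the objects in the last two groups at most one falls into each cell, so
-- a trace is determined by the list of the occupants of the cells.
open Classical in
theorem traceBound_groupOf {n k r γ : ℕ} {x y : ℕ → ℝ} {E : ℕ → ℕ → Prop} (hr : r < k)
    (hγ : γ < n * n + n)
    (hE : ∀ i j, i < n → j < n → |x i - x j| ≤ 1 → |y i - y j| ≤ 1 → E i j) :
    TraceBound n E (fun i => groupOf n k r (level n x i) (level n y i)) ((n + 1) ^ (16 * k)) γ := by
  set G : ℕ → ℕ := fun i => groupOf n k r (level n x i) (level n y i) with hG
  have hk : 0 < k := Nat.zero_lt_of_lt hr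
  -- Last or last but one group, half in x, half in y, colour, y-level modulo `k`: 16k cells.
  let cell : ℕ → ℕ → Bool × Bool × Bool × Bool × Fin k := fun j c =>
    (decide (G j = γ), decide (IsUpper n x j), decide (IsUpper n y j), decide (c = 2),
      ⟨level n y j % k, Nat.mod_lt _ hk⟩)
  let occ : (ℕ → ℕ) → Bool × Bool × Bool × Bool × Fin k → ℕ → Prop := fun f κ j =>
    j < n ∧ f j ≠ 0 ∧ γ ≤ G j + 1 ∧ cell j (f j) = κ
  -- The extra value `Fin.last n` marks an empty cell.
  let code : (ℕ → ℕ) → (Bool × Bool × Bool × Bool × Fin k) → Fin (n + 1) := fun f κ =>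
    if h : ∃ j, occ f κ j then ⟨h.choose, by have := h.choose_spec.1; omega⟩ else Fin.last n
  have hcard : Fintype.card ((Bool × Bool × Bool × Bool × Fin k) → Fin (n + 1)) =
      (n + 1) ^ (16 * k) := by
    simp only [Fintype.card_fun, Fintype.card_prod, Fintype.card_bool, Fintype.card_fin]
    congr 1; ring
  -- Two occupants of one cell share group, levels, halves and colour. Their centres differ by at
  -- most 1 in both coordinates, so they intersect, and a proper colouring excludes this.
  have huniq : ∀ f, IsColoring n E (fun j => G j ≤ γ) f → ∀ κ j j', occ f κ j → occ f κ j' →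
      j = j' := by
    rintro f hf κ j j' ⟨hj, hfj, hGj, rfl⟩ ⟨hj', hfj', hGj', he⟩
    simp only [cell, Prod.mk.injEq, decide_eq_decide, Fin.mk.injEq] at he
    obtain ⟨e1, e2, e3, e4, e5⟩ := he
    have m1 := hf.mem j hfj
    have m2 := hf.mem j' hfj'
    have c1 := hf.le j
    have c2 := hf.le j'
    have hff : f j = f j' := by omega
    have hGG : G j = G j' := by
      by_cases h : G j = γ
      · rw [h, e1.2 h]
      · have : G j' ≠ γ := fun h' => h (e1.1 h')
        omega
    have k1 := (groupOf_lt_iff (k := k) (r := r) (level_lt hj (x := x)) (level_lt hj (x := y))).1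
      (lt_of_le_of_lt m1 hγ)
    have k2 := (groupOf_lt_iff (k := k) (r := r) (level_lt hj' (x := x)) (level_lt hj' (x := y))).1
      (lt_of_le_of_lt m2 hγ)
    obtain ⟨hlx, hly⟩ := eq_of_groupOf_eq (level_lt hj) (level_lt hj') hr k1 k2 hGG e5.symm
    by_contra hne
    exact hf.proper j j' hfj hff hne (hE j j' hj hj' (abs_sub_le_one hj hj' hlx e2.symm)
      (abs_sub_le_one hj hj' hly e3.symm))
  refine ⟨fun f => (Fintype.equivFinOfCardEq hcard) (code f), fun f f' hf hf' he => ?_⟩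
  have he := (Fintype.equivFinOfCardEq hcard).injective he
  -- The occupant of a cell has its colour recorded in the cell, so equal codes force equal colours.
  -- Uncoloured objects are handled by symmetry below.
  have key : ∀ f f', IsColoring n E (fun j => G j ≤ γ) f → IsColoring n E (fun j => G j ≤ γ) f' →
      code f = code f' → ∀ j < n, γ ≤ G j + 1 → f j ≠ 0 → f j = f' j := by
    intro f f' hf hf' he j hj hGj hfj
    have ho : occ f (cell j (f j)) j := ⟨hj, hfj, hGj, rfl⟩
    have hex : ∃ j', occ f (cell j (f j)) j' := ⟨j, ho⟩
    have h1 := congrFun he (cell j (f j))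
    simp only [code] at h1
    rw [dif_pos hex] at h1
    have hch := huniq f hf _ _ _ hex.choose_spec ho
    by_cases hex' : ∃ j', occ f' (cell j (f j)) j'
    · rw [dif_pos hex'] at h1
      have h2 : hex'.choose = j := (Fin.mk.inj_iff.1 h1).symm.trans hch
      have ho' := hex'.choose_spec
      rw [h2] at ho'
      have h3 := ho'.2.2.2
      simp only [cell, Prod.mk.injEq, decide_eq_decide, true_and] at h3
      have c1 := hf.le j
      have c2 := hf'.le j
      have := ho'.2.1
      omega
    · rw [dif_neg hex'] at h1
      have h2 := congrArg Fin.val h1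
      simp only [Fin.val_last] at h2
      omega
  intro j hj hGj
  by_cases h : f j = 0
  · by_cases h' : f' j = 0
    · rw [h, h']
    · exact (key f' f hf' hf he.symm j hj hGj h').symm
  · exact key f f' hf hf' he j hj hGj h

/-! ### Tables of partial colourings -/

/-- The rows `lo, …, hi - 1` are colourings with different traces, with their weights. Every
colouring in `S` has the trace of a row with at least the same weight. -/
structure IsTable (n : ℕ) (E : ℕ → ℕ → Prop) (w : ℕ → ℝ) (G : ℕ → ℕ) (γ : ℕ) (P : ℕ → Prop)
    (S : Set (ℕ → ℕ)) (row : ℕ → ℕ → ℕ) (W : ℕ → ℝ) (lo hi : ℕ) : Prop where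
  le : lo ≤ hi
  coloring : ∀ u, lo ≤ u → u < hi → IsColoring n E P (row u)
  weight : ∀ u, lo ≤ u → u < hi → W u = colorWeight n w (row u)
  inj : ∀ u v, lo ≤ u → u < hi → lo ≤ v → v < hi → SameTrace n G γ (row u) (row v) → u = v
  complete : ∀ f ∈ S, ∃ u, lo ≤ u ∧ u < hi ∧ SameTrace n G γ f (row u) ∧
    colorWeight n w f ≤ W u

namespace IsTable

variable {n : ℕ} {E : ℕ → ℕ → Prop} {w : ℕ → ℝ} {G : ℕ → ℕ} {γ : ℕ} {P : ℕ → Prop}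
  {S : Set (ℕ → ℕ)} {row row' : ℕ → ℕ → ℕ} {W W' : ℕ → ℝ} {lo hi : ℕ} {f : ℕ → ℕ}

theorem empty (lo : ℕ) : IsTable n E w G γ P ∅ row W lo lo :=
  ⟨le_rfl, fun u h h' => by omega, fun u h h' => by omega, fun u v h h' => by omega, by simp⟩

theorem mono {S' : Set (ℕ → ℕ)} (h : IsTable n E w G γ P S row W lo hi) (hS : S' ⊆ S) :
    IsTable n E w G γ P S' row W lo hi :=
  ⟨h.le, h.coloring, h.weight, h.inj, fun f hf => h.complete f (hS hf)⟩

/-- Applies to unfinished tables as well, because it uses only that the traces of the rows are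
different. This bounds the cost of each search during an update. -/
theorem sub_le {N : ℕ} (h : IsTable n E w G γ P S row W lo hi) (hN : TraceBound n E G N γ)
    (hP : ∀ j < n, P j → G j ≤ γ) : hi - lo ≤ N := by
  obtain ⟨key, hkey⟩ := hN
  have hinj : Function.Injective fun u : Fin (hi - lo) => key (row (lo + u)) := by
    intro u v huv
    have hu := u.2
    have hv := v.2
    have := h.inj (lo + u) (lo + v) (by omega) (by omega) (by omega) (by omega)
      (hkey _ _ ((h.coloring _ (by omega) (by omega)).mono hP)
        ((h.coloring _ (by omega) (by omega)).mono hP) huv)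
    exact Fin.ext (by omega)
  simpa using Fintype.card_le_of_injective _ hinj

/-- Nothing is to be done if a row of the same trace has at least the same weight. -/
theorem skip (h : IsTable n E w G γ P S row W lo hi) {pos : ℕ} (h1 : lo ≤ pos) (h2 : pos < hi)
    (ht : SameTrace n G γ f (row pos)) (hw : colorWeight n w f ≤ W pos) :
    IsTable n E w G γ P (insert f S) row W lo hi := by
  refine ⟨h.le, h.coloring, h.weight, h.inj, fun g hg => ?_⟩
  rcases hg with rfl | hg
  · exact ⟨pos, h1, h2, ht, hw⟩
  · exact h.complete g hg

/-- A row of the same trace and smaller weight is overwritten. -/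
theorem overwrite (h : IsTable n E w G γ P S row W lo hi) (hf : IsColoring n E P f) {pos : ℕ}
    (h1 : lo ≤ pos) (h2 : pos < hi) (ht : SameTrace n G γ f (row pos))
    (hw : W pos ≤ colorWeight n w f) (hrow : ∀ u, row' u = if u = pos then f else row u)
    (hW : ∀ u, W' u = if u = pos then colorWeight n w f else W u) :
    IsTable n E w G γ P (insert f S) row' W' lo hi := by
  have htr : ∀ u, SameTrace n G γ (row u) (row' u) := by
    intro u
    rw [hrow]
    split_ifs with hu
    · subst hu; exact ht.symm
    · exact fun _ _ _ => rfl
  refine ⟨h.le, fun u hu hu' => ?_, fun u hu hu' => ?_, fun u v hu hu' hv hv' huv => ?_,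
    fun g hg => ?_⟩
  · rw [hrow]; split_ifs
    · exact hf
    · exact h.coloring u hu hu'
  · rw [hrow, hW]; split_ifs
    · rfl
    · exact h.weight u hu hu'
  · exact h.inj u v hu hu' hv hv' ((htr u).trans (huv.trans (htr v).symm))
  · rcases hg with rfl | hg
    · exact ⟨pos, h1, h2, ht.trans (htr pos), by rw [hW, if_pos rfl]⟩
    · obtain ⟨u, hu, hu', hut, huw⟩ := h.complete g hg
      refine ⟨u, hu, hu', hut.trans (htr u), huw.trans ?_⟩
      rw [hW]
      split_ifs with h
      · subst h; exact hw
      · exact le_rfl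

/-- A colouring with a new trace is appended. -/
theorem append (h : IsTable n E w G γ P S row W lo hi) (hf : IsColoring n E P f)
    (hnew : ∀ u, lo ≤ u → u < hi → ¬ SameTrace n G γ f (row u))
    (hrow : ∀ u, row' u = if u = hi then f else row u)
    (hW : ∀ u, W' u = if u = hi then colorWeight n w f else W u) :
    IsTable n E w G γ P (insert f S) row' W' lo (hi + 1) := by
  have hold : ∀ u, u < hi → row' u = row u ∧ W' u = W u := fun u hu => by
    rw [hrow, hW, if_neg hu.ne, if_neg hu.ne]; exact ⟨rfl, rfl⟩
  have hnew' : row' hi = f ∧ W' hi = colorWeight n w f := by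
    rw [hrow, hW, if_pos rfl, if_pos rfl]; exact ⟨rfl, rfl⟩
  have hle := h.le
  refine ⟨by omega, fun u hu hu' => ?_, fun u hu hu' => ?_, fun u v hu hu' hv hv' huv => ?_,
    fun g hg => ?_⟩
  · rcases Nat.lt_succ_iff_lt_or_eq.1 hu' with h' | rfl
    · rw [(hold u h').1]; exact h.coloring u hu h'
    · rw [hnew'.1]; exact hf
  · rcases Nat.lt_succ_iff_lt_or_eq.1 hu' with h' | rfl
    · rw [(hold u h').1, (hold u h').2]; exact h.weight u hu h'
    · rw [hnew'.1, hnew'.2]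
  · rcases Nat.lt_succ_iff_lt_or_eq.1 hu' with hu'' | rfl <;>
      rcases Nat.lt_succ_iff_lt_or_eq.1 hv' with hv'' | rfl
    · rw [(hold u hu'').1, (hold v hv'').1] at huv
      exact h.inj u v hu hu'' hv hv'' huv
    · rw [(hold u hu'').1, hnew'.1] at huv
      exact absurd huv.symm (hnew u hu hu'')
    · rw [(hold v hv'').1, hnew'.1] at huv
      exact absurd huv (hnew v hv hv'')
    · rfl
  · rcases hg with rfl | hg
    · exact ⟨hi, hle, by omega, by rw [hnew'.1]; exact fun _ _ _ => rfl, hnew'.2.ge⟩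
    · obtain ⟨u, hu, hu', hut, huw⟩ := h.complete g hg
      exact ⟨u, hu, by omega, by rwa [(hold u hu').1], by rwa [(hold u hu').2]⟩

end IsTable

/-- The rows `lo, …, hi - 1` are at most `N` colourings of the objects in `P`, with their weights.
Every colouring of the objects in `P` has the trace of a row with at least the same weight. -/
structure IsFront (n : ℕ) (E : ℕ → ℕ → Prop) (w : ℕ → ℝ) (G : ℕ → ℕ) (N γ : ℕ) (P : ℕ → Prop)
    (row : ℕ → ℕ → ℕ) (W : ℕ → ℝ) (lo hi : ℕ) : Prop where
  le : lo ≤ hi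
  sub_le : hi - lo ≤ N
  coloring : ∀ u, lo ≤ u → u < hi → IsColoring n E P (row u)
  weight : ∀ u, lo ≤ u → u < hi → W u = colorWeight n w (row u)
  complete : ∀ f, IsColoring n E P f → ∃ u, lo ≤ u ∧ u < hi ∧ SameTrace n G γ f (row u) ∧
    colorWeight n w f ≤ W u

/-- The extensions of the rows before row `m` by a colour of the object `i`. -/
def extensions (n : ℕ) (E : ℕ → ℕ → Prop) (P : ℕ → Prop) (row : ℕ → ℕ → ℕ) (i lo m c : ℕ) :
    Set (ℕ → ℕ) :=
  {f | IsColoring n E P f ∧ ∃ u c', lo ≤ u ∧ c' < 3 ∧ (u < m ∨ u = m ∧ c' < c) ∧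
    f = Function.update (row u) i c'}

theorem colorWeight_update {n : ℕ} {w : ℕ → ℝ} {f : ℕ → ℕ} {i c : ℕ} (hi : i < n)
    (hf : f i = 0) :
    colorWeight n w (Function.update f i c) =
      colorWeight n w f + if c = 0 then 0 else w i := by
  rw [colorWeight, colorWeight,
    ← Finset.add_sum_erase _ _ (Finset.mem_range.2 hi),
    ← Finset.add_sum_erase _ (fun j => if f j = 0 then 0 else w j) (Finset.mem_range.2 hi)]
  have : ∀ j ∈ (Finset.range n).erase i,
      (if Function.update f i c j = 0 then 0 else w j) = if f j = 0 then 0 else w j := by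
    intro j hj
    rw [Function.update_of_ne (Finset.ne_of_mem_erase hj)]
  rw [Finset.sum_congr rfl this]
  simp [hf, add_comm]

/-- The colourings of `P` and of one more object `i`, which is in the last group so far. -/
theorem IsFront.step {n : ℕ} {E : ℕ → ℕ → Prop} {w : ℕ → ℝ} {G : ℕ → ℕ} {N : ℕ}
    {P P' : ℕ → Prop} {row row' : ℕ → ℕ → ℕ} {W W' : ℕ → ℝ} {lo hi hi' i : ℕ}
    (h : IsFront n E w G N (G i) P row W lo hi) (hi_lt : i < n)
    (hP' : ∀ j < n, P' j ↔ P j ∨ j = i) (hi_mem : ¬ P i) (hPi : ∀ j < n, P j → G j ≤ G i)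
    (hsymm : ∀ a b, E a b → E b a)
    (hEG : ∀ a b, a < n → b < n → P' a → P' b → E a b → G a ≤ G b + 1)
    (ht : IsTable n E w G (G i) P' (extensions n E P' row i lo hi 0) row' W' hi hi')
    (hN : TraceBound n E G N (G i)) : IsFront n E w G N (G i) P' row' W' hi hi' := by
  refine ⟨ht.le, ht.sub_le hN fun j hj hPj => ?_, ht.coloring, ht.weight, fun f hf => ?_⟩
  · rcases (hP' j hj).1 hPj with h' | rfl
    · exact hPi j hj h'
    · exact le_rfl
  · have hf0 : IsColoring n E P (Function.update f i 0) := by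
      have hne : ∀ j, Function.update f i 0 j ≠ 0 → j ≠ i ∧ f j ≠ 0 := by
        intro j hj
        by_cases hji : j = i
        · subst hji; simp at hj
        · rw [Function.update_of_ne hji] at hj; exact ⟨hji, hj⟩
      refine ⟨fun j hj => hf.lt j (hne j hj).2, fun j hj => ?_, fun j => ?_,
        fun a b ha hab hne' => ?_⟩
      · obtain ⟨h1, h2⟩ := hne j hj
        exact ((hP' j (hf.lt j h2)).1 (hf.mem j h2)).resolve_right h1
      · by_cases hji : j = i
        · subst hji; simp
        · rw [Function.update_of_ne hji]; exact hf.le j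
      · obtain ⟨h1, h2⟩ := hne a ha
        obtain ⟨h3, h4⟩ := hne b (by rwa [← hab])
        rw [Function.update_of_ne h1, Function.update_of_ne h3] at hab
        exact hf.proper a b h2 hab hne'
    obtain ⟨u, hu, hu', hut, huw⟩ := h.complete _ hf0
    have hcu := h.coloring u hu hu'
    have hui : row u i = 0 := by
      by_contra h0
      exact hi_mem (hcu.mem i h0)
    -- The exchange: give `i` its colour from `f` on top of that row. The result has the trace of
    -- `f` and no less weight.
    set g := Function.update (row u) i (f i) with hg
    have hfg : SameTrace n G (G i) f g := by
      intro j hj hGj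
      by_cases hji : j = i
      · subst hji; simp [hg]
      · have := hut j hj hGj
        rw [Function.update_of_ne hji] at this
        rw [hg, Function.update_of_ne hji, this]
    have hgi : g i = f i := by simp [hg]
    have hgj : ∀ j, j ≠ i → g j = row u j := fun j hj => by rw [hg, Function.update_of_ne hj]
    -- A neighbour of `i` has group number at least `G i - 1`, so it belongs to the trace, where `g`
    -- agrees with the proper colouring `f`.
    have hconf : ∀ j, j ≠ i → f i ≠ 0 → f i = row u j → ¬ E i j := by
      intro j hji h0 he hE
      have hj0 : row u j ≠ 0 := by rw [← he]; exact h0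
      have hjn := hcu.lt j hj0
      have hjP := (hP' j hjn).2 (.inl (hcu.mem j hj0))
      have := hfg j hjn (hEG i j hi_lt hjn ((hP' i hi_lt).2 (.inr rfl)) hjP hE)
      rw [hgj j hji, ← he] at this
      exact hf.proper i j h0 this.symm (Ne.symm hji) hE
    have hgc : IsColoring n E P' g := by
      refine ⟨fun j hj => ?_, fun j hj => ?_, fun j => ?_, fun a b ha hab hne => ?_⟩
      · by_cases hji : j = i
        · subst hji; exact hi_lt
        · rw [hgj j hji] at hj; exact hcu.lt j hj
      · by_cases hji : j = i
        · subst hji; exact (hP' j hi_lt).2 (.inr rfl)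
        · rw [hgj j hji] at hj
          exact (hP' j (hcu.lt j hj)).2 (.inl (hcu.mem j hj))
      · by_cases hji : j = i
        · subst hji; rw [hgi]; exact hf.le j
        · rw [hgj j hji]; exact hcu.le j
      · by_cases hai : a = i
        · subst hai
          rw [hgi] at ha
          rw [hgi, hgj b (Ne.symm hne)] at hab
          exact hconf b (Ne.symm hne) ha hab
        · rw [hgj a hai] at ha hab
          by_cases hbi : b = i
          · subst hbi
            rw [hgi] at hab
            exact fun hE => hconf a hai (by rwa [← hab]) hab.symm (hsymm _ _ hE)
          · rw [hgj b hbi] at hab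
            exact hcu.proper a b ha hab hne
    obtain ⟨v, hv, hv', hvt, hvw⟩ := ht.complete g ⟨hgc, u, f i, hu,
      Nat.lt_succ_of_le (hf.le i), .inl hu', rfl⟩
    refine ⟨v, hv, hv', hfg.trans hvt, le_trans ?_ hvw⟩
    have hff : f = Function.update (Function.update f i 0) i (f i) := by simp
    rw [hff, colorWeight_update hi_lt (by simp), hg, colorWeight_update hi_lt hui,
      ← h.weight u hu hu']
    linarith

/-- For a larger `γ'` traces record fewer objects, so a front remains a front when the sweep moves
on to the next group. -/
theorem IsFront.mono {n : ℕ} {E : ℕ → ℕ → Prop} {w : ℕ → ℝ} {G : ℕ → ℕ} {N γ γ' : ℕ}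
    {P P' : ℕ → Prop} {row : ℕ → ℕ → ℕ} {W : ℕ → ℝ} {lo hi : ℕ}
    (h : IsFront n E w G N γ P row W lo hi) (hγ : γ ≤ γ') (hP : ∀ j < n, P j ↔ P' j) :
    IsFront n E w G N γ' P' row W lo hi := by
  refine ⟨h.le, h.sub_le, fun u hu hu' => (h.coloring u hu hu').mono fun j hj => (hP j hj).1,
    h.weight, fun f hf => ?_⟩
  obtain ⟨u, hu, hu', ht, hw⟩ := h.complete f (hf.mono fun j hj => (hP j hj).2)
  exact ⟨u, hu, hu', fun j hj hG => ht j hj (by omega), hw⟩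

/-- The initial front consists of the empty colouring. -/
theorem IsFront.init {n : ℕ} {E : ℕ → ℕ → Prop} {w : ℕ → ℝ} {G : ℕ → ℕ} {N γ : ℕ}
    {P : ℕ → Prop} {row : ℕ → ℕ → ℕ} {W : ℕ → ℝ} {lo : ℕ} (hN : 1 ≤ N)
    (hrow : row lo = 0) (hW : W lo = 0) (hP : ∀ j < n, ¬ P j) :
    IsFront n E w G N γ P row W lo (lo + 1) := by
  have h0 : colorWeight n w 0 = 0 := by simp [colorWeight]
  refine ⟨by omega, by omega, fun u hu hu' => ?_, fun u hu hu' => ?_, fun f hf => ?_⟩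
  · obtain rfl : u = lo := by omega
    rw [hrow]
    exact ⟨by simp, by simp, by simp, by simp⟩
  · obtain rfl : u = lo := by omega
    rw [hrow, hW, h0]
  · obtain rfl : f = 0 := by
      funext j
      by_contra hj
      exact hP j (hf.lt j hj) (hf.mem j hj)
    exact ⟨lo, le_rfl, by omega, by rw [hrow]; exact fun _ _ _ => rfl, by rw [h0, hW]⟩

/-! ### Shifting -/

/-- If `best` is at least the weight of every colouring that avoids the levels congruent to `r`
modulo `k`, for each `r < k`, then it is almost at least the weight of every colouring. -/
theorem colorWeight_le_of_shifts {n k : ℕ} {E : ℕ → ℕ → Prop} {w : ℕ → ℝ} {l : ℕ → ℕ}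
    {ε best : ℝ} (hε : 0 < ε) (hl : ∀ i < n, l i < n) (hk : n < k ∨ 1 ≤ ((k : ℝ) - 1) * ε)
    (hbest : ∀ r < k, ∀ g, IsColoring n E (fun j => l j % k ≠ r) g → colorWeight n w g ≤ best)
    {f : ℕ → ℕ} (hf : IsColoring n E (fun _ => True) f) :
    colorWeight n w f ≤ (1 + ε) * best := by
  classical
  set W := ∑ j ∈ Finset.range n, (if f j = 0 then 0 else max (w j) 0) with hW
  have hW0 : 0 ≤ W := Finset.sum_nonneg fun j _ => by split_ifs <;> simp
  have hfW : colorWeight n w f ≤ W := Finset.sum_le_sum fun j _ => by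
    split_ifs
    · exact le_rfl
    · exact le_max_left _ _
  -- Objects of negative weight are discarded too, so that only the positive parts of the weights
  -- count. Colourings stay proper when objects lose their colour.
  let g : ℕ → ℕ → ℕ := fun r j => if w j < 0 ∨ l j % k = r then 0 else f j
  have hg : ∀ r, IsColoring n E (fun j => l j % k ≠ r) (g r) := by
    intro r
    have hne : ∀ j, g r j ≠ 0 → g r j = f j ∧ l j % k ≠ r := by
      intro j hj
      simp only [g] at hj ⊢
      split_ifs with h
      · simp [h] at hj
      · exact ⟨rfl, fun h' => h (.inr h')⟩
    refine ⟨fun j hj => hf.lt j (by rw [← (hne j hj).1]; exact hj), fun j hj => (hne j hj).2,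
      fun j => ?_, fun a b ha hab hne' => ?_⟩
    · simp only [g]; split_ifs
      · simp
      · exact hf.le j
    · have h1 := (hne a ha).1
      have h2 := (hne b (by rwa [← hab])).1
      exact hf.proper a b (by rwa [← h1]) (by rw [← h1, ← h2, hab]) hne'
  have hgw : ∀ r, colorWeight n w (g r) =
      ∑ j ∈ Finset.range n, if l j % k = r then 0 else if f j = 0 then 0 else max (w j) 0 := by
    intro r
    refine Finset.sum_congr rfl fun j _ => ?_
    simp only [g]
    by_cases h1 : l j % k = r
    · simp [h1]
    · by_cases h2 : w j < 0
      · simp [h2, max_eq_right h2.le]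
      · simp [h1, h2, max_eq_left (not_lt.1 h2)]
  rcases hk with hk | hk
  -- All levels are less than `n`, so the residue `n` removes no object.
  · have h1 := hbest n hk (g n) (hg n)
    have h2 : colorWeight n w (g n) = W := by
      rw [hgw]
      refine Finset.sum_congr rfl fun j hj => if_neg ?_
      have := hl j (Finset.mem_range.1 hj)
      rw [Nat.mod_eq_of_lt (this.trans hk)]
      exact this.ne
    nlinarith
  · have hk0 : 0 < k := by
      rcases Nat.eq_zero_or_pos k with rfl | h
      · norm_num at hk; linarith
      · exact h
    -- Each object is missing for exactly one of the `k` residues.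
    have hsum : ∑ r ∈ Finset.range k, colorWeight n w (g r) = ((k : ℝ) - 1) * W := by
      simp only [hgw]
      rw [Finset.sum_comm, hW, Finset.mul_sum]
      refine Finset.sum_congr rfl fun j _ => ?_
      have hm : l j % k ∈ Finset.range k := Finset.mem_range.2 (Nat.mod_lt _ hk0)
      rw [← Finset.add_sum_erase _ _ hm, if_pos rfl, zero_add]
      rw [Finset.sum_congr rfl (g := fun _ => if f j = 0 then 0 else max (w j) 0)
        fun r hr => if_neg (Finset.ne_of_mem_erase hr).symm]
      rw [Finset.sum_const, Finset.card_erase_of_mem hm, Finset.card_range, nsmul_eq_mul,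
        Nat.cast_pred hk0]
    have hle : ∑ r ∈ Finset.range k, colorWeight n w (g r) ≤ k * best := by
      refine (Finset.sum_le_card_nsmul _ _ best fun r hr =>
        hbest r (Finset.mem_range.1 hr) _ (hg r)).trans ?_
      simp
    rw [hsum] at hle
    have hk1 : (0 : ℝ) < (k : ℝ) - 1 := by
      by_contra h
      nlinarith
    have hb : 0 ≤ best := by
      by_contra h
      push Not at h
      have : (k : ℝ) * best < 0 := mul_neg_of_pos_of_neg (by exact_mod_cast hk0) h
      nlinarith [mul_nonneg hk1.le hW0]
    -- From (k - 1)W ≤ k · best and k ≤ (1 + ε)(k - 1), where best ≥ 0 is needed for the second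
    -- estimate.
    refine hfW.trans (le_of_mul_le_mul_left ?_ hk1)
    nlinarith [mul_le_mul_of_nonneg_right hk hb]

/-! ### The program -/

namespace RealRAM

-- Prefixes: `a` for arrays of natural numbers, `r` for registers (cell 0 of an array of natural
-- numbers), `f` for arrays of real numbers. The current front consists of the rows from `rLo` to
-- `rHi - 1`, and the rows under construction run from `rHi` to `rEnd - 1`. Row `u` starts at the
-- address `u * n`; this product is stored in `aBase`, as natural numbers cannot be multiplied. For
-- the same reason `rCount` and `rStart` keep the current level modulo `k` and `n` times the number
-- of removed levels so far. Natural numbers cannot be converted to real ones, so `fK` carries `k -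
-- 1` as a real number.
local notation "aOut" => 1
local notation "aLevelY" => 2
local notation "aLevelX" => 3
local notation "aOffset" => 4
local notation "aGroup" => 5
local notation "aRows" => 6
local notation "aBase" => 7
local notation "aCand" => 24
local notation "rN" => 0
local notation "rK" => 8
local notation "rR" => 9
local notation "rMax" => 10
local notation "rCount" => 11
local notation "rStart" => 12
local notation "rLo" => 13
local notation "rHi" => 14
local notation "rEnd" => 15
local notation "rGroup" => 16
local notation "rI" => 17
local notation "rJ" => 18
local notation "rU" => 19
local notation "rColor" => 20
local notation "rV" => 21
local notation "rPos" => 22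
local notation "rFlag" => 23
local notation "rL" => 25
local notation "fEps" => 0
local notation "fX" => 1
local notation "fY" => 2
local notation "fW" => 3
local notation "fRowW" => 4
local notation "fBest" => 5
local notation "fK" => 6
local notation "fCandW" => 7

/-- Compute the levels of the numbers in the real-number array `x`. -/
def levelsProg (x out : ℕ) : Prog :=
  forFrom rL (.lit 0) (reg rN) <| forFrom rI (.lit 0) (reg rN) <|
    forFrom rJ (.lit 0) (reg rN) <|
      .ite (.and (.natLe (reg rL) (.get out (reg rJ)))
          (.neg (.realLe (.get x (reg rI)) (.add (.get x (reg rJ)) (.lit 2)))))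
        (.setNat out (reg rI) (.add (reg rL) (.lit 1))) .skip

/-- Compute the number of shifts. -/
def shiftsProg : Prog :=
  .seq (.seq (.setNat rK (.lit 0) (.lit 1)) (.setReal fK (.lit 0) (.lit 0)))
    (.loop (.and (.natLe (reg rK) (reg rN))
        (.neg (.realLe (.lit 1) (.mul (.get fK (.lit 0)) (.get fEps (.lit 0))))))
      (.seq (.setNat rK (.lit 0) (.add (reg rK) (.lit 1)))
        (.setReal fK (.lit 0) (.add (.get fK (.lit 0)) (.lit 1)))))

/-- Compute a bound for the group numbers. -/
def maxProg : Prog :=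
  .seq (.setNat rMax (.lit 0) (reg rN))
    (forFrom rJ (.lit 0) (reg rN) (.setNat rMax (.lit 0) (.add (reg rMax) (reg rN))))

/-- Compute the group numbers for the current shift. -/
def groupsProg : Prog :=
  .seq (.seq (.setNat rCount (.lit 0) (.lit 0)) (.setNat rStart (.lit 0) (.lit 0))) <|
  .seq (forFrom rL (.lit 0) (reg rN) <|
    .seq (.ite (.natEq (reg rCount) (reg rR))
        (.seq (.setNat aOffset (reg rL) (reg rMax))
          (.setNat rStart (.lit 0) (.add (reg rStart) (reg rN))))
        (.setNat aOffset (reg rL) (reg rStart))) <|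
    .seq (.setNat rCount (.lit 0) (.add (reg rCount) (.lit 1)))
      (.ite (.natLe (reg rK) (reg rCount)) (.setNat rCount (.lit 0) (.lit 0)) .skip)) <|
  forFrom rJ (.lit 0) (reg rN) <|
    .setNat aGroup (reg rJ) (.add (.get aOffset (.get aLevelY (reg rJ))) (.get aLevelX (reg rJ)))

/-- The cell of row `u` and column `j` of the table. -/
abbrev cellExpr (u j : ℕ) : NatExpr := .get aRows (.add (.get aBase (reg u)) (reg j))

/-- Search the new rows for the trace of the candidate. -/
def searchProg : Prog :=
  .seq (.setNat rPos (.lit 0) (reg rEnd)) <|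
  forFrom rV (reg rHi) (reg rEnd) <|
    .seq (anyFlag rFlag rJ (.lit 0) (reg rN)
        (.and (.natLe (.get aGroup (reg rI)) (.add (.get aGroup (reg rJ)) (.lit 1)))
          (.neg (.natEq (.get aCand (reg rJ)) (cellExpr rV rJ)))))
      (.ite (.natLe (reg rFlag) (.lit 0)) (.setNat rPos (.lit 0) (reg rV)) .skip)

/-- Write the candidate into the row that was found, or append it. -/
def writeProg : Prog :=
  .seq (forFrom rJ (.lit 0) (reg rN) <|
    .setNat aRows (.add (.get aBase (reg rPos)) (reg rJ)) (.get aCand (reg rJ))) <|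
  .seq (.setReal fRowW (reg rPos) (.get fCandW (.lit 0)))
    (.ite (.natLe (reg rEnd) (reg rPos))
      (.seq (.setNat aBase (.add (reg rEnd) (.lit 1)) (.add (.get aBase (reg rEnd)) (reg rN)))
        (.setNat rEnd (.lit 0) (.add (reg rEnd) (.lit 1)))) .skip)

/-- Insert the candidate into the new rows. -/
def insertProg : Prog :=
  .seq searchProg
    (.ite (.and (.neg (.natLe (reg rEnd) (reg rPos)))
      (.realLe (.get fCandW (.lit 0)) (.get fRowW (reg rPos)))) .skip writeProg)

/-- Extend a row by a colour of the current object. -/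
def candProg : Prog :=
  .seq (forFrom rJ (.lit 0) (reg rN) (.setNat aCand (reg rJ) (cellExpr rU rJ))) <|
  .seq (.setNat aCand (reg rI) (reg rColor))
    (.ite (.natLe (reg rColor) (.lit 0))
      (.setReal fCandW (.lit 0) (.get fRowW (reg rU)))
      (.setReal fCandW (.lit 0) (.add (.get fRowW (reg rU)) (.get fW (reg rI)))))

/-- Extend a row by a colour of the current object, and insert the result if it is proper. -/
def extendProg (adj : Test) : Prog :=
  .seq candProg <|
  .seq (anyFlag rFlag rJ (.lit 0) (reg rN)
    (.and (.and (.natLe (.lit 1) (reg rColor)) (.neg (.natEq (reg rI) (reg rJ))))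
      (.and (.natEq (.get aCand (reg rJ)) (reg rColor)) adj)))
    (.ite (.natLe (reg rFlag) (.lit 0)) insertProg .skip)

/-- Handle an object. -/
def objectProg (adj : Test) : Prog :=
  .seq (.setNat rEnd (.lit 0) (reg rHi)) <|
  .seq (forFrom rU (reg rLo) (reg rHi) (forFrom rColor (.lit 0) (.lit 3) (extendProg adj)))
    (.seq (.setNat rLo (.lit 0) (reg rHi)) (.setNat rHi (.lit 0) (reg rEnd)))

/-- Start with a single empty row. -/
def initProg : Prog :=
  .seq (.seq (.seq (.setNat rLo (.lit 0) (.lit 0)) (.setNat rHi (.lit 0) (.lit 1)))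
    (.seq (.seq (.setNat aBase (.lit 0) (.lit 0)) (.setNat aBase (.lit 1) (reg rN)))
      (.setReal fRowW (.lit 0) (.lit 0))))
    (forFrom rJ (.lit 0) (reg rN) (.setNat aRows (reg rJ) (.lit 0)))

/-- Handle all objects in the order of their groups. -/
def sweepProg (adj : Test) : Prog :=
  forFrom rGroup (.lit 0) (reg rMax) <| forFrom rI (.lit 0) (reg rN) <|
    .ite (.natEq (.get aGroup (reg rI)) (reg rGroup)) (objectProg adj) .skip

/-- Copy the best row to the output if it is an improvement. -/
def outputProg : Prog :=
  forFrom rU (reg rLo) (reg rHi) <|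
    .ite (.realLe (.get fRowW (reg rU)) (.get fBest (.lit 0))) .skip
      (.seq (.setReal fBest (.lit 0) (.get fRowW (reg rU)))
        (forFrom rJ (.lit 0) (reg rN) (.setNat aOut (reg rJ) (cellExpr rU rJ))))

/-- Find an optimal solution for the current shift, and update the output. -/
def shiftProg (adj : Test) : Prog :=
  .seq groupsProg <| .seq initProg <| .seq (sweepProg adj) outputProg

/-- The approximation scheme, for objects whose adjacency is tested by `adj`. -/
def schemeProg (adj : Test) : Prog :=
  .seq shiftsProg <| .seq (levelsProg fY aLevelY) <| .seq (levelsProg fX aLevelX) <|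
  .seq maxProg <| .seq (.setReal fBest (.lit 0) (.lit 0)) <|
  forFrom rR (.lit 0) (reg rK) (shiftProg adj)

/-! ### Correctness and running time of the sweep -/

theorem eval_reg (s : Store) (x : ℕ) : (reg x).eval s = s.nat x 0 := rfl

/-- The first `n` cells of an array, followed by zeros. -/
def trunc (n : ℕ) (A : ℕ → ℕ) (j : ℕ) : ℕ := if j < n then A j else 0

/-- The row `u` of a table with rows of length `n`. -/
def rowOf (n : ℕ) (A : ℕ → ℕ) (u : ℕ) : ℕ → ℕ := trunc n fun j => A (u * n + j)

theorem sameTrace_trunc {n : ℕ} {G : ℕ → ℕ} {γ : ℕ} {A B : ℕ → ℕ} :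
    SameTrace n G γ (trunc n A) (trunc n B) ↔ ∀ j < n, γ ≤ G j + 1 → A j = B j := by
  refine forall₂_congr fun j hj => ?_
  simp [trunc, hj]

/-- The value `e`, one past the last row, in `rPos` signals that no row has the trace of the
candidate. It is also the place where a new row is to be appended. -/
theorem Runs.searchProg {n hi e M : ℕ} {s : Store} (hn : s.nat rN 0 = n)
    (hhi : s.nat rHi 0 = hi) (he : s.nat rEnd 0 = e) (hle : hi ≤ e)
    (hbase : ∀ u ≤ e, s.nat aBase u = u * n) (hM : 1 ≤ M) (hnM : n ≤ M) (heM : e - hi ≤ M) :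
    Runs searchProg (200 * M ^ 2) s fun s' =>
      (s'.nat rPos 0 = e ∧ ∀ u, hi ≤ u → u < e →
        ¬ SameTrace n (s.nat aGroup) (s.nat aGroup (s.nat rI 0)) (trunc n (s.nat aCand))
          (rowOf n (s.nat aRows) u)) ∨
      (hi ≤ s'.nat rPos 0 ∧ s'.nat rPos 0 < e ∧
        SameTrace n (s.nat aGroup) (s.nat aGroup (s.nat rI 0)) (trunc n (s.nat aCand))
          (rowOf n (s.nat aRows) (s'.nat rPos 0))) := by
  refine Runs.seq_pow hM (α := 4) (i := 0) (R := fun s' => s' = s.writeNat rPos 0 e)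
    (Runs.of_loopFree_pow hM rfl (by decide) (by simp [Prog.run, NatExpr.eval, he]))
    (β := 190) (j := 2) ?_ (by simp) le_rfl (by simp)
  rintro s₁ rfl -
  refine Runs.forFrom_pow hM (i := 1) (j := 1) (α := 110) hi e (fun v s' =>
      (s'.nat rPos 0 = e ∧ ∀ u, hi ≤ u → u < v →
        ¬ SameTrace n (s.nat aGroup) (s.nat aGroup (s.nat rI 0)) (trunc n (s.nat aCand))
          (rowOf n (s.nat aRows) u)) ∨
      (hi ≤ s'.nat rPos 0 ∧ s'.nat rPos 0 < v ∧
        SameTrace n (s.nat aGroup) (s.nat aGroup (s.nat rI 0)) (trunc n (s.nat aCand))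
          (rowOf n (s.nat aRows) (s'.nat rPos 0)))) hle (by simpa using heM)
    (by simp [NatExpr.eval, hhi])
    (.inl ⟨by simp, fun u h1 h2 => by omega⟩) ?_ (by decide) (fun i s' x h => by simpa using h)
    ?_ le_rfl (by decide)
  · intro s' hF
    simp [NatExpr.eval, hF.nat rEnd (by decide), he]
  · intro v s₂ h1 h2 hv hF hI
    have f0 : s₂.nat rN = s.nat rN := by rw [hF.nat _ (by decide)]; simp
    have f5 : s₂.nat aGroup = s.nat aGroup := by rw [hF.nat _ (by decide)]; simp
    have f6 : s₂.nat aRows = s.nat aRows := by rw [hF.nat _ (by decide)]; simp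
    have f7 : s₂.nat aBase = s.nat aBase := by rw [hF.nat _ (by decide)]; simp
    have f17 : s₂.nat rI = s.nat rI := by rw [hF.nat _ (by decide)]; simp
    have f24 : s₂.nat aCand = s.nat aCand := by rw [hF.nat _ (by decide)]; simp
    refine Runs.seq_pow hM (Runs.anyFlag_pow hM 0 n
      (fun j => s.nat aGroup (s.nat rI 0) ≤ s.nat aGroup j + 1 ∧
        ¬ s.nat aCand j = s.nat aRows (v * n + j)) (Nat.zero_le _) hnM (by decide)
      (fun _ _ => rfl) ?_ ?_ le_rfl) (β := 10) (j := 0) ?_ le_rfl (by simp) (by decide)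
    · intro s' hF'
      simp [NatExpr.eval, hF'.nat rN (by decide), f0, hn]
    · intro j s₃ _ hj hj' hF'
      simp only [Test.Holds, NatExpr.eval, hj', hF'.nat aGroup (by decide),
        hF'.nat rI (by decide), hF'.nat aRows (by decide), hF'.nat aBase (by decide),
        hF'.nat aCand (by decide), hF'.nat rV (by decide), f5, f6, f7, f17, f24, hv,
        hbase v h2.le, ← le_antisymm_iff]
    · intro s₃ hflag hF'
      have f22 : s₃.nat rPos = s₂.nat rPos := hF'.nat _ (by decide)
      have f21 : s₃.nat rV 0 = v := by rw [hF'.nat _ (by decide), hv]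
      refine Runs.of_loopFree_pow hM rfl (by decide) ?_
      have hiff : s₃.nat rFlag 0 = 0 ↔ SameTrace n (s.nat aGroup) (s.nat aGroup (s.nat rI 0))
          (trunc n (s.nat aCand)) (rowOf n (s.nat aRows) v) := by
        rw [hflag, rowOf, sameTrace_trunc]
        simp
      simp only [Prog.run]
      split_ifs with h <;> simp only [NatExpr.eval, Test.Holds, Nat.le_zero, hiff] at h
      · right
        simp [NatExpr.eval, f21, h1, h]
      · rw [f22]
        rcases hI with ⟨h3, h4⟩ | ⟨h3, h4, h5⟩
        · refine .inl ⟨h3, fun u hu hu' => ?_⟩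
          rcases Nat.lt_succ_iff_lt_or_eq.1 hu' with h6 | rfl
          · exact h4 u hu h6
          · exact h
        · exact .inr ⟨h3, by omega, h5⟩

/-- The blocks of `n` cells that belong to different rows are disjoint. -/
theorem rowOf_update {n pos : ℕ} {A A' B : ℕ → ℕ}
    (h : ∀ a, A' a = if pos * n ≤ a ∧ a < pos * n + n then B (a - pos * n) else A a) (u : ℕ) :
    rowOf n A' u = if u = pos then trunc n B else rowOf n A u := by
  have hcell : ∀ j, j < n → A' (u * n + j) = if u = pos then B j else A (u * n + j) := by
    intro j hj
    rw [h]
    by_cases hu : u = pos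
    · subst hu
      rw [if_pos ⟨by omega, by omega⟩, if_pos rfl, Nat.add_sub_cancel_left]
    · rw [if_neg, if_neg hu]
      rintro ⟨h3, h4⟩
      rcases Nat.lt_or_gt_of_ne hu with h5 | h5
      · have := Nat.mul_le_mul_right n (Nat.succ_le_of_lt h5)
        rw [Nat.succ_mul] at this; omega
      · have := Nat.mul_le_mul_right n (Nat.succ_le_of_lt h5)
        rw [Nat.succ_mul] at this; omega
  funext j
  by_cases hj : j < n
  · have := hcell j hj
    by_cases hu : u = pos
    · subst hu; simpa [rowOf, trunc, hj] using this
    · simpa [rowOf, trunc, hj, hu] using this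
  · by_cases hu : u = pos <;> simp [rowOf, trunc, hj, hu]

/-- The base addresses are known up to and including row `e`, one more than there are rows, so that
appending needs no product: the next address is obtained by adding `n`. -/
theorem Runs.writeProg {n e pos M : ℕ} {s : Store} (hn : s.nat rN 0 = n)
    (he : s.nat rEnd 0 = e) (hpos : s.nat rPos 0 = pos) (hpe : pos ≤ e)
    (hbase : ∀ u ≤ e, s.nat aBase u = u * n) (hM : 1 ≤ M) (hnM : n ≤ M) :
    Runs writeProg (100 * M ^ 1) s fun s' =>
      (∀ u, rowOf n (s'.nat aRows) u =
        if u = pos then trunc n (s.nat aCand) else rowOf n (s.nat aRows) u) ∧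
      (∀ u, s'.real fRowW u = if u = pos then s.real fCandW 0 else s.real fRowW u) ∧
      s'.nat rEnd 0 = (if e = pos then e + 1 else e) ∧
      ∀ u ≤ s'.nat rEnd 0, s'.nat aBase u = u * n := by
  refine Runs.seq_pow hM (i := 1) (α := 50) (R := fun s' => ∀ u, rowOf n (s'.nat aRows) u =
      if u = pos then trunc n (s.nat aCand) else rowOf n (s.nat aRows) u) ?_
    (β := 50) (j := 0) ?_ le_rfl (by simp) (by simp)
  · refine Runs.mono (Runs.forFrom_pow hM (i := 1) (j := 0) (α := 20) 0 n
      (fun m s' => ∀ a, s'.nat aRows a =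
        if pos * n ≤ a ∧ a < pos * n + m then s.nat aCand (a - pos * n) else s.nat aRows a)
      (Nat.zero_le _) (by simpa using hnM) rfl (fun a => ?_) ?_ (by decide)
      (fun i s' x h => by simpa using h) ?_ (γ := 50) (r := 1) (by simp) (by decide))
      le_rfl fun s' h u => rowOf_update h u
    · rw [if_neg (by omega)]
    · intro s' hF
      simp [NatExpr.eval, hF.nat rN (by decide), hn]
    · intro m s' _ h2 hm hF hI
      refine Runs.of_loopFree_pow hM rfl (by decide) fun a => ?_
      simp only [Prog.run, NatExpr.eval, hm, hF.nat aBase (by decide), hF.nat rPos (by decide),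
        hF.nat aCand (by decide), hpos, hbase pos hpe, Store.writeNat_nat_self]
      by_cases ha : a = pos * n + m
      · subst ha
        simp
      · rw [Function.update_of_ne ha, hI]
        congr 1
        simp only [eq_iff_iff]
        omega
  · intro s' hrow hF
    have f22 : s'.nat rPos 0 = pos := by rw [hF.nat _ (by decide), hpos]
    have f15 : s'.nat rEnd 0 = e := by rw [hF.nat _ (by decide), he]
    have f0 : s'.nat rN 0 = n := by rw [hF.nat _ (by decide), hn]
    have f7 : s'.nat aBase = s.nat aBase := hF.nat _ (by decide)
    have g4 : s'.real fRowW = s.real fRowW := hF.real _ (by decide)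
    have g7 : s'.real fCandW = s.real fCandW := hF.real _ (by decide)
    refine Runs.seq_pow hM (α := 10) (i := 0)
      (R := fun s'' => s'' = s'.writeReal fRowW pos (s.real fCandW 0))
      (Runs.of_loopFree_pow hM rfl (by decide)
        (by simp [Prog.run, NatExpr.eval, RealExpr.eval, f22, g7]))
      (β := 30) (j := 0) ?_ le_rfl le_rfl (by simp)
    rintro s₂ rfl -
    refine Runs.ite_pow hM (α := 20) (fun h => ?_) (fun h => ?_) (by decide) <;>
      simp only [NatExpr.eval, Test.Holds, Store.writeReal_nat, f15, f22] at h <;>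
      refine Runs.of_loopFree_pow hM rfl (by decide) ?_ <;>
      simp only [Prog.run, NatExpr.eval, Store.writeReal_nat, f15, f0, f7]
    · have hep : e = pos := le_antisymm h hpe
      refine ⟨by simpa using hrow, fun u => ?_, ?_, fun u hu => ?_⟩
      · simp [g4, Function.update_apply]
      · simp [f15, hep]
      · simp [f15] at hu
        rw [Store.writeNat_nat_of_ne _ _ _ (by decide), Store.writeNat_nat_self]
        simp only [Store.writeReal_nat, Function.update_apply, f7]
        split_ifs with h'
        · rw [hbase e le_rfl, h']; ring
        · exact hbase u (by omega)
    · have hep : ¬ e = pos := fun h' => h h'.le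
      refine ⟨by simpa using hrow, fun u => ?_, ?_, fun u hu => ?_⟩
      · simp [g4, Function.update_apply]
      · simp [hep]
      · exact hbase u hu

/-- The outcomes of the search and of the comparison of weights match `IsTable.skip`,
`IsTable.overwrite` and `IsTable.append`. The rows before `hi` must survive because the old front is
still being read. -/
theorem Runs.insertProg {n hi e M : ℕ} {E : ℕ → ℕ → Prop} {w : ℕ → ℝ} {P : ℕ → Prop}
    {S : Set (ℕ → ℕ)} {s : Store} (hn : s.nat rN 0 = n)
    (hhi : s.nat rHi 0 = hi) (he : s.nat rEnd 0 = e)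
    (hbase : ∀ u ≤ e, s.nat aBase u = u * n) (hM : 1 ≤ M) (hnM : n ≤ M) (heM : e - hi ≤ M)
    (ht : IsTable n E w (s.nat aGroup) (s.nat aGroup (s.nat rI 0)) P S
      (rowOf n (s.nat aRows)) (s.real fRowW) hi e)
    (hf : IsColoring n E P (trunc n (s.nat aCand)))
    (hw : s.real fCandW 0 = colorWeight n w (trunc n (s.nat aCand))) :
    Runs insertProg (400 * M ^ 2) s fun s' =>
      (∀ u ≤ s'.nat rEnd 0, s'.nat aBase u = u * n) ∧
      IsTable n E w (s.nat aGroup) (s.nat aGroup (s.nat rI 0)) P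
        (insert (trunc n (s.nat aCand)) S)
        (rowOf n (s'.nat aRows)) (s'.real fRowW) hi (s'.nat rEnd 0) ∧
      ∀ u < hi, rowOf n (s'.nat aRows) u = rowOf n (s.nat aRows) u ∧
        s'.real fRowW u = s.real fRowW u := by
  have hle := ht.le
  refine Runs.seq_pow hM (Runs.searchProg hn hhi he hle hbase hM hnM heM) (β := 200) (j := 2)
    (fun s₁ hs hF => ?_) le_rfl le_rfl (by simp)
  have f0 : s₁.nat rN = s.nat rN := hF.nat _ (by decide)
  have f6 : s₁.nat aRows = s.nat aRows := hF.nat _ (by decide)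
  have f7 : s₁.nat aBase = s.nat aBase := hF.nat _ (by decide)
  have f15 : s₁.nat rEnd = s.nat rEnd := hF.nat _ (by decide)
  have f24 : s₁.nat aCand = s.nat aCand := hF.nat _ (by decide)
  have g4 : s₁.real fRowW = s.real fRowW := hF.real _ (by decide)
  have g7 : s₁.real fCandW = s.real fCandW := hF.real _ (by decide)
  have hpe : s₁.nat rPos 0 ≤ e := by
    rcases hs with ⟨h1, -⟩ | ⟨-, h1, -⟩ <;> omega
  have hph : hi ≤ s₁.nat rPos 0 := by
    rcases hs with ⟨h1, -⟩ | ⟨h1, -, -⟩ <;> omega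
  refine Runs.ite_pow hM (α := 100) (fun h => ?_) (fun h => ?_) (by decide) <;>
    simp only [NatExpr.eval, RealExpr.eval, Test.Holds, f15, he, g4, g7] at h
  · refine Runs.of_loopFree_pow hM rfl (by decide) ?_
    obtain ⟨h1, h2⟩ := h
    rcases hs with ⟨h3, -⟩ | ⟨h3, h4, h5⟩
    · omega
    · simp only [Prog.run, f6, f7, f15, g4, he]
      refine ⟨hbase, ht.skip h3 h4 h5 (by rw [← hw]; exact h2), by simp⟩
  · refine Runs.mono (Runs.writeProg (n := n) (e := e) (by rw [f0, hn]) (by rw [f15, he]) rfl hpe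
      (by rw [f7]; exact hbase) hM hnM) (Nat.mul_le_mul_left _ (Nat.pow_le_pow_right hM
      (by decide))) ?_
    rintro s₂ ⟨hrow, hW, hend, hb⟩
    rw [f6, f24] at hrow
    rw [g4, g7, hw] at hW
    refine ⟨hb, ?_, fun u hu => ?_⟩
    · rcases hs with ⟨h3, h4⟩ | ⟨h3, h4, h5⟩
      · rw [h3] at hrow hW
        rw [hend, if_pos h3.symm]
        exact ht.append hf h4 hrow hW
      · rw [hend, if_neg (by omega)]
        refine ht.overwrite hf h3 h4 h5 ?_ hrow hW
        rw [← hw]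
        by_contra hc
        exact h ⟨by omega, by linarith⟩
    · rw [hrow, hW, if_neg (by omega), if_neg (by omega)]
      exact ⟨rfl, rfl⟩

theorem Runs.candProg {n e M : ℕ} {w : ℕ → ℝ} {s : Store} (hn : s.nat rN 0 = n)
    (hw : s.real fW = w) (hbase : ∀ u ≤ e, s.nat aBase u = u * n) (hM : 1 ≤ M) (hnM : n ≤ M)
    (hu : s.nat rU 0 ≤ e) (hi : s.nat rI 0 < n)
    (h0 : rowOf n (s.nat aRows) (s.nat rU 0) (s.nat rI 0) = 0)
    (hW : s.real fRowW (s.nat rU 0) = colorWeight n w (rowOf n (s.nat aRows) (s.nat rU 0))) :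
    Runs candProg (100 * M ^ 1) s fun s' =>
      trunc n (s'.nat aCand) = Function.update (rowOf n (s.nat aRows) (s.nat rU 0)) (s.nat rI 0)
        (s.nat rColor 0) ∧
      s'.real fCandW 0 = colorWeight n w (trunc n (s'.nat aCand)) := by
  refine Runs.seq_pow hM (i := 1) (α := 50) (R := fun s' => ∀ j < n,
      s'.nat aCand j = s.nat aRows (s.nat rU 0 * n + j)) ?_
    (β := 50) (j := 0) ?_ le_rfl (by simp) (by simp)
  · refine Runs.forFrom_pow hM (i := 1) (j := 0) (α := 20) 0 n
      (fun m s' => ∀ j < m, s'.nat aCand j = s.nat aRows (s.nat rU 0 * n + j))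
      (Nat.zero_le _) (by simpa using hnM) rfl (fun j hj => by omega) ?_ (by decide)
      (fun i s' x h => by simpa using h) ?_ (γ := 50) (r := 1) (by simp) (by decide)
    · intro s' hF
      simp [NatExpr.eval, hF.nat rN (by decide), hn]
    · intro m s' _ h2 hm hF hI
      refine Runs.of_loopFree_pow hM rfl (by decide) fun j hj => ?_
      simp only [Prog.run, NatExpr.eval, hm, hF.nat aBase (by decide), hF.nat rU (by decide),
        hF.nat aRows (by decide), hbase _ hu, Store.writeNat_nat_self]
      rcases Nat.lt_succ_iff_lt_or_eq.1 hj with h | rfl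
      · rw [Function.update_of_ne h.ne, hI j h]
      · simp
  · intro s₁ hc hF
    have f17 : s₁.nat rI = s.nat rI := hF.nat _ (by decide)
    have f19 : s₁.nat rU = s.nat rU := hF.nat _ (by decide)
    have f20 : s₁.nat rColor = s.nat rColor := hF.nat _ (by decide)
    have g3 : s₁.real fW = w := by rw [hF.real _ (by decide), hw]
    have g4 : s₁.real fRowW = s.real fRowW := hF.real _ (by decide)
    set i := s.nat rI 0
    set c := s.nat rColor 0
    have hcand : trunc n (Function.update (s₁.nat aCand) i c) =
        Function.update (rowOf n (s.nat aRows) (s.nat rU 0)) i c := by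
      funext j
      by_cases hj : j < n
      · by_cases hji : j = i
        · subst hji; simp [trunc, hj]
        · simp [trunc, rowOf, hj, hji, hc j hj]
      · have hji : j ≠ i := by omega
        simp [trunc, rowOf, hj, hji]
    refine Runs.seq_pow hM (α := 10) (i := 0)
      (R := fun s'' => s'' = s₁.writeNat aCand i c)
      (Runs.of_loopFree_pow hM rfl (by decide)
        (by simp [Prog.run, NatExpr.eval, f17, f20, i, c]))
      (β := 30) (j := 0) ?_ le_rfl le_rfl (by simp)
    rintro s₂ rfl -
    refine Runs.ite_pow hM (α := 20) (fun h => ?_) (fun h => ?_) (by decide) <;>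
      simp only [NatExpr.eval, Test.Holds] at h <;>
      rw [Store.writeNat_nat_of_ne _ _ _ (by decide), f20] at h <;>
      refine Runs.of_loopFree_pow hM rfl (by decide) ?_ <;>
      simp only [Prog.run, NatExpr.eval, RealExpr.eval, Store.writeReal_nat,
        Store.writeNat_nat_self, hcand, true_and, colorWeight_update hi h0, ← hW] <;>
      rw [Store.writeReal_real_self, Function.update_self, Store.writeNat_real,
        Store.writeNat_nat_of_ne _ _ _ (by decide), f19, g4]
    · rw [if_pos (Nat.le_zero.1 h), add_zero]
    · rw [if_neg fun h' => h (by omega), g3, Store.writeNat_nat_of_ne _ _ _ (by decide), f17]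

/-- The row is proper already, so only edges at `i` can be violated, and one scan over all objects
tests the candidate. -/
theorem isColoring_update_iff {n : ℕ} {E : ℕ → ℕ → Prop} {P P' : ℕ → Prop} {f : ℕ → ℕ} {i c : ℕ}
    (hf : IsColoring n E P f) (hi : i < n) (hPP' : ∀ j < n, P j → P' j) (hi' : P' i) (hc : c ≤ 2)
    (hsymm : ∀ a b, E a b → E b a) :
    IsColoring n E P' (Function.update f i c) ↔
      ∀ j < n, ¬ (c ≠ 0 ∧ i ≠ j ∧ Function.update f i c j = c ∧ E i j) := by
  constructor
  · rintro h j - ⟨h1, h2, h3, h4⟩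
    exact h.proper i j (by simpa using h1) (by simpa using h3.symm) h2 h4
  · intro h
    have hne : ∀ j, j ≠ i → Function.update f i c j = f j := fun j hj =>
      Function.update_of_ne hj _ _
    refine ⟨fun j hj => ?_, fun j hj => ?_, fun j => ?_, fun a b ha hab hne' hE => ?_⟩
    · by_cases hji : j = i
      · rwa [hji]
      · rw [hne j hji] at hj; exact hf.lt j hj
    · by_cases hji : j = i
      · rwa [hji]
      · rw [hne j hji] at hj; exact hPP' j (hf.lt j hj) (hf.mem j hj)
    · by_cases hji : j = i
      · rw [hji, Function.update_self]; exact hc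
      · rw [hne j hji]; exact hf.le j
    · by_cases hai : a = i
      · subst hai
        have hba := Ne.symm hne'
        simp only [Function.update_self] at ha hab
        refine h b (hf.lt b ?_) ⟨ha, hne', hab.symm, hE⟩
        rw [← hne b hba, ← hab]; exact ha
      · by_cases hbi : b = i
        · subst hbi
          simp only [Function.update_self] at hab
          refine h a (hf.lt a ?_) ⟨by rwa [← hab], hne'.symm, hab, hsymm _ _ hE⟩
          rw [← hne a hai]; exact ha
        · rw [hne a hai] at ha hab
          rw [hne b hbi] at hab
          exact hf.proper a b ha hab hne' hE

/-- The test `adj` decides the relation `E` between the objects in the registers. -/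
def Decides (adj : Test) (x y : ℕ → ℝ) (E : ℕ → ℕ → Prop) : Prop :=
  ∀ s : Store, s.real fX = x → s.real fY = y → (adj.Holds s ↔ E (s.nat rI 0) (s.nat rJ 0))

/-- The input as far as it is used by the sweep. -/
structure HasInput (n : ℕ) (x y w : ℕ → ℝ) (s : Store) : Prop where
  nat : s.nat rN 0 = n
  x : s.real fX = x
  y : s.real fY = y
  w : s.real fW = w

theorem HasInput.of_frame {n : ℕ} {x y w : ℕ → ℝ} {s s' : Store} {p : Prog}
    (h : HasInput n x y w s) (hF : Frame p s s') (h0 : rN ∉ p.natWrites)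
    (h1 : fX ∉ p.realWrites) (h2 : fY ∉ p.realWrites) (h3 : fW ∉ p.realWrites) :
    HasInput n x y w s' :=
  ⟨by rw [hF.nat _ h0, h.nat], by rw [hF.real _ h1, h.x], by rw [hF.real _ h2, h.y],
    by rw [hF.real _ h3, h.w]⟩

theorem Runs.extendProg {adj : Test} {n hi e M : ℕ} {x y w : ℕ → ℝ} {E : ℕ → ℕ → Prop}
    {P P' : ℕ → Prop} {S : Set (ℕ → ℕ)} {s : Store} (hadj : Decides adj x y E)
    (hs : HasInput n x y w s) (hsymm : ∀ a b, E a b → E b a)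
    (hhi : s.nat rHi 0 = hi) (he : s.nat rEnd 0 = e)
    (hbase : ∀ u ≤ e, s.nat aBase u = u * n) (hM : 1 ≤ M) (hnM : n ≤ M) (heM : e - hi ≤ M)
    (ht : IsTable n E w (s.nat aGroup) (s.nat aGroup (s.nat rI 0)) P' S
      (rowOf n (s.nat aRows)) (s.real fRowW) hi e)
    (hu : s.nat rU 0 < hi) (hi_lt : s.nat rI 0 < n) (hc : s.nat rColor 0 < 3)
    (hrow : IsColoring n E P (rowOf n (s.nat aRows) (s.nat rU 0)))
    (hW : s.real fRowW (s.nat rU 0) = colorWeight n w (rowOf n (s.nat aRows) (s.nat rU 0)))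
    (hPP' : ∀ j < n, P j → P' j) (hiP : ¬ P (s.nat rI 0)) (hiP' : P' (s.nat rI 0)) :
    Runs (extendProg adj) ((adj.cost + 700) * M ^ 2) s fun s' =>
      (∀ u ≤ s'.nat rEnd 0, s'.nat aBase u = u * n) ∧
      IsTable n E w (s.nat aGroup) (s.nat aGroup (s.nat rI 0)) P'
        ({f | f = Function.update (rowOf n (s.nat aRows) (s.nat rU 0)) (s.nat rI 0)
          (s.nat rColor 0) ∧ IsColoring n E P' f} ∪ S)
        (rowOf n (s'.nat aRows)) (s'.real fRowW) hi (s'.nat rEnd 0) ∧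
      ∀ u < hi, rowOf n (s'.nat aRows) u = rowOf n (s.nat aRows) u ∧
        s'.real fRowW u = s.real fRowW u := by
  have hle := ht.le
  have h0 : rowOf n (s.nat aRows) (s.nat rU 0) (s.nat rI 0) = 0 := by
    by_contra h
    exact hiP (hrow.mem _ h)
  have hiff := isColoring_update_iff hrow hi_lt hPP' hiP' (Nat.le_of_lt_succ hc) hsymm
  set i := s.nat rI 0
  set c := s.nat rColor 0
  set f := Function.update (rowOf n (s.nat aRows) (s.nat rU 0)) i c with hf
  refine Runs.seq_pow hM (Runs.candProg hs.nat hs.w hbase hM hnM (by omega) hi_lt h0 hW)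
    (β := adj.cost + 600) (j := 2) ?_ (by simp) le_rfl (by omega)
  rintro s₁ ⟨hcand, hcw⟩ hF
  have f5 : s₁.nat aGroup = s.nat aGroup := hF.nat _ (by exact of_decide_eq_true rfl)
  have f6 : s₁.nat aRows = s.nat aRows := hF.nat _ (by exact of_decide_eq_true rfl)
  have f7 : s₁.nat aBase = s.nat aBase := hF.nat _ (by exact of_decide_eq_true rfl)
  have f14 : s₁.nat rHi = s.nat rHi := hF.nat _ (by exact of_decide_eq_true rfl)
  have f15 : s₁.nat rEnd = s.nat rEnd := hF.nat _ (by exact of_decide_eq_true rfl)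
  have f17 : s₁.nat rI 0 = i := by rw [hF.nat _ (by exact of_decide_eq_true rfl)]
  have f20 : s₁.nat rColor 0 = c := by rw [hF.nat _ (by exact of_decide_eq_true rfl)]
  have g4 : s₁.real fRowW = s.real fRowW := hF.real _ (by exact of_decide_eq_true rfl)
  have hs₁ : HasInput n x y w s₁ := hs.of_frame hF (by exact of_decide_eq_true rfl)
    (by exact of_decide_eq_true rfl) (by exact of_decide_eq_true rfl)
      (by exact of_decide_eq_true rfl)
  have hcj : ∀ j < n, s₁.nat aCand j = f j := fun j hj => by
    rw [show f = _ from hcand.symm]; simp [trunc, hj]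
  refine Runs.seq_pow hM (i := 1) (α := adj.cost + 80) (Runs.anyFlag_pow hM 0 n
      (fun j => c ≠ 0 ∧ i ≠ j ∧ f j = c ∧ E i j) (Nat.zero_le _) hnM
        (by exact of_decide_eq_true rfl)
      (fun _ _ => rfl) ?_ ?_ ?_) (β := 500) (j := 2) ?_ (by simp) le_rfl (by omega)
  · intro s' hF'
    simp [NatExpr.eval, hF'.nat rN (by exact of_decide_eq_true rfl), hs₁.nat]
  · intro j s' _ hj hj' hF'
    have := hadj s' (by rw [hF'.real _ (by exact of_decide_eq_true rfl), hs₁.x])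
      (by rw [hF'.real _ (by exact of_decide_eq_true rfl), hs₁.y])
    simp only [Test.Holds, NatExpr.eval, this, hj', hF'.nat rI (by exact of_decide_eq_true rfl),
      hF'.nat aCand (by exact of_decide_eq_true rfl), hF'.nat rColor
        (by exact of_decide_eq_true rfl), f17, f20, hcj j hj,
      ← le_antisymm_iff, Nat.one_le_iff_ne_zero, and_assoc]
  · simp only [Test.cost, NatExpr.cost]; omega
  · intro s₂ hflag hF'
    have e6 : s₂.nat aRows = s.nat aRows := by rw [hF'.nat _ (by exact of_decide_eq_true rfl), f6]
    have e7 : s₂.nat aBase = s.nat aBase := by rw [hF'.nat _ (by exact of_decide_eq_true rfl), f7]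
    have e15 : s₂.nat rEnd = s.nat rEnd := by rw [hF'.nat _ (by exact of_decide_eq_true rfl), f15]
    have e5 : s₂.nat aGroup = s.nat aGroup := by rw [hF'.nat _ (by exact of_decide_eq_true rfl), f5]
    have e17 : s₂.nat rI 0 = i := by rw [hF'.nat _ (by exact of_decide_eq_true rfl), f17]
    have e24 : s₂.nat aCand = s₁.nat aCand := hF'.nat _ (by exact of_decide_eq_true rfl)
    have d4 : s₂.real fRowW = s.real fRowW := by
      rw [hF'.real _ (by exact of_decide_eq_true rfl), g4]
    have hflag' : s₂.nat rFlag 0 = 0 ↔ IsColoring n E P' f := by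
      rw [hflag, hiff]
      simp
    refine Runs.ite_pow hM (α := 400) (fun h => ?_) (fun h => ?_)
      (by exact of_decide_eq_true rfl) <;>
      simp only [NatExpr.eval, Test.Holds, Nat.le_zero, hflag'] at h
    · have key := Runs.insertProg (n := n) (hi := hi) (e := e) (E := E) (w := w) (P := P') (S := S)
        (s := s₂) (by rw [hF'.nat _ (by exact of_decide_eq_true rfl), hs₁.nat])
        (by rw [hF'.nat _ (by exact of_decide_eq_true rfl), f14, hhi]) (by rw [e15, he])
          (by rw [e7]; exact hbase)
        hM hnM heM (by rw [e5, e17, e6, d4]; exact ht) (by rw [e24, hcand]; exact h)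
        (by rw [e24, hF'.real _ (by exact of_decide_eq_true rfl), hcw])
      rw [e5, e17, e24, hcand, e6, d4] at key
      refine key.mono le_rfl ?_
      rintro s₃ ⟨h1, h2, h3⟩
      refine ⟨h1, h2.mono ?_, h3⟩
      rintro g (⟨rfl, -⟩ | hg)
      · exact Set.mem_insert _ _
      · exact Set.mem_insert_of_mem _ hg
    · refine Runs.of_loopFree_pow hM rfl (by exact of_decide_eq_true rfl) ?_
      simp only [Prog.run, e6, e7, e15, d4, he]
      refine ⟨hbase, ht.mono ?_, by simp⟩
      rintro g (⟨rfl, hg⟩ | hg)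
      · exact absurd hg h
      · exact hg

theorem Runs.objectProg {adj : Test} {n lo hi N M : ℕ} {x y w : ℕ → ℝ} {E : ℕ → ℕ → Prop}
    {P P' : ℕ → Prop} {s : Store} (hadj : Decides adj x y E)
    (hs : HasInput n x y w s) (hsymm : ∀ a b, E a b → E b a)
    (hlo : s.nat rLo 0 = lo) (hhi : s.nat rHi 0 = hi)
    (hbase : ∀ u ≤ hi, s.nat aBase u = u * n) (hM : 3 ≤ M) (hnM : n ≤ M) (hNM : N ≤ M)
    (hfront : IsFront n E w (s.nat aGroup) N (s.nat aGroup (s.nat rI 0)) P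
      (rowOf n (s.nat aRows)) (s.real fRowW) lo hi) (hi_lt : s.nat rI 0 < n)
    (hPP' : ∀ j < n, P' j ↔ P j ∨ j = s.nat rI 0) (hiP : ¬ P (s.nat rI 0))
    (hPi : ∀ j < n, P j → s.nat aGroup j ≤ s.nat aGroup (s.nat rI 0))
    (hEG : ∀ a b, a < n → b < n → P' a → P' b → E a b → s.nat aGroup a ≤ s.nat aGroup b + 1)
    (hN : TraceBound n E (s.nat aGroup) N (s.nat aGroup (s.nat rI 0))) :
    Runs (objectProg adj) ((adj.cost + 1000) * M ^ 4) s fun s' =>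
      (∀ u ≤ s'.nat rHi 0, s'.nat aBase u = u * n) ∧
      IsFront n E w (s.nat aGroup) N (s.nat aGroup (s.nat rI 0)) P'
        (rowOf n (s'.nat aRows)) (s'.real fRowW) (s'.nat rLo 0) (s'.nat rHi 0) := by
  have hM1 : 1 ≤ M := by omega
  have hle := hfront.le
  have hP'i : ∀ j < n, P' j → s.nat aGroup j ≤ s.nat aGroup (s.nat rI 0) := fun j hj h => by
    rcases (hPP' j hj).1 h with h | rfl
    · exact hPi j hj h
    · exact le_rfl
  set i := s.nat rI 0
  -- All proper extensions that precede the pair of row `u` and colour `c` in lexicographic order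
  -- are represented in the new rows, and the old front is unchanged.
  let I : ℕ → ℕ → Store → Prop := fun u c s' =>
    (∀ u ≤ s'.nat rEnd 0, s'.nat aBase u = u * n) ∧
    IsTable n E w (s.nat aGroup) (s.nat aGroup i) P'
      (extensions n E P' (rowOf n (s.nat aRows)) i lo u c)
      (rowOf n (s'.nat aRows)) (s'.real fRowW) hi (s'.nat rEnd 0) ∧
    ∀ u < hi, rowOf n (s'.nat aRows) u = rowOf n (s.nat aRows) u ∧
      s'.real fRowW u = s.real fRowW u
  refine Runs.seq_pow hM1 (α := 4) (i := 0) (R := fun s' => s' = s.writeNat rEnd 0 hi)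
    (Runs.of_loopFree_pow hM1 rfl (by exact of_decide_eq_true rfl)
      (by simp [Prog.run, NatExpr.eval, hhi]))
    (β := adj.cost + 900) (j := 4) ?_ (by simp) le_rfl (by omega)
  rintro s₁ rfl -
  have hs₁ : HasInput n x y w (s.writeNat rEnd 0 hi) :=
    ⟨by simp [hs.nat], hs.x, hs.y, hs.w⟩
  refine Runs.seq_pow hM1 (α := adj.cost + 800) (i := 4) (R := I hi 0) ?_
    (β := 20) (j := 0) ?_ le_rfl (by simp) (by omega)
  · refine Runs.forFrom_pow hM1 (i := 1) (j := 3) (α := adj.cost + 750) lo hi (fun u => I u 0) hle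
      (by simpa using hfront.sub_le.trans hNM) (by simp [NatExpr.eval, hlo]) ?_ ?_
        (by exact of_decide_eq_true rfl)
      (fun i s' x h => by simpa [I] using h) ?_ (by simp) (by simp [NatExpr.cost])
    · refine ⟨by simpa using hbase, ?_, by simp⟩
      rw [show (s.writeNat rEnd 0 hi).nat rEnd 0 = hi by simp]
      refine (IsTable.empty hi).mono ?_
      rintro f ⟨-, u, c', h1, h2, h3, -⟩
      omega
    · intro s' hF
      simp [NatExpr.eval, hF.nat rHi (by exact of_decide_eq_true rfl), hhi]
    · intro u s₂ hu hu' hru hF hI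
      have hs₂ : HasInput n x y w s₂ :=
        hs₁.of_frame hF (by exact of_decide_eq_true rfl) (by exact of_decide_eq_true rfl)
          (by exact of_decide_eq_true rfl) (by exact of_decide_eq_true rfl)
      have f5 : s₂.nat aGroup = s.nat aGroup := by
        rw [hF.nat _ (by exact of_decide_eq_true rfl)]
        simp
      have f14 : s₂.nat rHi = s.nat rHi := by rw [hF.nat _ (by exact of_decide_eq_true rfl)]; simp
      have f17 : s₂.nat rI = s.nat rI := by rw [hF.nat _ (by exact of_decide_eq_true rfl)]; simp
      refine Runs.mono (Runs.forFrom_pow hM1 (i := 1) (j := 2) (α := adj.cost + 700) 0 3 (I u)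
        (by simp) (by simpa using hM) rfl hI (fun _ _ => rfl) (by exact of_decide_eq_true rfl)
        (fun i s' x h => by simpa [I] using h) ?_ (r := 3) (γ := adj.cost + 750) le_rfl
        (by simp [NatExpr.cost])) le_rfl ?_
      · rintro c s₃ - hc hrc hF' ⟨hb, ht, hold⟩
        have hs₃ : HasInput n x y w s₃ :=
          hs₂.of_frame hF' (by exact of_decide_eq_true rfl) (by exact of_decide_eq_true rfl)
            (by exact of_decide_eq_true rfl) (by exact of_decide_eq_true rfl)
        have e5 : s₃.nat aGroup = s.nat aGroup := by
          rw [hF'.nat _ (by exact of_decide_eq_true rfl), f5]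
        have e14 : s₃.nat rHi 0 = hi := by rw [hF'.nat _ (by exact of_decide_eq_true rfl), f14, hhi]
        have e17 : s₃.nat rI 0 = i := by rw [hF'.nat _ (by exact of_decide_eq_true rfl), f17]
        have e19 : s₃.nat rU 0 = u := by rw [hF'.nat _ (by exact of_decide_eq_true rfl), hru]
        -- The unfinished table also has at most `N` rows, by `IsTable.sub_le`, so each search stays
        -- within `M` rows.
        have key := Runs.extendProg (P := P) (P' := P')
          (S := extensions n E P' (rowOf n (s.nat aRows)) i lo u c) (M := M) hadj hs₃ hsymm e14 rfl
          hb hM1 hnM ((ht.sub_le hN hP'i).trans hNM) (by rw [e5, e17]; exact ht)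
          (by rw [e19]; exact hu') (by rw [e17]; exact hi_lt) (by rw [hrc]; exact hc)
          (by rw [e19, (hold u hu').1]; exact hfront.coloring u hu hu')
          (by rw [e19, (hold u hu').1, (hold u hu').2]; exact hfront.weight u hu hu')
          (fun j hj h => (hPP' j hj).2 (.inl h)) (by rw [e17]; exact hiP)
          (by rw [e17]; exact (hPP' i hi_lt).2 (.inr rfl))
        rw [e5, e17, e19, hrc, (hold u hu').1] at key
        refine key.mono le_rfl ?_
        rintro s₄ ⟨h1, h2, h3⟩
        refine ⟨h1, h2.mono ?_, fun v hv => ?_⟩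
        · rintro f ⟨hfc, v, c', h4, h5, h6, h7⟩
          by_cases hvc : v = u ∧ c' = c
          · obtain ⟨rfl, rfl⟩ := hvc
            exact .inl ⟨h7, hfc⟩
          · exact .inr ⟨hfc, v, c', h4, h5, by omega, h7⟩
        · rw [(h3 v hv).1, (h3 v hv).2]; exact hold v hv
      · rintro s₃ ⟨h1, h2, h3⟩
        refine ⟨h1, h2.mono ?_, h3⟩
        rintro f ⟨hfc, v, c', h4, h5, h6, h7⟩
        exact ⟨hfc, v, c', h4, h5, by omega, h7⟩
  · rintro s₂ ⟨h1, h2, h3⟩ hF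
    have f14 : s₂.nat rHi 0 = hi := by rw [hF.nat _ (by exact of_decide_eq_true rfl)]; simp [hhi]
    refine Runs.of_loopFree_pow hM1 rfl (by exact of_decide_eq_true rfl) ?_
    have key := hfront.step hi_lt hPP' hiP hPi hsymm hEG h2 hN
    simp only [Prog.run, NatExpr.eval]
    refine ⟨by simpa using h1, by simpa [f14] using key⟩

/-- The exponent 7 is 2 for the group numbers, 1 for the scan over the objects and 4 for handling
one object. -/
theorem Runs.sweepProg {adj : Test} {n gm N M : ℕ} {x y w : ℕ → ℝ} {E : ℕ → ℕ → Prop}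
    {s : Store} (hadj : Decides adj x y E)
    (hs : HasInput n x y w s) (hsymm : ∀ a b, E a b → E b a) (hgm : s.nat rMax 0 = gm)
    (hbase : ∀ u ≤ s.nat rHi 0, s.nat aBase u = u * n) (hM : 3 ≤ M) (hnM : n ≤ M) (hNM : N ≤ M)
    (hgM : gm ≤ M ^ 2)
    (hfront : IsFront n E w (s.nat aGroup) N 0 (fun _ => False)
      (rowOf n (s.nat aRows)) (s.real fRowW) (s.nat rLo 0) (s.nat rHi 0))
    (hEG : ∀ a b, a < n → b < n → s.nat aGroup a < gm → s.nat aGroup b < gm → E a b →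
      s.nat aGroup a ≤ s.nat aGroup b + 1)
    (hN : ∀ γ < gm, TraceBound n E (s.nat aGroup) N γ) :
    Runs (sweepProg adj) ((adj.cost + 1200) * M ^ 7) s fun s' =>
      (∀ u ≤ s'.nat rHi 0, s'.nat aBase u = u * n) ∧
      IsFront n E w (s.nat aGroup) N gm (fun j => s.nat aGroup j < gm)
        (rowOf n (s'.nat aRows)) (s'.real fRowW) (s'.nat rLo 0) (s'.nat rHi 0) := by
  have hM1 : 1 ≤ M := by omega
  let I : ℕ → (ℕ → Prop) → Store → Prop := fun g P s' =>
    (∀ u ≤ s'.nat rHi 0, s'.nat aBase u = u * n) ∧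
      IsFront n E w (s.nat aGroup) N g P
        (rowOf n (s'.nat aRows)) (s'.real fRowW) (s'.nat rLo 0) (s'.nat rHi 0)
  refine Runs.forFrom_pow hM1 (i := 2) (j := 5) (α := adj.cost + 1100) 0 gm
    (fun g => I g fun j => s.nat aGroup j < g) (Nat.zero_le _) (by simpa using hgM)
    rfl ⟨hbase, hfront.mono le_rfl (by simp)⟩ ?_ (by exact of_decide_eq_true rfl)
    (fun i s' x h => by simpa [I] using h) ?_ le_rfl (by simp [NatExpr.cost])
  · intro s' hF
    simp [NatExpr.eval, hF.nat rMax (by exact of_decide_eq_true rfl), hgm]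
  · intro g s₁ _ hg hrg hF hI
    have hs₁ : HasInput n x y w s₁ :=
      hs.of_frame hF (by exact of_decide_eq_true rfl) (by exact of_decide_eq_true rfl)
        (by exact of_decide_eq_true rfl) (by exact of_decide_eq_true rfl)
    have f5 : s₁.nat aGroup = s.nat aGroup := hF.nat _ (by exact of_decide_eq_true rfl)
    -- Objects are handled by group and, within a group, by index. The object being added therefore
    -- has the largest group number so far, as `IsFront.step` demands.
    refine Runs.mono (Runs.forFrom_pow hM1 (i := 1) (j := 4) (α := adj.cost + 1050) 0 n
      (fun i => I g fun j => s.nat aGroup j < g ∨ s.nat aGroup j = g ∧ j < i) (Nat.zero_le _)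
      (by simpa using hnM) rfl ⟨hI.1, hI.2.mono le_rfl (by simp)⟩ ?_
        (by exact of_decide_eq_true rfl)
      (fun i s' x h => by simpa [I] using h) ?_ (r := 5) (γ := adj.cost + 1100) le_rfl
      (by simp [NatExpr.cost])) le_rfl ?_
    · intro s' hF'
      simp [NatExpr.eval, hF'.nat rN (by exact of_decide_eq_true rfl), hs₁.nat]
    · intro i s₂ _ hi hri hF' hI'
      have hs₂ : HasInput n x y w s₂ :=
        hs₁.of_frame hF' (by exact of_decide_eq_true rfl) (by exact of_decide_eq_true rfl)
          (by exact of_decide_eq_true rfl) (by exact of_decide_eq_true rfl)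
      have e5 : s₂.nat aGroup = s.nat aGroup := by
        rw [hF'.nat _ (by exact of_decide_eq_true rfl), f5]
      have e16 : s₂.nat rGroup 0 = g := by rw [hF'.nat _ (by exact of_decide_eq_true rfl), hrg]
      refine Runs.ite_pow hM1 (α := adj.cost + 1000) (fun h => ?_) (fun h => ?_)
        (by simp [Test.cost, NatExpr.cost]; omega) <;>
        simp only [NatExpr.eval, Test.Holds, e5, e16, hri, ← le_antisymm_iff] at h
      · have key := Runs.objectProg (P := fun j => s.nat aGroup j < g ∨ s.nat aGroup j = g ∧ j < i)
          (P' := fun j => s.nat aGroup j < g ∨ s.nat aGroup j = g ∧ j < i + 1) (M := M) (N := N)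
          hadj hs₂ hsymm rfl rfl hI'.1 hM hnM hNM (by rw [e5, hri, h]; exact hI'.2)
          (by rw [hri]; exact hi) (fun j hj => ?_) (by simp [hri, h])
          (fun j hj h' => by rw [e5, hri]; omega)
          (fun a b ha hb ha' hb' hE => by
            rw [e5]; exact hEG a b ha hb (by omega) (by omega) hE)
          (by rw [e5, hri, h]; exact hN g hg)
        · rw [e5, hri, h] at key
          exact key
        · rw [hri]
          constructor
          · rintro (h' | ⟨h', h''⟩)
            · exact .inl (.inl h')
            · by_cases hji : j = i
              · exact .inr hji
              · exact .inl (.inr ⟨h', by omega⟩)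
          · rintro ((h' | ⟨h', h''⟩) | rfl)
            · exact .inl h'
            · exact .inr ⟨h', by omega⟩
            · exact .inr ⟨h, by omega⟩
      · refine Runs.of_loopFree_pow hM1 rfl (by simp [Prog.maxCost]) ?_
        refine ⟨hI'.1, hI'.2.mono le_rfl fun j hj => ?_⟩
        constructor
        · rintro (h' | ⟨h', h''⟩)
          · exact .inl h'
          · exact .inr ⟨h', by omega⟩
        · rintro (h' | ⟨h', h''⟩)
          · exact .inl h'
          · by_cases hji : j = i
            · subst hji; exact absurd h' h
            · exact .inr ⟨h', by omega⟩
    · rintro s₂ ⟨h1, h2⟩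
      exact ⟨h1, h2.mono (Nat.le_succ g) fun j hj => by omega⟩

/-! ### Correctness of the preparation: levels, number of shifts, group numbers -/

theorem Runs.levelsProg {x out n M : ℕ} {s : Store}
  (hout : out ≠ rN ∧ out ≠ rI ∧ out ≠ rJ ∧ out ≠ rL)
    (hn : s.nat rN 0 = n) (hM : 1 ≤ M) (hnM : n ≤ M) (h0 : ∀ i < n, s.nat out i = 0) :
    Runs (levelsProg x out) (150 * M ^ 3) s fun s' =>
      ∀ i < n, s'.nat out i = level n (s.real x) i := by
  obtain ⟨o0, o1, o2, o3⟩ := hout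
  set v := s.real x
  refine Runs.forFrom_pow hM (i := 1) (j := 2) (α := 110) 0 n
    (fun L s' => ∀ i < n, s'.nat out i = levelUpTo n v L i) (Nat.zero_le _) (by simpa using hnM)
    rfl h0 ?_ ?_ ?_ ?_ le_rfl (by decide)
  · intro s' hF
    rw [eval_reg, hF.nat _ (by simp [Prog.natWrites, RealRAM.forFrom, o0.symm]), hn]
  · simp [Prog.natWrites, RealRAM.forFrom, o3.symm]
  · intro i s' z h; simpa [Store.writeNat_nat_of_ne s' 0 z o3] using h
  intro L s₁ _ hL hrL hF hI
  have f0 : s₁.nat rN 0 = n := by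
    rw [hF.nat _ (by simp [Prog.natWrites, RealRAM.forFrom, o0.symm]), hn]
  have g1 : s₁.real x = v := hF.real _ (by simp [Prog.realWrites, RealRAM.forFrom])
  refine Runs.mono (Runs.forFrom_pow hM (i := 1) (j := 1) (α := 75) 0 n
    (fun i s' => ∀ i' < n, s'.nat out i' =
      if i' < i then levelUpTo n v (L + 1) i' else levelUpTo n v L i')
    (Nat.zero_le _) (by simpa using hnM) rfl (by simpa using hI) ?_ ?_ ?_ ?_
    (r := 2) (γ := 110) le_rfl (by decide)) le_rfl
    fun s' h i hi => by simpa [hi] using h i hi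
  · intro s' hF'
    rw [eval_reg, hF'.nat _ (by simp [Prog.natWrites, RealRAM.forFrom, o0.symm]), f0]
  · simp [Prog.natWrites, RealRAM.forFrom, o1.symm]
  · intro i s' z h; simpa [Store.writeNat_nat_of_ne s' 0 z o1] using h
  intro i s₂ _ hi hri hF' hI'
  have f0' : s₂.nat rN 0 = n := by
    rw [hF'.nat _ (by simp [Prog.natWrites, RealRAM.forFrom, o0.symm]), f0]
  have f25 : s₂.nat rL 0 = L := by
    rw [hF'.nat _ (by simp [Prog.natWrites, RealRAM.forFrom, o3.symm]), hrL]
  have g1' : s₂.real x = v := by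
    rw [hF'.real _ (by simp [Prog.realWrites, RealRAM.forFrom]), g1]
  classical
  -- The array is updated in place: entries before `i` have been raised to the new round, and entry
  -- `i` is raised as soon as a suitable predecessor `j' < j` has been found.
  refine Runs.mono (Runs.forFrom_pow hM (i := 1) (j := 0) (α := 40) 0 n
    (fun j s' => ∀ i' < n, s'.nat out i' =
      if i' < i then levelUpTo n v (L + 1) i'
      else if i' = i ∧ ∃ j' < j, HasChain n v L j' ∧ v j' + 2 < v i then L + 1
      else levelUpTo n v L i')
    (Nat.zero_le _) (by simpa using hnM) rfl (by simpa using hI') ?_ ?_ ?_ ?_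
    (r := 1) (γ := 75) le_rfl (by decide)) le_rfl ?_
  · intro s' hF''
    rw [eval_reg, hF''.nat _ (by simp [Prog.natWrites, RealRAM.forFrom, o0.symm]), f0']
  · simp [Prog.natWrites, o2.symm]
  · intro i s' z h; simpa [Store.writeNat_nat_of_ne s' 0 z o2] using h
  · intro j s₃ _ hj hrj hF'' hI''
    have e25 : s₃.nat rL 0 = L := by
      rw [hF''.nat _ (by simp [Prog.natWrites, RealRAM.forFrom, o3.symm]), f25]
    have e17 : s₃.nat rI 0 = i := by
      rw [hF''.nat _ (by simp [Prog.natWrites, RealRAM.forFrom, o1.symm]), hri]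
    have e1 : s₃.real x = v := by
      rw [hF''.real _ (by simp [Prog.realWrites, RealRAM.forFrom]), g1']
    -- The update in place is harmless: an entry already raised to `L + 1` has a chain of `L + 1`
    -- jumps, hence also one of `L` jumps.
    have hLj : L ≤ s₃.nat out j ↔ HasChain n v L j := by
      rw [hI'' j hj]
      split_ifs with h1 h2
      · exact le_levelUpTo_iff (Nat.le_succ L)
      · obtain ⟨rfl, j', hj', h3, h4⟩ := h2
        exact iff_of_true (Nat.le_succ L) (HasChain.pred ⟨j', hj'.trans hj, h3, h4⟩)
      · exact le_levelUpTo_iff le_rfl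
    refine Runs.ite_pow hM (α := 20) (fun h => ?_) (fun h => ?_)
      (by simp [Test.cost, NatExpr.cost, RealExpr.cost]) <;>
      simp only [NatExpr.eval, RealExpr.eval, Test.Holds, e25, e17, e1, hrj, hLj, not_le,
        Rat.cast_ofNat] at h <;>
      refine Runs.of_loopFree_pow hM rfl (by simp [Prog.maxCost, NatExpr.cost]) fun i' hi' => ?_
    · simp only [Prog.run, NatExpr.eval, e17, e25, Store.writeNat_nat_self]
      by_cases hii : i' = i
      · subst hii
        rw [Function.update_self, if_neg (lt_irrefl _), if_pos ⟨rfl, j, Nat.lt_succ_self j, h⟩]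
      · rw [Function.update_of_ne hii, hI'' i' hi']
        simp [hii]
    · simp only [Prog.run]
      rw [hI'' i' hi']
      have : (∃ j' < j + 1, HasChain n v L j' ∧ v j' + 2 < v i) ↔
          ∃ j' < j, HasChain n v L j' ∧ v j' + 2 < v i := by
        constructor
        · rintro ⟨j', h1, h2⟩
          rcases Nat.lt_succ_iff_lt_or_eq.1 h1 with h3 | rfl
          · exact ⟨j', h3, h2⟩
          · exact absurd h2 h
        · rintro ⟨j', h1, h2⟩
          exact ⟨j', by omega, h2⟩
      simp only [this]
  · intro s' h i' hi'
    rw [h i' hi']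
    by_cases h1 : i' < i
    · simp [h1, Nat.lt_succ_of_lt h1]
    · by_cases h2 : i' = i
      · subst h2
        rw [if_neg (lt_irrefl _), if_pos (Nat.lt_succ_self _), levelUpTo]
        by_cases hc : HasChain n v (L + 1) i'
        · rw [if_pos ⟨rfl, hc⟩, if_pos hc]
        · rw [if_neg (fun h => hc h.2), if_neg hc]
      · rw [if_neg h1, if_neg (fun h => h2 h.1), if_neg (by omega)]

theorem Runs.shiftsProg {n M : ℕ} {ε : ℝ} {s : Store} (hε : 0 < ε) (hn : s.nat rN 0 = n)
    (he : s.real fEps 0 = ε) (hM : 1 ≤ M) (hnM : n ≤ M) :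
    Runs shiftsProg (100 * M ^ 1) s fun s' => ∃ k, s'.nat rK 0 = k ∧ 1 ≤ k ∧ k ≤ n + 1 ∧
      (k : ℝ) ≤ 2 + 1 / ε ∧ (n < k ∨ 1 ≤ ((k : ℝ) - 1) * ε) := by
  have main : ∀ d k s', k + d = n + 1 → 1 ≤ k → (k : ℝ) ≤ 2 + 1 / ε → s'.nat rN 0 = n →
      s'.real fEps 0 = ε → s'.nat rK 0 = k → s'.real fK 0 = (k : ℝ) - 1 →
      Runs (.loop (.and (.natLe (reg rK) (reg rN))
        (.neg (.realLe (.lit 1) (.mul (.get fK (.lit 0)) (.get fEps (.lit 0))))))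
      (.seq (.setNat rK (.lit 0) (.add (reg rK) (.lit 1)))
        (.setReal fK (.lit 0) (.add (.get fK (.lit 0)) (.lit 1))))) (d * 30 + 20) s'
        fun s' => ∃ k, s'.nat rK 0 = k ∧ 1 ≤ k ∧ k ≤ n + 1 ∧
          (k : ℝ) ≤ 2 + 1 / ε ∧ (n < k ∨ 1 ≤ ((k : ℝ) - 1) * ε) := by
    intro d
    induction d with
    | zero =>
      intro k s' h1 h2 h3 h4 h5 h6 h7
      refine ⟨_, s', .loopFalse ?_, ?_, k, h6, h2, by omega, h3, .inl (by omega)⟩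
      · simp only [Test.Holds, NatExpr.eval, h4, h6]
        omega
      · simp [Test.cost, NatExpr.cost, RealExpr.cost]
    | succ d ih =>
      intro k s' h1 h2 h3 h4 h5 h6 h7
      by_cases hb : 1 ≤ ((k : ℝ) - 1) * ε
      · refine ⟨_, s', .loopFalse ?_, ?_, k, h6, h2, by omega, h3, .inr hb⟩
        · simpa [Test.Holds, NatExpr.eval, RealExpr.eval, h4, h5, h6, h7] using fun _ => hb
        · simp [Test.cost, NatExpr.cost, RealExpr.cost]
      -- The loop continues only while (k - 1)ε < 1, so that k + 1 ≤ 2 + 1/ε still holds after the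
      -- increment.
      · obtain ⟨t, s'', hex, ht, hQ⟩ := ih (k + 1)
          ((s'.writeNat rK 0 (k + 1)).writeReal fK 0 ((k : ℝ) - 1 + 1)) (by omega) (by omega)
          (by
            have : ((k : ℝ) - 1) ≤ 1 / ε := by rw [le_div_iff₀ hε]; linarith
            push_cast; linarith)
          (by simp [h4]) (by simp [h5]) (by simp) (by simp)
        have hset1 := Exec.setNat rK (.lit 0) (.add (reg rK) (.lit 1)) s'
        have hset2 := Exec.setReal fK (.lit 0) (.add (.get fK (.lit 0)) (.lit 1))
          (s'.writeNat rK 0 (k + 1))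
        rw [show (NatExpr.add (reg rK) (.lit 1)).eval s' = k + 1 by simp [NatExpr.eval, h6]] at hset1
        rw [show (RealExpr.add (.get fK (.lit 0)) (.lit 1)).eval (s'.writeNat rK 0 (k + 1)) =
          (k : ℝ) - 1 + 1 by simp [RealExpr.eval, NatExpr.eval, h7]] at hset2
        refine ⟨_, s'', .loopTrue ?_ (.seq hset1 hset2) hex, ?_, hQ⟩
        · have hk : k ≤ n := by omega
          simp only [Test.Holds, NatExpr.eval, RealExpr.eval, h4, h5, h6, h7, Rat.cast_one]
          exact ⟨hk, hb⟩
        · simp only [Test.cost, NatExpr.cost, RealExpr.cost]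
          omega
  refine Runs.seq (T₁ := 10) (R := fun s' => s' = (s.writeNat rK 0 1).writeReal fK 0 0)
    (Runs.of_loopFree rfl (by decide) (by simp [Prog.run, NatExpr.eval, RealExpr.eval]))
    (T₂ := n * 30 + 20) ?_ (by rw [pow_one]; omega)
  rintro s₁ rfl -
  refine main n 1 _ (by omega) le_rfl ?_ (by simp [hn]) (by simp [he]) (by simp) (by simp)
  have : 0 < 1 / ε := by positivity
  push_cast; linarith

theorem Runs.maxProg {n M : ℕ} {s : Store} (hn : s.nat rN 0 = n) (hM : 1 ≤ M) (hnM : n ≤ M) :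
    Runs maxProg (100 * M ^ 1) s fun s' => s'.nat rMax 0 = n * n + n := by
  refine Runs.seq_pow hM (α := 10) (i := 0) (R := fun s' => s' = s.writeNat rMax 0 n)
    (Runs.of_loopFree_pow hM rfl (by decide) (by simp [Prog.run, NatExpr.eval, hn]))
    (β := 80) (j := 1) ?_ (by simp) le_rfl (by simp)
  rintro s₁ rfl -
  refine Runs.forFrom_pow hM (i := 1) (j := 0) (α := 20) 0 n
    (fun j s' => s'.nat rMax 0 = j * n + n) (Nat.zero_le _) (by simpa using hnM) rfl (by simp)
    ?_ (by decide) (fun i s' x h => by simpa using h) ?_ (by simp) (by decide)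
  · intro s' hF
    simp [NatExpr.eval, hF.nat rN (by decide), hn]
  · intro j s' _ hj hrj hF hI
    refine Runs.of_loopFree_pow hM rfl (by decide) ?_
    simp [Prog.run, NatExpr.eval, hF.nat rN (by decide), hn, hI]
    ring

theorem succ_mod_eq {l k : ℕ} (hk : 0 < k) :
    (l + 1) % k = if k ≤ l % k + 1 then 0 else l % k + 1 := by
  have := Nat.mod_lt l hk
  rw [← Nat.mod_add_mod]
  split_ifs with h
  · rw [show l % k + 1 = k by omega, Nat.mod_self]
  · exact Nat.mod_eq_of_lt (by omega)

theorem Runs.groupsProg {n k r M : ℕ} {s : Store} (hn : s.nat rN 0 = n) (hk : s.nat rK 0 = k)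
    (hr : s.nat rR 0 = r) (hrk : r < k) (hgm : s.nat rMax 0 = n * n + n)
    (hy : ∀ j < n, s.nat aLevelY j < n) (hM : 1 ≤ M) (hnM : n ≤ M) :
    Runs groupsProg (300 * M ^ 1) s fun s' =>
      ∀ j < n, s'.nat aGroup j = groupOf n k r (s.nat aLevelX j) (s.nat aLevelY j) := by
  refine Runs.seq_pow hM (α := 10) (i := 0)
    (R := fun s' => s' = (s.writeNat rCount 0 0).writeNat rStart 0 0)
    (Runs.of_loopFree_pow hM rfl (by decide) (by simp [Prog.run, NatExpr.eval]))
    (β := 250) (j := 1) ?_ (by simp) le_rfl (by simp)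
  rintro s₁ rfl -
  refine Runs.seq_pow hM (i := 1) (α := 150) (R := fun s' => ∀ l < n, s'.nat aOffset l =
      if l % k = r then n * n + n else n * Nat.count (fun m => m % k = r) l) ?_
    (β := 100) (j := 1) ?_ (by simp) le_rfl (by simp)
  -- `rCount` runs cyclically through the residues, and `rStart` grows by `n` at each removed level.
  · refine Runs.mono (Runs.forFrom_pow hM (i := 1) (j := 0) (α := 100) 0 n
      (fun l s' => s'.nat rCount 0 = l % k ∧
        s'.nat rStart 0 = n * Nat.count (fun m => m % k = r) l ∧ ∀ l' < l, s'.nat aOffset l' =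
          if l' % k = r then n * n + n else n * Nat.count (fun m => m % k = r) l')
      (Nat.zero_le _) (by simpa using hnM) rfl (by simp)
      ?_ (by decide) (fun i s' x h => by simpa using h) ?_ (r := 1) (γ := 150) (by simp)
      (by decide)) le_rfl fun s' h => h.2.2
    · intro s' hF
      simp [NatExpr.eval, hF.nat rN (by decide), hn]
    · rintro l s' - hl hrl hF ⟨h1, h2, h3⟩
      have f0 : s'.nat rN 0 = n := by rw [hF.nat _ (by decide)]; simpa using hn
      have f8 : s'.nat rK 0 = k := by rw [hF.nat _ (by decide)]; simpa using hk
      have f9 : s'.nat rR 0 = r := by rw [hF.nat _ (by decide)]; simpa using hr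
      have f10 : s'.nat rMax 0 = n * n + n := by rw [hF.nat _ (by decide)]; simpa using hgm
      refine Runs.seq_pow hM (α := 40) (i := 0) (R := fun s'' => s''.nat rCount 0 = l % k ∧
        s''.nat rStart 0 = n * Nat.count (fun m => m % k = r) (l + 1) ∧
        ∀ l' < l + 1, s''.nat aOffset l' =
          if l' % k = r then n * n + n else n * Nat.count (fun m => m % k = r) l')
        ?_ (β := 50) (j := 0) ?_ le_rfl le_rfl (by simp)
      · refine Runs.ite_pow hM (α := 20) (fun h => ?_) (fun h => ?_) (by decide) <;>
          simp only [NatExpr.eval, Test.Holds, h1, f9, ← le_antisymm_iff] at h <;>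
          refine Runs.of_loopFree_pow hM rfl (by decide) ?_ <;>
          simp only [Prog.run, NatExpr.eval, hrl, f10] <;>
          refine ⟨by simp [h1], by simp [h2, f0, Nat.count_succ, h, mul_add], fun l' hl' => ?_⟩
        · rw [Store.writeNat_nat_of_ne _ _ _ (by decide), Store.writeNat_nat_self]
          rcases Nat.lt_succ_iff_lt_or_eq.1 hl' with h4 | rfl
          · rw [Function.update_of_ne h4.ne, h3 l' h4]
          · simp [h]
        · rw [Store.writeNat_nat_self]
          rcases Nat.lt_succ_iff_lt_or_eq.1 hl' with h4 | rfl
          · rw [Function.update_of_ne h4.ne, h3 l' h4]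
          · simp [h, h2]
      · rintro s₂ ⟨h4, h5, h6⟩ hF'
        have e8 : s₂.nat rK 0 = k := by rw [hF'.nat _ (by decide), f8]
        refine Runs.seq_pow hM (α := 10) (i := 0)
          (R := fun s' => s' = s₂.writeNat rCount 0 (l % k + 1))
          (Runs.of_loopFree_pow hM rfl (by decide) (by simp [Prog.run, NatExpr.eval, h4]))
          (β := 40) (j := 0) ?_ (by simp) le_rfl (by simp)
        rintro s₃ rfl -
        refine Runs.ite_pow hM (α := 20) (fun h => ?_) (fun h => ?_) (by decide) <;>
          simp only [NatExpr.eval, Test.Holds, Store.writeNat_nat_self, Function.update_self] at h <;>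
          rw [Store.writeNat_nat_of_ne _ _ _ (by decide), e8] at h <;>
          refine Runs.of_loopFree_pow hM rfl (by decide) ?_ <;>
          simp only [Prog.run, NatExpr.eval] <;>
          refine ⟨?_, by simpa using h5, by simpa using h6⟩
        · simp [succ_mod_eq (l := l) (Nat.zero_lt_of_lt hrk), h]
        · simp [succ_mod_eq (l := l) (Nat.zero_lt_of_lt hrk), h]
  · intro s₁ hoff hF
    have f2 : s₁.nat aLevelY = s.nat aLevelY := by rw [hF.nat _ (by decide)]; simp
    have f3 : s₁.nat aLevelX = s.nat aLevelX := by rw [hF.nat _ (by decide)]; simp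
    refine Runs.forFrom_pow hM (i := 1) (j := 0) (α := 40) 0 n
      (fun j s' => ∀ j' < j, s'.nat aGroup j' =
        groupOf n k r (s.nat aLevelX j') (s.nat aLevelY j'))
      (Nat.zero_le _) (by simpa using hnM) rfl (by simp)
      ?_ (by decide) (fun i s' x h => by simpa using h) ?_ (by simp) (by decide)
    · intro s' hF'
      rw [eval_reg, hF'.nat rN (by decide), hF.nat rN (by decide)]
      simpa using hn
    · intro j s' _ hj hrj hF' hI
      refine Runs.of_loopFree_pow hM rfl (by decide) fun j' hj' => ?_
      simp only [Prog.run, NatExpr.eval, hrj, hF'.nat aOffset (by decide),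
        hF'.nat aLevelX (by decide), hF'.nat aLevelY (by decide), f2, f3,
        Store.writeNat_nat_self]
      rcases Nat.lt_succ_iff_lt_or_eq.1 hj' with h4 | rfl
      · rw [Function.update_of_ne h4.ne, hI j' h4]
      · rw [Function.update_self, hoff _ (hy _ hj), groupOf]

theorem Runs.initProg {n M : ℕ} {s : Store} (hn : s.nat rN 0 = n) (hM : 1 ≤ M) (hnM : n ≤ M) :
    Runs initProg (100 * M ^ 1) s fun s' => s'.nat rLo 0 = 0 ∧ s'.nat rHi 0 = 1 ∧
      (∀ u ≤ 1, s'.nat aBase u = u * n) ∧ rowOf n (s'.nat aRows) 0 = 0 ∧ s'.real fRowW 0 = 0 := by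
  refine Runs.seq_pow hM (α := 40) (i := 0)
    (R := fun s' => s'.nat rLo 0 = 0 ∧ s'.nat rHi 0 = 1 ∧
      (∀ u ≤ 1, s'.nat aBase u = u * n) ∧ s'.real fRowW 0 = 0)
    (Runs.of_loopFree_pow hM rfl (by decide) ?_)
    (β := 50) (j := 1) ?_ (by simp) le_rfl (by simp)
  · simp only [Prog.run, NatExpr.eval, RealExpr.eval]
    refine ⟨by simp, by simp, fun u hu => ?_, by simp⟩
    obtain rfl | rfl : u = 0 ∨ u = 1 := by omega
    · simp
    · simp [hn]
  · rintro s₁ ⟨h1, h2, h3, h4⟩ hF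
    -- Row 0 has to be cleared because it holds a row from the sweep of an earlier shift.
    refine Runs.mono (Runs.forFrom_pow hM (i := 1) (j := 0) (α := 10) 0 n
      (fun j s' => ∀ j' < j, s'.nat aRows j' = 0)
      (Nat.zero_le _) (by simpa using hnM) rfl (by simp)
      ?_ (by decide) (fun i s' x h => by simpa using h) ?_ (r := 1) (γ := 50) (by simp)
      (by decide)).frame le_rfl ?_
    · intro s' hF'
      rw [eval_reg, hF'.nat rN (by decide), hF.nat rN (by decide), hn]
    · intro j s' _ hj hrj hF' hI
      refine Runs.of_loopFree_pow hM rfl (by decide) fun j' hj' => ?_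
      simp only [Prog.run, NatExpr.eval, hrj, Store.writeNat_nat_self]
      rcases Nat.lt_succ_iff_lt_or_eq.1 hj' with h4 | rfl
      · rw [Function.update_of_ne h4.ne, hI j' h4]
      · simp
    · rintro s' ⟨h, hF'⟩
      rw [hF'.nat rLo (by decide), hF'.nat rHi (by decide), hF'.nat aBase (by decide),
        hF'.real fRowW (by decide)]
      refine ⟨h1, h2, h3, ?_, h4⟩
      funext j
      simp only [rowOf, trunc, zero_mul, zero_add, Pi.zero_apply, ite_eq_right_iff]
      exact h j

theorem Runs.outputProg {n lo hi M : ℕ} {w : ℕ → ℝ} {E : ℕ → ℕ → Prop} {s : Store}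
    (hn : s.nat rN 0 = n) (hlo : s.nat rLo 0 = lo) (hhi : s.nat rHi 0 = hi) (hle : lo ≤ hi)
    (hbase : ∀ u ≤ hi, s.nat aBase u = u * n) (hM : 1 ≤ M) (hnM : n ≤ M) (hlM : hi - lo ≤ M)
    (hrow : ∀ u, lo ≤ u → u < hi → IsColoring n E (fun _ => True) (rowOf n (s.nat aRows) u))
    (hW : ∀ u, lo ≤ u → u < hi →
      s.real fRowW u = colorWeight n w (rowOf n (s.nat aRows) u))
    (hout : IsColoring n E (fun _ => True) (trunc n (s.nat aOut)))
    (hbest : s.real fBest 0 = colorWeight n w (trunc n (s.nat aOut))) :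
    Runs outputProg (200 * M ^ 2) s fun s' =>
      IsColoring n E (fun _ => True) (trunc n (s'.nat aOut)) ∧
      s'.real fBest 0 = colorWeight n w (trunc n (s'.nat aOut)) ∧
      s.real fBest 0 ≤ s'.real fBest 0 ∧
      ∀ u, lo ≤ u → u < hi → s.real fRowW u ≤ s'.real fBest 0 := by
  refine Runs.forFrom_pow hM (i := 1) (j := 1) (α := 120) lo hi (fun m s' =>
      IsColoring n E (fun _ => True) (trunc n (s'.nat aOut)) ∧
      s'.real fBest 0 = colorWeight n w (trunc n (s'.nat aOut)) ∧
      s.real fBest 0 ≤ s'.real fBest 0 ∧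
      ∀ u, lo ≤ u → u < m → s.real fRowW u ≤ s'.real fBest 0)
    hle (by simpa using hlM) (by simp [NatExpr.eval, hlo])
    ⟨hout, hbest, le_rfl, fun u h1 h2 => by omega⟩ ?_ (by decide)
    (fun i s' x h => by simpa using h) ?_ le_rfl (by decide)
  · intro s' hF
    rw [eval_reg, hF.nat rHi (by decide), hhi]
  · rintro u s₁ hu hu' hru hF ⟨h1, h2, h3, h4⟩
    have f6 : s₁.nat aRows = s.nat aRows := hF.nat _ (by decide)
    have f7 : s₁.nat aBase = s.nat aBase := hF.nat _ (by decide)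
    have g4 : s₁.real fRowW = s.real fRowW := hF.real _ (by decide)
    refine Runs.ite_pow hM (α := 100) (fun h => ?_) (fun h => ?_) (by decide) <;>
      simp only [NatExpr.eval, RealExpr.eval, Test.Holds, hru, g4, not_le] at h
    · refine Runs.of_loopFree_pow hM rfl (by decide) ⟨h1, h2, h3, fun v hv hv' => ?_⟩
      rcases Nat.lt_succ_iff_lt_or_eq.1 hv' with h5 | rfl
      · exact h4 v hv h5
      · exact h
    · refine Runs.seq_pow hM (α := 20) (i := 0)
        (R := fun s' => s' = s₁.writeReal fBest 0 (s.real fRowW u))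
        (Runs.of_loopFree_pow hM rfl (by decide)
          (by simp [Prog.run, NatExpr.eval, RealExpr.eval, hru, g4]))
        (β := 80) (j := 1) ?_ (by simp) le_rfl (by simp)
      rintro s₂ rfl -
      refine Runs.mono (Runs.forFrom_pow hM (i := 1) (j := 0) (α := 40) 0 n
        (fun j s' => ∀ j' < j, s'.nat aOut j' = s.nat aRows (u * n + j'))
        (Nat.zero_le _) (by simpa using hnM) rfl (by simp)
        ?_ (by decide) (fun i s' x h => by simpa using h) ?_ (r := 1) (γ := 80) (by simp)
        (by decide)).frame le_rfl ?_
      · intro s' hF'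
        rw [eval_reg, hF'.nat rN (by decide), Store.writeReal_nat, hF.nat rN (by decide), hn]
      · intro j s' _ hj hrj hF' hI
        refine Runs.of_loopFree_pow hM rfl (by decide) fun j' hj' => ?_
        simp only [Prog.run, NatExpr.eval, hrj, hF'.nat aRows (by decide),
          hF'.nat aBase (by decide), hF'.nat rU (by decide), Store.writeReal_nat, f6, f7, hru,
          hbase u hu'.le, Store.writeNat_nat_self]
        rcases Nat.lt_succ_iff_lt_or_eq.1 hj' with h4 | rfl
        · rw [Function.update_of_ne h4.ne, hI j' h4]
        · simp
      · rintro s' ⟨h5, hF'⟩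
        have hb : s'.real fBest 0 = s.real fRowW u := by
          rw [hF'.real _ (by decide)]
          simp
        have ho : trunc n (s'.nat aOut) = rowOf n (s.nat aRows) u := by
          funext j
          by_cases hj : j < n
          · simp [trunc, rowOf, hj, h5 j hj]
          · simp [trunc, rowOf, hj]
        rw [hb, ho]
        refine ⟨hrow u hu hu', hW u hu hu', by linarith, fun v hv hv' => ?_⟩
        rcases Nat.lt_succ_iff_lt_or_eq.1 hv' with h6 | rfl
        · linarith [h4 v hv h6]
        · exact le_rfl

/-! ### One shift and the whole scheme -/

/-- Needed because the computed array of group numbers agrees with `groupOf` only on the indices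
below `n`. -/
theorem TraceBound.congr {n : ℕ} {E : ℕ → ℕ → Prop} {G G' : ℕ → ℕ} {N γ : ℕ}
    (h : TraceBound n E G N γ) (hG : ∀ j < n, G' j = G j) : TraceBound n E G' N γ := by
  obtain ⟨key, hkey⟩ := h
  refine ⟨key, fun f f' hf hf' he j hj hγ => hkey f f' (hf.mono fun j hj h => ?_)
    (hf'.mono fun j hj h => ?_) he j hj (by rw [← hG j hj]; exact hγ)⟩
  · rw [← hG j hj]; exact h
  · rw [← hG j hj]; exact h

theorem Runs.shiftProg {adj : Test} {n k r N M : ℕ} {x y w : ℕ → ℝ} {E : ℕ → ℕ → Prop} {s : Store}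
    (hadj : Decides adj x y E) (hs : HasInput n x y w s) (hsymm : ∀ a b, E a b → E b a)
    (hnear : ∀ i j, i < n → j < n → |x i - x j| ≤ 1 → |y i - y j| ≤ 1 → E i j)
    (hfar : ∀ i j, i < n → j < n → E i j → |x i - x j| ≤ 2 ∧ |y i - y j| ≤ 2)
    (hM : 3 ≤ M) (hnM : n + 1 ≤ M) (hN : N = (n + 1) ^ (16 * k)) (hNM : N ≤ M)
    (hk : s.nat rK 0 = k) (hr : s.nat rR 0 = r) (hrk : r < k)
    (hgm : s.nat rMax 0 = n * n + n) (hly : ∀ j < n, s.nat aLevelY j = level n y j)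
    (hlx : ∀ j < n, s.nat aLevelX j = level n x j)
    (hout : IsColoring n E (fun _ => True) (trunc n (s.nat aOut)))
    (hbest : s.real fBest 0 = colorWeight n w (trunc n (s.nat aOut))) :
    Runs (shiftProg adj) ((adj.cost + 2000) * M ^ 7) s fun s' =>
        IsColoring n E (fun _ => True) (trunc n (s'.nat aOut)) ∧
        s'.real fBest 0 = colorWeight n w (trunc n (s'.nat aOut)) ∧
        s.real fBest 0 ≤ s'.real fBest 0 ∧
        ∀ g, IsColoring n E (fun j => level n y j % k ≠ r) g →
          colorWeight n w g ≤ s'.real fBest 0 := by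
  have hM1 : 1 ≤ M := by omega
  have hnM' : n ≤ M := by omega
  refine Runs.seq_pow hM1 (Runs.groupsProg hs.nat hk hr hrk hgm
    (fun j hj => by rw [hly j hj]; exact level_lt hj) hM1 hnM')
    (β := adj.cost + 1600) (j := 7) ?_ (by simp) le_rfl (by omega)
  intro s₁ hG hF
  have hs₁ : HasInput n x y w s₁ := hs.of_frame hF (by decide) (by decide) (by decide) (by decide)
  replace hG : ∀ j < n, s₁.nat aGroup j = groupOf n k r (level n x j) (level n y j) :=
    fun j hj => by rw [hG j hj, hly j hj, hlx j hj]
  have a1 : s₁.nat aOut = s.nat aOut := hF.nat _ (by decide)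
  have a10 : s₁.nat rMax = s.nat rMax := hF.nat _ (by decide)
  have b5 : s₁.real fBest = s.real fBest := hF.real _ (by decide)
  refine Runs.seq_pow hM1 (Runs.initProg hs₁.nat hM1 hnM')
    (β := adj.cost + 1500) (j := 7) ?_ (by simp) le_rfl (by omega)
  rintro s₂ ⟨h1, h2, h3, h4, h5⟩ hF₂
  have hs₂ : HasInput n x y w s₂ :=
    hs₁.of_frame hF₂ (by decide) (by decide) (by decide) (by decide)
  have c1 : s₂.nat aOut = s.nat aOut := by rw [hF₂.nat _ (by decide), a1]
  have c5 : s₂.nat aGroup = s₁.nat aGroup := hF₂.nat _ (by decide)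
  have c10 : s₂.nat rMax = s.nat rMax := by rw [hF₂.nat _ (by decide), a10]
  have d5 : s₂.real fBest = s.real fBest := by rw [hF₂.real _ (by decide), b5]
  have hkept : ∀ j < n, s₁.nat aGroup j < n * n + n ↔ level n y j % k ≠ r := fun j hj => by
    rw [hG j hj]; exact groupOf_lt_iff (level_lt hj) (level_lt hj)
  -- The bound n · n + n separates kept from removed objects. The sweep stops there, so removed
  -- objects never enter a colouring.
  have hsweep := Runs.sweepProg (n := n) (gm := n * n + n) (N := N) (M := M) hadj hs₂ hsymm
    (by rw [c10, hgm]) (by rw [h2]; exact h3) hM hnM' hNM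
    (by nlinarith) (by
      rw [h1, h2]
      exact IsFront.init (by rw [hN]; exact Nat.one_le_pow _ _ (Nat.succ_pos n)) h4 h5
        fun _ _ h => h)
    (fun a b ha hb ha' hb' hE => by
      rw [c5] at ha' hb' ⊢
      rw [hkept a ha] at ha'
      rw [hkept b hb] at hb'
      rw [hG a ha, hG b hb]
      obtain ⟨hx, hy⟩ := hfar a b ha hb hE
      rw [abs_le] at hx hy
      exact groupOf_le_succ ha' hb' (level_le_succ ha hb (by linarith))
        (level_le_succ ha hb (by linarith)) (level_le_succ hb ha (by linarith)))
    (fun γ hγ => TraceBound.congr (by rw [hN]; exact traceBound_groupOf hrk hγ hnear)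
      fun j hj => by rw [c5, hG j hj])
  refine Runs.seq_pow hM1 hsweep (β := 200) (j := 2) ?_ le_rfl (by simp) (by omega)
  rintro s₃ ⟨hb, hfront⟩ hF₃
  have e1 : s₃.nat aOut = s.nat aOut := by
    rw [hF₃.nat _ (by exact of_decide_eq_true rfl), c1]
  have e5 : s₃.real fBest = s.real fBest := by
    rw [hF₃.real _ (by exact of_decide_eq_true rfl), d5]
  have e0 : s₃.nat rN 0 = n := by
    rw [hF₃.nat _ (by exact of_decide_eq_true rfl), hs₂.nat]
  refine (Runs.outputProg (n := n) (w := w) (E := E) (M := M) e0 rfl rfl hfront.le hb hM1 hnM'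
    (hfront.sub_le.trans hNM)
    (fun u hu hu' => (hfront.coloring u hu hu').mono fun _ _ _ => trivial) hfront.weight
    (by rw [e1]; exact hout) (by rw [e1, e5, hbest])).mono le_rfl ?_
  rintro s₄ ⟨h6, h7, h8, h9⟩
  refine ⟨h6, h7, by rwa [e5] at h8, fun g hg => ?_⟩
  obtain ⟨u, hu, hu', -, huw⟩ := hfront.complete g
    (hg.mono fun j hj h => by rw [c5]; exact (hkept j hj).2 h)
  exact huw.trans (h9 u hu hu')

theorem Runs.schemeProg {adj : Test} {n M : ℕ} {ε : ℝ} {x y w : ℕ → ℝ} {E : ℕ → ℕ → Prop}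
    {s : Store} (hadj : Decides adj x y E) (hs : HasInput n x y w s) (hε : 0 < ε)
    (he : s.real fEps 0 = ε) (hsymm : ∀ a b, E a b → E b a)
    (hnear : ∀ i j, i < n → j < n → |x i - x j| ≤ 1 → |y i - y j| ≤ 1 → E i j)
    (hfar : ∀ i j, i < n → j < n → E i j → |x i - x j| ≤ 2 ∧ |y i - y j| ≤ 2)
    (hM : 3 ≤ M) (hnM : n + 1 ≤ M)
    (hNM : ∀ k : ℕ, k ≤ n + 1 → (k : ℝ) ≤ 2 + 1 / ε → (n + 1) ^ (16 * k) ≤ M)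
    (h1 : s.nat aOut = 0) (h2 : s.nat aLevelY = 0) (h3 : s.nat aLevelX = 0) :
    Runs (schemeProg adj) ((adj.cost + 3000) * M ^ 8) s fun s' =>
      IsColoring n E (fun _ => True) (trunc n (s'.nat aOut)) ∧
      ∀ f, IsColoring n E (fun _ => True) f →
        colorWeight n w f ≤ (1 + ε) * colorWeight n w (trunc n (s'.nat aOut)) := by
  have hM1 : 1 ≤ M := by omega
  have hnM' : n ≤ M := by omega
  refine Runs.seq_pow hM1 (Runs.shiftsProg hε hs.nat he hM1 hnM') (β := adj.cost + 2800) (j := 8)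
    ?_ (by simp) le_rfl (by omega)
  rintro s₁ ⟨k, hk, hk1, hkn, hkε, hkε'⟩ hF₁
  have hs₁ : HasInput n x y w s₁ :=
    hs.of_frame hF₁ (by decide) (by decide) (by decide) (by decide)
  have l1 : s₁.nat aOut = 0 := by rw [hF₁.nat _ (by decide), h1]
  have l2 : s₁.nat aLevelY = 0 := by rw [hF₁.nat _ (by decide), h2]
  have l3 : s₁.nat aLevelX = 0 := by rw [hF₁.nat _ (by decide), h3]
  refine Runs.seq_pow hM1 (Runs.levelsProg (x := fY) (out := aLevelY) (by decide) hs₁.nat hM1 hnM'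
    fun i _ => by rw [l2]; rfl) (β := adj.cost + 2600) (j := 8) ?_ (by simp) le_rfl (by omega)
  rintro s₂ hly hF₂
  have hs₂ : HasInput n x y w s₂ :=
    hs₁.of_frame hF₂ (by decide) (by decide) (by decide) (by decide)
  have m1 : s₂.nat aOut = 0 := by rw [hF₂.nat _ (by decide), l1]
  have m3 : s₂.nat aLevelX = 0 := by rw [hF₂.nat _ (by decide), l3]
  have m8 : s₂.nat rK 0 = k := by rw [hF₂.nat _ (by decide), hk]
  rw [hs₁.y] at hly
  refine Runs.seq_pow hM1 (Runs.levelsProg (x := fX) (out := aLevelX) (by decide) hs₂.nat hM1 hnM'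
    fun i _ => by rw [m3]; rfl) (β := adj.cost + 2400) (j := 8) ?_ (by simp) le_rfl (by omega)
  rintro s₃ hlx hF₃
  have hs₃ : HasInput n x y w s₃ :=
    hs₂.of_frame hF₃ (by decide) (by decide) (by decide) (by decide)
  have p1 : s₃.nat aOut = 0 := by rw [hF₃.nat _ (by decide), m1]
  have p2 : s₃.nat aLevelY = s₂.nat aLevelY := hF₃.nat _ (by decide)
  have p8 : s₃.nat rK 0 = k := by rw [hF₃.nat _ (by decide), m8]
  rw [hs₂.x] at hlx
  refine Runs.seq_pow hM1 (Runs.maxProg hs₃.nat hM1 hnM') (β := adj.cost + 2200) (j := 8)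
    ?_ (by simp) le_rfl (by omega)
  rintro s₄ hgm hF₄
  have hs₄ : HasInput n x y w s₄ :=
    hs₃.of_frame hF₄ (by decide) (by decide) (by decide) (by decide)
  have q1 : s₄.nat aOut = 0 := by rw [hF₄.nat _ (by decide), p1]
  have q2 : s₄.nat aLevelY = s₂.nat aLevelY := by rw [hF₄.nat _ (by decide), p2]
  have q3 : s₄.nat aLevelX = s₃.nat aLevelX := hF₄.nat _ (by decide)
  have q8 : s₄.nat rK 0 = k := by rw [hF₄.nat _ (by decide), p8]
  refine Runs.seq_pow hM1 (α := 10) (i := 0) (R := fun s' => s' = s₄.writeReal fBest 0 0)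
    (Runs.of_loopFree_pow hM1 rfl (by decide) (by simp [Prog.run, NatExpr.eval, RealExpr.eval]))
    (β := adj.cost + 2100) (j := 8) ?_ (by simp) le_rfl (by omega)
  rintro s₅ rfl -
  have hs₅ : HasInput n x y w (s₄.writeReal fBest 0 0) :=
    ⟨hs₄.nat, by simp [hs₄.x], by simp [hs₄.y], by simp [hs₄.w]⟩
  have htr : trunc n (0 : ℕ → ℕ) = 0 := by funext j; simp [trunc]
  -- The best value starts at 0, the weight of the empty output, and never decreases. After all
  -- shifts it dominates every colouring that avoids some residue, which is the input of
  -- `colorWeight_le_of_shifts`.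
  refine Runs.mono (Runs.forFrom_pow hM1 (i := 1) (j := 7) (α := adj.cost + 2000) 0 k (fun r s' =>
      IsColoring n E (fun _ => True) (trunc n (s'.nat aOut)) ∧
      s'.real fBest 0 = colorWeight n w (trunc n (s'.nat aOut)) ∧
      ∀ r' < r, ∀ g, IsColoring n E (fun j => level n y j % k ≠ r') g →
        colorWeight n w g ≤ s'.real fBest 0)
    (Nat.zero_le _) (by rw [pow_one]; omega) rfl ?_ ?_ (by exact of_decide_eq_true rfl)
    (fun i s' x h => by simpa using h) ?_ le_rfl (by simp [NatExpr.cost])) le_rfl ?_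
  · refine ⟨?_, ?_, fun r' h => by omega⟩
    · rw [Store.writeReal_nat, q1, htr]
      exact ⟨by simp, by simp, by simp, by simp⟩
    · rw [Store.writeReal_nat, q1, htr]
      simp [colorWeight]
  · intro s' hF
    rw [eval_reg, hF.nat rK (by exact of_decide_eq_true rfl), Store.writeReal_nat, q8]
  · rintro r s₆ - hr hrr hF ⟨h4, h5, h6⟩
    refine (Runs.shiftProg (N := (n + 1) ^ (16 * k)) (M := M) hadj
      (hs₅.of_frame hF (by exact of_decide_eq_true rfl) (by exact of_decide_eq_true rfl)
        (by exact of_decide_eq_true rfl) (by exact of_decide_eq_true rfl)) hsymm hnear hfar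
      hM hnM rfl (hNM k hkn hkε)
      (by rw [hF.nat rK (by exact of_decide_eq_true rfl), Store.writeReal_nat, q8]) hrr hr
      (by rw [hF.nat rMax (by exact of_decide_eq_true rfl), Store.writeReal_nat, hgm])
      (fun j hj => by
        rw [hF.nat aLevelY (by exact of_decide_eq_true rfl), Store.writeReal_nat, q2, hly j hj])
      (fun j hj => by
        rw [hF.nat aLevelX (by exact of_decide_eq_true rfl), Store.writeReal_nat, q3, hlx j hj])
      h4 h5).mono le_rfl ?_
    rintro s₇ ⟨h7, h8, h9, h10⟩
    refine ⟨h7, h8, fun r' hr' g hg => ?_⟩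
    rcases Nat.lt_succ_iff_lt_or_eq.1 hr' with h11 | rfl
    · exact (h6 r' h11 g hg).trans h9
    · exact h10 g hg
  · rintro s' ⟨h4, h5, h6⟩
    refine ⟨h4, fun f hf => ?_⟩
    rw [← h5]
    exact colorWeight_le_of_shifts hε (fun i hi => level_lt hi) hkε' h6 hf

/-- Cell `i` of the real-number array `a` minus cell `j`. -/
abbrev diffExpr (a i j : ℕ) : RealExpr := .sub (.get a (reg i)) (.get a (reg j))

/-- Whether the unit disks with the numbers in the registers intersect. -/
def diskTest : Test :=
  .realLe (.add (.mul (diffExpr fX rI rJ) (diffExpr fX rI rJ))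
    (.mul (diffExpr fY rI rJ) (diffExpr fY rI rJ))) (.lit 4)

/-- Whether the unit squares with the numbers in the registers intersect. -/
def squareTest : Test :=
  .and (.and (.realLe (diffExpr fX rI rJ) (.lit 1)) (.realLe (diffExpr fX rJ rI) (.lit 1)))
    (.and (.realLe (diffExpr fY rI rJ) (.lit 1)) (.realLe (diffExpr fY rJ rI) (.lit 1)))

/-- Give all objects the weight `1`. -/
def unitWeightsProg : Prog :=
  forFrom rJ (.lit 0) (reg rN) (.setReal fW (reg rJ) (.lit 1))

end RealRAM

open RealRAM

/-! ### Unit disks and unit squares -/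

/-- If the centres are at distance at most 2, the midpoint lies in both disks. The midpoint serves
for squares in the same way. -/
theorem unitDisk_inter_nonempty_iff {p q : Plane} :
    (unitDisk p ∩ unitDisk q).Nonempty ↔
      (p 0 - q 0) * (p 0 - q 0) + (p 1 - q 1) * (p 1 - q 1) ≤ 4 := by
  have hd : dist p q ≤ 2 ↔ (p 0 - q 0) * (p 0 - q 0) + (p 1 - q 1) * (p 1 - q 1) ≤ 4 := by
    rw [EuclideanSpace.dist_eq, Real.sqrt_le_left (by norm_num), Fin.sum_univ_two,
      Real.dist_eq, Real.dist_eq, sq_abs, sq_abs]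
    norm_num [sq]
  rw [← hd]
  constructor
  · rintro ⟨z, hz, hz'⟩
    have h1 := dist_triangle_left p q z
    have h2 : dist z p ≤ 1 := hz
    have h3 : dist z q ≤ 1 := hz'
    linarith
  · intro h
    refine ⟨midpoint ℝ p q, ?_, ?_⟩
    · simp only [unitDisk, Metric.mem_closedBall, dist_midpoint_left, Real.norm_ofNat]
      linarith
    · simp only [unitDisk, Metric.mem_closedBall, dist_midpoint_right, Real.norm_ofNat]
      linarith

theorem unitSquare_inter_nonempty_iff {p q : Plane} :
    (unitSquare p ∩ unitSquare q).Nonempty ↔ |p 0 - q 0| ≤ 1 ∧ |p 1 - q 1| ≤ 1 := by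
  have key : (unitSquare p ∩ unitSquare q).Nonempty ↔ ∀ i, |p i - q i| ≤ 1 := by
    constructor
    · rintro ⟨z, hz, hz'⟩ i
      have h1 := abs_le.1 (hz i)
      have h2 := abs_le.1 (hz' i)
      rw [abs_le]
      constructor <;> linarith [h1.1, h1.2, h2.1, h2.2]
    · intro h
      refine ⟨WithLp.toLp 2 fun i => (p i + q i) / 2, fun i => ?_, fun i => ?_⟩ <;>
      · have h1 := abs_le.1 (h i)
        change |(p i + q i) / 2 - _| ≤ 1 / 2
        rw [abs_le]
        constructor <;> linarith [h1.1, h1.2]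
  rw [key, Fin.forall_fin_two]

/-- The point with the coordinates `x i` and `y i`. -/
noncomputable def pointAt (x y : ℕ → ℝ) (i : ℕ) : Plane := !₂[x i, y i]

@[simp] theorem pointAt_zero (x y : ℕ → ℝ) (i : ℕ) : pointAt x y i 0 = x i := rfl

@[simp] theorem pointAt_one (x y : ℕ → ℝ) (i : ℕ) : pointAt x y i 1 = y i := rfl

/-- The test `adj` decides whether two objects of the given shape intersect. Objects with
centres at distance at most `1` in both coordinates intersect, and those with centres at distance
more than `2` in some coordinate do not. -/
structure IsShapeTest (shape : Plane → Set Plane) (adj : Test) : Prop where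
  decides : ∀ x y, Decides adj x y fun i j =>
    (shape (pointAt x y i) ∩ shape (pointAt x y j)).Nonempty
  near : ∀ p q, |p 0 - q 0| ≤ 1 → |p 1 - q 1| ≤ 1 → (shape p ∩ shape q).Nonempty
  far : ∀ p q, (shape p ∩ shape q).Nonempty → |p 0 - q 0| ≤ 2 ∧ |p 1 - q 1| ≤ 2

theorem isShapeTest_unitDisk : IsShapeTest unitDisk diskTest where
  decides x y s hx hy := by
    refine Iff.trans ?_ unitDisk_inter_nonempty_iff.symm
    simp [diskTest, Test.Holds, RealExpr.eval, NatExpr.eval, hx, hy]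
  near p q h1 h2 := by
    rw [unitDisk_inter_nonempty_iff]
    rw [abs_le] at h1 h2
    nlinarith [h1.1, h1.2, h2.1, h2.2]
  far p q h := by
    rw [unitDisk_inter_nonempty_iff] at h
    constructor <;> refine abs_le_of_sq_le_sq ?_ (by norm_num) <;>
      nlinarith [mul_self_nonneg (p 0 - q 0), mul_self_nonneg (p 1 - q 1)]

theorem isShapeTest_unitSquare : IsShapeTest unitSquare squareTest where
  decides x y s hx hy := by
    refine Iff.trans ?_ unitSquare_inter_nonempty_iff.symm
    simp only [squareTest, Test.Holds, RealExpr.eval, NatExpr.eval, hx, hy, Rat.cast_one,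
      pointAt_zero, pointAt_one, abs_le]
    constructor
    · rintro ⟨⟨h1, h2⟩, h3, h4⟩
      exact ⟨⟨by linarith, h1⟩, by linarith, h3⟩
    · rintro ⟨⟨h1, h2⟩, h3, h4⟩
      exact ⟨⟨h2, by linarith⟩, h4, by linarith⟩
  near p q h1 h2 := unitSquare_inter_nonempty_iff.2 ⟨h1, h2⟩
  far p q h := by
    obtain ⟨h1, h2⟩ := unitSquare_inter_nonempty_iff.1 h
    exact ⟨by linarith, by linarith⟩

/-! ### Feasible sets and colourings -/

theorem tabulate_val {n : ℕ} (f : Fin n → ℝ) (i : Fin n) : tabulate f i = f i := by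
  simp [tabulate]

theorem pointAt_tabulate {n : ℕ} (c : Fin n → Plane) (i : Fin n) :
    pointAt (tabulate fun j => c j 0) (tabulate fun j => c j 1) i = c i := by
  ext k
  fin_cases k
  · exact tabulate_val (fun j => c j 0) i
  · exact tabulate_val (fun j => c j 1) i

section Feasible

variable {n : ℕ} {obj : Fin n → Set Plane} {E : ℕ → ℕ → Prop}

/-- The colours 1 and 2 are the two sides of the bipartition, and 0 means that the object is not
selected. `IsFeasible.exists_isColoring` is the converse, with the colours of `Fin 2` moved up by 1.
-/
theorem IsColoring.isFeasible {f : ℕ → ℕ} {P : ℕ → Prop} (hf : IsColoring n E P f)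
    (hE : ∀ i j : Fin n, (obj i ∩ obj j).Nonempty → E i j) :
    IsFeasible obj (Finset.univ.filter fun i : Fin n => f i ≠ 0) := by
  refine ⟨SimpleGraph.Coloring.mk (fun i => if f i.1 = 1 then (0 : Fin 2) else 1) ?_⟩
  rintro ⟨i, hi⟩ ⟨j, hj⟩ h heq
  simp only [Finset.coe_filter, Finset.mem_univ, true_and, Set.mem_ofPred_eq] at hi hj
  have h' : i ≠ j ∧ (obj i ∩ obj j).Nonempty := h
  have h1 := hf.le i
  have h2 := hf.le j
  refine hf.proper i j hi ?_ (fun he => h'.1 (Fin.ext he)) (hE i j h'.2)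
  by_cases h3 : f i = 1 <;> by_cases h4 : f j = 1
  · omega
  · simp [h3, h4] at heq
  · simp [h3, h4] at heq
  · omega

theorem IsFeasible.exists_isColoring {T : Finset (Fin n)} (hT : IsFeasible obj T)
    (hE : ∀ i j : Fin n, E i j → (obj i ∩ obj j).Nonempty) :
    ∃ f, IsColoring n E (fun _ => True) f ∧ ∀ i : Fin n, f i ≠ 0 ↔ i ∈ T := by
  classical
  obtain ⟨χ⟩ := hT
  let f : ℕ → ℕ := fun j =>
    if h : ∃ hj : j < n, (⟨j, hj⟩ : Fin n) ∈ T then (χ ⟨⟨j, h.1⟩, h.2⟩ : ℕ) + 1 else 0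
  have hf0 : ∀ j, f j ≠ 0 → ∃ hj : j < n, (⟨j, hj⟩ : Fin n) ∈ T := by
    intro j hj
    by_contra h
    exact hj (dif_neg h)
  have hf1 : ∀ j (h : ∃ hj : j < n, (⟨j, hj⟩ : Fin n) ∈ T),
      f j = (χ ⟨⟨j, h.1⟩, h.2⟩ : ℕ) + 1 := fun j h => dif_pos h
  refine ⟨f, ⟨fun j hj => (hf0 j hj).1, fun _ _ => trivial, fun j => ?_,
    fun i j hi hij hne hE' => ?_⟩, fun i => ⟨fun h => (hf0 i h).2, fun h => ?_⟩⟩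
  · by_cases h : ∃ hj : j < n, (⟨j, hj⟩ : Fin n) ∈ T
    · rw [hf1 j h]
      have := (χ ⟨⟨j, h.1⟩, h.2⟩).2
      omega
    · exact (dif_neg h).trans_le (Nat.zero_le 2)
  · have h1 := hf0 i hi
    have h2 := hf0 j (by rwa [← hij])
    rw [hf1 i h1, hf1 j h2] at hij
    have hadj : ((intersectionGraph obj).induce (T : Set (Fin n))).Adj
        ⟨⟨i, h1.1⟩, h1.2⟩ ⟨⟨j, h2.1⟩, h2.2⟩ :=
      ⟨fun h => hne (congrArg Fin.val h), hE _ _ hE'⟩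
    exact χ.valid hadj (Fin.ext (by omega))
  · rw [hf1 i ⟨i.2, h⟩]
    exact Nat.succ_ne_zero _

theorem colorWeight_eq_sum {w : ℕ → ℝ} {f : ℕ → ℕ} {T : Finset (Fin n)}
    (h : ∀ i : Fin n, f i ≠ 0 ↔ i ∈ T) : colorWeight n w f = ∑ i ∈ T, w i := by
  rw [colorWeight, Finset.sum_range, ← Finset.sum_filter_add_sum_filter_not _ (· ∈ T)]
  rw [Finset.sum_eq_zero (s := Finset.univ.filter fun i => i ∉ T), add_zero]
  · simp only [Finset.filter_mem_eq_inter, Finset.univ_inter]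
    exact Finset.sum_congr rfl fun i hi => if_neg ((h i).2 hi)
  · intro i hi
    simp only [Finset.mem_filter, Finset.mem_univ, true_and] at hi
    exact if_pos (by by_contra h'; exact hi ((h i).1 h'))

end Feasible

/-! ### The running time -/

/-- A bound for the number of shifts. -/
noncomputable def maxShifts (n : ℕ) (ε : ℝ) : ℕ := min (n + 1) ⌊2 + 1 / ε⌋₊

/-- A bound for the number of colourings in the table of the sweep. -/
noncomputable def tableBound (n : ℕ) (ε : ℝ) : ℕ := (n + 3) ^ (16 * maxShifts n ε + 1)

theorem withinTime_of_le {n C t : ℕ} {ε : ℝ} (hε : 0 < ε) (ht : t ≤ C * tableBound n ε ^ 8) :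
    WithinTime (C * 16 ^ 132) 792 384 n ε t := by
  set κ := maxShifts n ε with hκ
  have hκn : κ ≤ n + 1 := min_le_left _ _
  have hpos : 0 < 2 + 1 / ε := by positivity
  have hκε : (κ : ℝ) ≤ 2 + 1 / ε :=
    le_trans (by exact_mod_cast min_le_right _ _) (Nat.floor_le hpos.le)
  have ht' : (t : ℝ) ≤ C * ((n : ℝ) + 3) ^ (128 * κ + 8) := by
    have : tableBound n ε ^ 8 = (n + 3) ^ (128 * κ + 8) := by
      rw [tableBound, ← pow_mul]; congr 1; ring
    rw [this] at ht
    exact_mod_cast ht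
  have hC : (0 : ℝ) ≤ C := Nat.cast_nonneg C
  rw [WithinTime]
  rcases Nat.lt_or_ge n 2 with hn | hn
  -- Here the powers of `n` in the bound are 1, so `K` has to absorb everything: there are at most 2
  -- shifts, n + 3 ≤ 4, and 4 ^ (128 · 2 + 8) = 16 ^ 132.
  · have hmax : max n 1 = 1 := by omega
    rw [hmax, Nat.cast_one, Real.one_rpow, Real.one_rpow, mul_one, mul_one]
    refine ht'.trans (mul_le_mul_of_nonneg_left ?_ hC)
    have hn' : (n : ℝ) + 3 ≤ 4 := by
      have : (n : ℝ) ≤ 1 := by exact_mod_cast Nat.le_of_lt_succ hn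
      linarith
    calc ((n : ℝ) + 3) ^ (128 * κ + 8) ≤ 4 ^ (128 * κ + 8) :=
          pow_le_pow_left₀ (by positivity) hn' _
      _ = 16 ^ (64 * κ + 4) := by
          rw [show (16 : ℝ) = 4 ^ 2 by norm_num, ← pow_mul]; congr 1; ring
      _ ≤ 16 ^ 132 := pow_le_pow_right₀ (by norm_num) (by omega)
  -- With n + 3 ≤ n ^ 3 the exponent becomes 384κ + 24, and κ ≤ 2 + 1/ε turns it into 792 + 384/ε.
  · have hmax : max n 1 = n := by omega
    rw [hmax]
    have hn1 : (1 : ℝ) ≤ n := by exact_mod_cast (by omega : 1 ≤ n)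
    have hn3 : (n : ℝ) + 3 ≤ (n : ℝ) ^ 3 := by
      have : (2 : ℝ) ≤ n := by exact_mod_cast hn
      nlinarith [mul_self_nonneg ((n : ℝ) - 2), pow_succ (n : ℝ) 2]
    have hpow : ((n : ℝ) + 3) ^ (128 * κ + 8) ≤ (n : ℝ) ^ (792 : ℝ) * (n : ℝ) ^ (384 / ε) := by
      calc ((n : ℝ) + 3) ^ (128 * κ + 8) ≤ ((n : ℝ) ^ 3) ^ (128 * κ + 8) :=
            pow_le_pow_left₀ (by positivity) hn3 _
        _ = (n : ℝ) ^ ((384 * κ + 24 : ℕ) : ℝ) := by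
            rw [Real.rpow_natCast, ← pow_mul]; congr 1; ring
        _ ≤ (n : ℝ) ^ ((792 : ℝ) + 384 / ε) := by
            refine Real.rpow_le_rpow_of_exponent_le hn1 ?_
            have : 384 / ε = 384 * (1 / ε) := by ring
            push_cast
            linarith
        _ = _ := Real.rpow_add (by linarith) _ _
    calc (t : ℝ) ≤ C * ((n : ℝ) + 3) ^ (128 * κ + 8) := ht'
      _ ≤ C * ((n : ℝ) ^ (792 : ℝ) * (n : ℝ) ^ (384 / ε)) := mul_le_mul_of_nonneg_left hpow hC
      _ ≤ C * 16 ^ 132 * ((n : ℝ) ^ (792 : ℝ) * (n : ℝ) ^ (384 / ε)) := by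
          refine mul_le_mul_of_nonneg_right ?_ (by positivity)
          exact le_mul_of_one_le_right hC (one_le_pow₀ (by norm_num))
      _ = _ := by ring

theorem le_tableBound (n : ℕ) (ε : ℝ) : n + 3 ≤ tableBound n ε :=
  Nat.le_self_pow (by omega) _

theorem pow_le_tableBound {n k : ℕ} {ε : ℝ} (hk : k ≤ n + 1) (hkε : (k : ℝ) ≤ 2 + 1 / ε) :
    (n + 1) ^ (16 * k) ≤ tableBound n ε := by
  have hκ : k ≤ maxShifts n ε := le_min hk (Nat.le_floor hkε)
  calc (n + 1) ^ (16 * k) ≤ (n + 3) ^ (16 * k) := Nat.pow_le_pow_left (by omega) _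
    _ ≤ tableBound n ε := Nat.pow_le_pow_right (by omega) (by omega)

/-! ### The approximation schemes -/

theorem runs_schemeProg {shape : Plane → Set Plane} {adj : Test}
    (h : IsShapeTest shape adj) {n : ℕ} {ε : ℝ} (hε : 0 < ε) (c : Fin n → Plane) {w : ℕ → ℝ}
    {s : Store}
    (hs : HasInput n (tabulate fun j => c j 0) (tabulate fun j => c j 1) w s)
    (he : s.real 0 0 = ε) (h1 : s.nat 1 = 0) (h2 : s.nat 2 = 0) (h3 : s.nat 3 = 0) :
    Runs (schemeProg adj) ((adj.cost + 3000) * tableBound n ε ^ 8) s fun s' =>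
      IsFeasible (fun i => shape (c i)) (outputSet n s') ∧
      ∀ T : Finset (Fin n), IsFeasible (fun i => shape (c i)) T →
        ∑ i ∈ T, w i ≤ (1 + ε) * ∑ i ∈ outputSet n s', w i := by
  set x := tabulate fun j => c j 0
  set y := tabulate fun j => c j 1
  have hE : ∀ i j : Fin n, (shape (pointAt x y i) ∩ shape (pointAt x y j)).Nonempty ↔
      (shape (c i) ∩ shape (c j)).Nonempty := fun i j => by
    rw [pointAt_tabulate c i, pointAt_tabulate c j]
  have hb := le_tableBound n ε
  refine (Runs.schemeProg (M := tableBound n ε) (h.decides x y) hs hε he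
    (fun a b hab => by rwa [Set.inter_comm]) (fun i j _ _ hx hy => h.near _ _ hx hy)
    (fun i j _ _ hij => h.far _ _ hij) (by omega) (by omega)
    (fun k hk hkε => pow_le_tableBound hk hkε) h1 h2 h3).mono le_rfl ?_
  rintro s' ⟨hcol, hopt⟩
  have hout : ∀ i : Fin n, trunc n (s'.nat 1) i ≠ 0 ↔ i ∈ outputSet n s' := fun i => by
    simp [outputSet, trunc]
  refine ⟨?_, fun T hT => ?_⟩
  · have := hcol.isFeasible (obj := fun i => shape (c i)) fun i j hij => (hE i j).2 hij
    convert this using 1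
    ext i
    simp [← hout i]
  · obtain ⟨f, hf, hfT⟩ := hT.exists_isColoring
        (E := fun i j => (shape (pointAt x y i) ∩ shape (pointAt x y j)).Nonempty)
        fun i j hij => (hE i j).1 hij
    rw [← colorWeight_eq_sum hfT, ← colorWeight_eq_sum hout]
    exact hopt f hf

theorem isWeightedPTAS_schemeProg {shape : Plane → Set Plane} {adj : Test}
    (h : IsShapeTest shape adj) : IsWeightedPTAS shape (schemeProg adj) := by
  refine ⟨((adj.cost + 3000 : ℕ) : ℝ) * 16 ^ 132, 792, 384, fun ε hε n c w => ?_⟩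
  obtain ⟨t, s, hex, ht, hfeas, hopt⟩ := runs_schemeProg h hε c (w := tabulate w)
    (s := weightedInput ε c w) ⟨by simp [weightedInput], rfl, rfl, rfl⟩ (by simp [weightedInput])
    (by funext i; simp [weightedInput]) (by funext i; simp [weightedInput])
    (by funext i; simp [weightedInput])
  refine ⟨t, s, hex, withinTime_of_le hε ht, hfeas, fun T hT => ?_⟩
  simpa only [tabulate_val] using hopt T hT

theorem isPTAS_schemeProg {shape : Plane → Set Plane} {adj : Test} (h : IsShapeTest shape adj) :
    IsPTAS shape (.seq unitWeightsProg (schemeProg adj)) := by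
  refine ⟨((adj.cost + 3100 : ℕ) : ℝ) * 16 ^ 132, 792, 384, fun ε hε n c => ?_⟩
  set s := unweightedInput ε c with hs
  have hb := le_tableBound n ε
  have hn : s.nat 0 0 = n := by simp [hs, unweightedInput, weightedInput]
  -- Cardinality is weight with all weights 1; these are written into the weight array first.
  have hweights : Runs unitWeightsProg (50 * tableBound n ε ^ 1) s fun s' =>
      ∀ j < n, s'.real 3 j = 1 := by
    refine Runs.forFrom_pow (M := tableBound n ε) (by omega) (i := 1) (j := 0) (α := 20) 0 n
      (fun m s' => ∀ j < m, s'.real 3 j = 1) (Nat.zero_le _) (by rw [pow_one]; omega)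
      rfl (by simp) ?_ (by decide) (fun i s' x h => by simpa using h) ?_ (by simp) (by decide)
    · intro s' hF
      rw [eval_reg, hF.nat _ (by decide), hn]
    · intro m s' _ hm hrm hF hI
      refine Runs.of_loopFree_pow (by omega) rfl (by decide) fun j hj => ?_
      simp only [Prog.run, NatExpr.eval, RealExpr.eval, hrm, Store.writeReal_real_self]
      rcases Nat.lt_succ_iff_lt_or_eq.1 hj with h | rfl
      · rw [Function.update_of_ne h.ne, hI j h]
      · simp
  have key := Runs.seq_pow (M := tableBound n ε) (by omega) hweights (q := schemeProg adj)
    (β := adj.cost + 3000) (γ := adj.cost + 3100) (j := 8) (r := 8)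
    (Q := fun s' => IsFeasible (fun i => shape (c i)) (outputSet n s') ∧
      ∀ T : Finset (Fin n), IsFeasible (fun i => shape (c i)) T →
        (T.card : ℝ) ≤ (1 + ε) * ((outputSet n s').card : ℝ))
    (fun s₁ hw hF => ?_) (by simp) le_rfl (by omega)
  · obtain ⟨t, s', hex, ht, hfeas, hopt⟩ := key
    exact ⟨t, s', hex, withinTime_of_le hε ht, hfeas, hopt⟩
  -- Only the loop counter (array 18) and the weights have been touched, so the output and level
  -- arrays are still zero, as the scheme requires.
  · have f : ∀ a, a ≠ 18 → s₁.nat a = s.nat a := fun a ha =>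
      hF.nat a (by simpa [unitWeightsProg, forFrom, Prog.natWrites] using ha)
    have g : ∀ a, a ≠ 3 → s₁.real a = s.real a := fun a ha =>
      hF.real a (by simpa [unitWeightsProg, forFrom, Prog.realWrites] using ha)
    refine (runs_schemeProg h hε c (w := s₁.real 3)
      ⟨by rw [f 0 (by decide), hn], g 1 (by decide), g 2 (by decide), rfl⟩
      (by rw [g 0 (by decide)]; simp [hs, unweightedInput, weightedInput])
      (by rw [f 1 (by decide)]; funext i; simp [hs, unweightedInput, weightedInput])
      (by rw [f 2 (by decide)]; funext i; simp [hs, unweightedInput, weightedInput])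
      (by rw [f 3 (by decide)]; funext i; simp [hs, unweightedInput, weightedInput])).mono le_rfl ?_
    rintro s' ⟨hfeas, hopt⟩
    have hsum : ∀ T : Finset (Fin n), ∑ i ∈ T, s₁.real 3 i = T.card := fun T => by
      rw [Finset.sum_congr rfl fun (i : Fin n) _ => hw i i.2]
      simp
    simp only [hsum] at hopt
    exact ⟨hfeas, hopt⟩

theorem mainTheorem11 :
    (∃ P : RealRAM.Prog, IsPTAS unitSquare P) ∧
    (∃ P : RealRAM.Prog, IsWeightedPTAS unitDisk P) ∧
    (∃ P : RealRAM.Prog, IsWeightedPTAS unitSquare P) :=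
  ⟨⟨_, isPTAS_schemeProg isShapeTest_unitSquare⟩,
    ⟨_, isWeightedPTAS_schemeProg isShapeTest_unitDisk⟩,
    ⟨_, isWeightedPTAS_schemeProg isShapeTest_unitSquare⟩⟩
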